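/- Definitions. An entire function $E$ is in the Hermite–Biehler class $\mathcal{HB}$ if $|E(\bar z)|<|E(z)|$ for all $z$ with $\operatorname{Im} z>0$. Write $f^*(z)=\overline{f(\bar z)}$. For $E\in\mathcal{HB}$, the de Branges space $\mathcal H(E)$ consists of all entire functions $f$ with $\|f\|_E^2=\int_{\mathbb R}|f(t)/E(t)|^2\,dt<\infty$ such that $f/E$ and $f^*/E$ are of bounded type (quotients of bounded analytic functions) and of nonpositive mean type $\limsup_{y\to+\infty} y^{-1}\log|\cdot(iy)|$ in the upper half-plane. Its reproducing kernel is $$K_E(w,z)=\frac{\overline{E(w)}E(z)-E(\bar w)E^*(z)}{2\pi i(\bar w-z)},$$ extended continuously to $z=\bar w$. We write $\mathcal H(E_0)=\mathcal H(E)$ if the two spaces coincide as sets and have equivalent norms. If $E\in\mathcal{HB}$ has no real zeros, a phase function $\varphi_E$ of $E$ is a continuous, strictly increasing function $\varphi_E:\mathbb R\to\mathbb R$ with $E(x)=|E(x)|e^{-i\varphi_E(x)}$ for all real $x$; it exists, is differentiable, and is unique up to an additive multiple of $2\pi$. Theorem. Let $E_0,E,F\in\mathcal{HB}$ have no real zeros,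 let $\mathcal H(E_0)=\mathcal H(E)$, let $\varphi_E,\varphi_F,\varphi_{EF}$ be phase functions of $E$, $F$ and $EF$, and suppose that there is a constant $C$ with $\varphi_F'(x)\le C\varphi_E'(x)$ for all real $x$. Then there are constants $A,B>0$ such that for every $\alpha\in[0,\pi)$ the following holds. Let $\{\lambda_n\}$ be the sequence of real solutions of $\varphi_{EF}(\lambda_n)=n\pi+\alpha$, where $n$ runs over all integers for which a solution exists. Then $\{\lambda_n\}$ is a normalized sampling sequence for $\mathcal H(E_0)$ with bounds $A,B$, that is, $$A\|f\|_{E_0}^2\le\sum_n\frac{|f(\lambda_n)|^2}{K_{E_0}(\lambda_n,\lambda_n)}\le B\|f\|_{E_0}^2\qquad\text{for all } f\in\mathcal H(E_0).$$ -/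

import Mathlib

namespace DeBranges

open scoped ComplexConjugate

noncomputable section

/-- The open upper half-plane, as a subset of `ℂ`. -/
def upper : Set ℂ := {z | 0 < z.im}

/-- The Hermite–Biehler class: entire functions with `|E (conj z)| < |E z|` on the
open upper half-plane. -/
structure HermiteBiehler (E : ℂ → ℂ) : Prop where
  entire : Differentiable ℂ E
  lt : ∀ z ∈ upper, ‖E (conj z)‖ < ‖E z‖

/-- `f` has no zeros on the real line. -/
def NoRealZeros (f : ℂ → ℂ) : Prop := ∀ x : ℝ, f x ≠ 0

/-- `f^*(z) = conj (f (conj z))`. -/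
def star (f : ℂ → ℂ) : ℂ → ℂ := fun z => conj (f (conj z))

/-- An analytic function on the upper half-plane is of bounded type if it is a quotient `g / h`
of two bounded analytic functions there, the denominator not being identically zero. -/
def BoundedType (f : ℂ → ℂ) : Prop :=
  DifferentiableOn ℂ f upper ∧
  ∃ g h : ℂ → ℂ,
    DifferentiableOn ℂ g upper ∧ DifferentiableOn ℂ h upper ∧
    (∃ M : ℝ, ∀ z ∈ upper, ‖g z‖ ≤ M) ∧ (∃ M : ℝ, ∀ z ∈ upper, ‖h z‖ ≤ M) ∧
    (∃ z ∈ upper, h z ≠ 0) ∧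
    ∀ z ∈ upper, f z * h z = g z

/-- Mean type in the upper half-plane: `limsup_{y → +∞} log |f (i y)| / y`, as an extended real,
with `log 0 = -∞`. -/
def meanType (f : ℂ → ℂ) : EReal :=
  Filter.limsup (fun y : ℝ => ENNReal.log ‖f (y * Complex.I)‖ₑ / (y : EReal)) Filter.atTop

/-- The de Branges space `H(E)`, as a set of entire functions. -/
structure MemSpace (E f : ℂ → ℂ) : Prop where
  entire : Differentiable ℂ f
  integrable : MeasureTheory.Integrable (fun t : ℝ => ‖f t / E t‖ ^ 2)
  boundedType : BoundedType (fun z => f z / E z)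
  boundedType_star : BoundedType (fun z => star f z / E z)
  meanType_le : meanType (fun z => f z / E z) ≤ 0
  meanType_star_le : meanType (fun z => star f z / E z) ≤ 0

/-- The de Branges space `H(E)`. -/
def space (E : ℂ → ℂ) : Set (ℂ → ℂ) := {f | MemSpace E f}

/-- The squared norm `∫ |f / E|²` over the real line. -/
def normSq (E f : ℂ → ℂ) : ℝ := ∫ t : ℝ, ‖f t / E t‖ ^ 2

/-- The norm of `H(E)`. -/
def norm (E f : ℂ → ℂ) : ℝ := Real.sqrt (normSq E f)

/-- `H(E₁) = H(E₂)`: the two spaces coincide as sets and their norms are equivalent. -/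
def SameSpace (E₁ E₂ : ℂ → ℂ) : Prop :=
  space E₁ = space E₂ ∧
  ∃ c C : ℝ, 0 < c ∧ 0 < C ∧
    ∀ f ∈ space E₁, c * norm E₁ f ≤ norm E₂ f ∧ norm E₂ f ≤ C * norm E₁ f

/-- The numerator of the reproducing kernel, as a function of `z`. It vanishes at `z = conj w`. -/
def kernelNum (E : ℂ → ℂ) (w z : ℂ) : ℂ := conj (E w) * E z - E (conj w) * star E z

/-- The reproducing kernel of `H(E)`: the quotient
`(conj (E w) E z - E (conj w) E^* z) / (2 π i (conj w - z))`, extended continuously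
to `z = conj w`. -/
def kernel (E : ℂ → ℂ) (w z : ℂ) : ℂ :=
  if z = conj w then -deriv (kernelNum E w) z / (2 * Real.pi * Complex.I)
  else kernelNum E w z / (2 * Real.pi * Complex.I * (conj w - z))

/-- `φ` is a phase function of `E`. -/
structure IsPhase (E : ℂ → ℂ) (φ : ℝ → ℝ) : Prop where
  continuous : Continuous φ
  strictMono : StrictMono φ
  eq : ∀ x : ℝ, E x = ‖E x‖ * Complex.exp (-(Complex.I * φ x))

/-- The family `lam` of real points is a normalized sampling sequence for `H(E)`
with bounds `A` and `B`. For real `x` the number `kernel E x x` is real. -/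
def NormalizedSamplingWith (E : ℂ → ℂ) {ι : Type} (lam : ι → ℝ) (A B : ℝ) : Prop :=
  0 < A ∧ 0 < B ∧ ∀ f ∈ space E,
    Summable (fun n => ‖f (lam n)‖ ^ 2 / (kernel E (lam n) (lam n)).re) ∧
    A * norm E f ^ 2 ≤ ∑' n, ‖f (lam n)‖ ^ 2 / (kernel E (lam n) (lam n)).re ∧
    ∑' n, ‖f (lam n)‖ ^ 2 / (kernel E (lam n) (lam n)).re ≤ B * norm E f ^ 2

end

end DeBranges

/-! Multiplication by `F` maps the space of `E` isometrically into that of `EF`, because `fF/(EF) =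
f/E` on the real line. In the space of `EF` the points of phase `α` modulo `π` are the zeros of the
companion function `S = e^{iα}EF - e^{-iα}(EF)^*`. At a zero `x` of `S` the kernel of `EF` is a
constant multiple of `S(z)/(z - x)`, so the normalized kernels at the sampling points are
orthonormal (`orthonormal_unitKernel`). Bessel's inequality for `fF` is then the upper sampling
bound. The lower bound can fail only through the remainder of the orthonormal expansion, which
vanishes at all sampling points and is therefore a multiple of `S`
(`MemHardy.exists_eq_const_mul_companion`).

`S` lies in the space for at most one phase modulo `π` (`sin_sub_eq_zero_of_memHardy_companion`).
For that phase, `S` is not `F` times an element of the space of `E`, since otherwise `F/F^*` would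
be a constant (`companion_toL2_notMem`). The space of `E` is closed in `L²`, so its angle with `S`
is positive, and the remainder takes at most a fixed fraction of the norm. Since one phase at most
is exceptional, the constant is uniform in `α` (`exists_sampling_mul`).

It remains to exchange the weights. On the diagonal `K_{EF} = |F|²K_E + |E|²K_F`, and `φ_E' =
πK_E/|E|²` (`IsPhase.hasDerivAt`). Hence the bound on `φ_F'/φ_E'` says exactly that `K_{EF}` is
comparable with `|F|²K_E`. Equivalence of norms makes `K_E` comparable with `K_{E₀}`
(`kernel_self_re_le`).

The analytic groundwork is a Smirnov-type theorem (`norm_le_of_boundedType`): bounded type,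
nonpositive mean type and square integrable boundary values give `|f/E| ≤ ‖f‖/√(π im z)`. The
reproducing formula and completeness rest on this estimate and on a Cauchy theorem for functions of
controlled growth. -/

namespace DeBranges

open scoped ComplexConjugate
open Complex MeasureTheory Filter Topology Set

/-! ### Cauchy's theorem on half-discs and, under growth conditions, on the real line. -/

/-- Cauchy's theorem for a half-annulus in the closed upper half-plane. -/
theorem integral_halfAnnulus_eq_zero {f : ℂ → ℂ} {r R : ℝ} (hr : 0 < r) (hrR : r ≤ R)
    (hc : ContinuousOn f {z | 0 ≤ z.im ∧ ‖z‖ ≤ R})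
    (hd : DifferentiableOn ℂ f {z | 0 < z.im ∧ ‖z‖ < R}) :
    (∫ t in r..R, f t) + (∫ t in r..R, f (-t)) +
      (I * ∫ θ in (0 : ℝ)..Real.pi, f (R * exp (θ * I)) * (R * exp (θ * I))) -
      (I * ∫ θ in (0 : ℝ)..Real.pi, f (r * exp (θ * I)) * (r * exp (θ * I))) = 0 := by
  have hR : 0 < R := hr.trans_le hrR
  have hlog : Real.log r ≤ Real.log R := Real.log_le_log hr hrR
  have him : ∀ ζ : ℂ, 0 ≤ ζ.im → ζ.im ≤ Real.pi → 0 ≤ (exp ζ).im := fun ζ h0 h1 => by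
    rw [exp_im]
    exact mul_nonneg (Real.exp_pos _).le (Real.sin_nonneg_of_nonneg_of_le_pi h0 h1)
  have hre : ∀ ζ : ℂ, ζ.re ≤ Real.log R → ‖exp ζ‖ ≤ R := fun ζ h => by
    rw [norm_exp]; exact (Real.le_log_iff_exp_le hR).1 h
  -- The half-annulus is the image under `exp` of the rectangle `[log r, log R] × [0, π]`, and
  -- `f(exp ζ) exp ζ` is the pulled-back integrand.
  have key := integral_boundary_rect_eq_zero_of_continuousOn_of_differentiableOn
    (fun ζ => f (exp ζ) * exp ζ) (Real.log r : ℂ) (Real.log R + Real.pi * I)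
    (by
      simp only [ofReal_re, ofReal_im, add_re, add_im, mul_re, mul_im, I_re, I_im, mul_zero,
        mul_one, sub_zero, add_zero, zero_add]
      rw [uIcc_of_le hlog, uIcc_of_le Real.pi_pos.le]
      refine ContinuousOn.mul (hc.comp continuous_exp.continuousOn ?_) continuous_exp.continuousOn
      rintro ζ ⟨h1, h2⟩
      exact ⟨him ζ h2.1 h2.2, hre ζ h1.2⟩)
    (by
      simp only [ofReal_re, ofReal_im, add_re, add_im, mul_re, mul_im, I_re, I_im, mul_zero,
        mul_one, sub_zero, add_zero, zero_add]
      rw [min_eq_left hlog, max_eq_right hlog, min_eq_left Real.pi_pos.le,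
        max_eq_right Real.pi_pos.le]
      refine DifferentiableOn.mul (hd.comp differentiable_exp.differentiableOn ?_)
        differentiable_exp.differentiableOn
      rintro ζ ⟨h1, h2⟩
      refine ⟨?_, ?_⟩
      · rw [exp_im]
        exact mul_pos (Real.exp_pos _) (Real.sin_pos_of_pos_of_lt_pi h2.1 h2.2)
      · rw [norm_exp]; exact (Real.lt_log_iff_exp_lt hR).1 h1.2)
  simp only [ofReal_re, ofReal_im, add_re, add_im, mul_re, mul_im, I_re, I_im, mul_zero,
        mul_one, sub_zero, add_zero, zero_add, ofReal_zero, zero_mul, smul_eq_mul] at key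
  have eR : ∀ θ : ℝ, exp ((Real.log R : ℝ) + θ * I) = R * exp (θ * I) := fun θ => by
    rw [exp_add, ← ofReal_exp, Real.exp_log hR]
  have er : ∀ θ : ℝ, exp ((Real.log r : ℝ) + θ * I) = r * exp (θ * I) := fun θ => by
    rw [exp_add, ← ofReal_exp, Real.exp_log hr]
  simp only [eR, er] at key
  have hexpR : Real.exp (Real.log R) = R := Real.exp_log hR
  have hexpr : Real.exp (Real.log r) = r := Real.exp_log hr
  have hmem : ∀ x ∈ Real.exp '' uIcc (Real.log r) (Real.log R), 0 ≤ x ∧ x ≤ R := by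
    rw [uIcc_of_le hlog]
    rintro _ ⟨x, hx, rfl⟩
    exact ⟨(Real.exp_pos _).le, (Real.le_log_iff_exp_le hR).1 hx.2⟩
  have c1 : (∫ x in Real.log r..Real.log R, f (exp (x : ℂ)) * exp (x : ℂ)) = ∫ t in r..R, f t := by
    have := intervalIntegral.integral_deriv_smul_comp' (a := Real.log r) (b := Real.log R)
      (f := Real.exp) (f' := Real.exp) (g := fun t : ℝ => f t)
      (fun x _ => Real.hasDerivAt_exp x) Real.continuous_exp.continuousOn
      (by
        refine hc.comp continuous_ofReal.continuousOn ?_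
        intro x hx
        obtain ⟨h0, h1⟩ := hmem x hx
        simpa [abs_of_nonneg h0] using h1)
    rw [hexpR, hexpr] at this
    rw [← this]
    refine intervalIntegral.integral_congr fun x _ => ?_
    simp [mul_comm]
  have c2 : (∫ x in Real.log r..Real.log R, f (exp (x + Real.pi * I)) * exp (x + Real.pi * I))
      = - ∫ t in r..R, f (-t) := by
    have := intervalIntegral.integral_deriv_smul_comp' (a := Real.log r) (b := Real.log R)
      (f := Real.exp) (f' := Real.exp) (g := fun t : ℝ => f (-t))
      (fun x _ => Real.hasDerivAt_exp x) Real.continuous_exp.continuousOn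
      (by
        refine hc.comp (continuous_ofReal.neg).continuousOn ?_
        intro x hx
        obtain ⟨h0, h1⟩ := hmem x hx
        simpa [abs_of_nonneg h0] using h1)
    rw [hexpR, hexpr] at this
    rw [← this, ← intervalIntegral.integral_neg]
    refine intervalIntegral.integral_congr fun x _ => ?_
    simp only [exp_add, exp_pi_mul_I, Function.comp_apply, real_smul, ofReal_exp]
    ring_nf
  rw [c1, c2] at key
  rw [← key]; ring

/-- Cauchy's theorem for a half-disc in the closed upper half-plane. -/
theorem integral_halfDisc_eq_zero {f : ℂ → ℂ} {R : ℝ} (hR : 0 < R)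
    (hc : ContinuousOn f {z | 0 ≤ z.im ∧ ‖z‖ ≤ R})
    (hd : DifferentiableOn ℂ f {z | 0 < z.im ∧ ‖z‖ < R}) :
    (∫ t in -R..R, f t) +
      I * ∫ θ in (0 : ℝ)..Real.pi, f (R * exp (θ * I)) * (R * exp (θ * I)) = 0 := by
  have hK : IsCompact {z : ℂ | 0 ≤ z.im ∧ ‖z‖ ≤ R} := by
    have : {z : ℂ | 0 ≤ z.im ∧ ‖z‖ ≤ R} = {z | 0 ≤ z.im} ∩ Metric.closedBall 0 R := by
      ext; simp
    rw [this]
    exact (isCompact_closedBall _ _).inter_left (isClosed_le continuous_const continuous_im)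
  obtain ⟨M, hM⟩ := hK.exists_bound_of_continuousOn hc
  have hmem : ∀ t : ℝ, |t| ≤ R → (t : ℂ) ∈ {z : ℂ | 0 ≤ z.im ∧ ‖z‖ ≤ R} := fun t ht => by
    simpa using ht
  have hM0 : 0 ≤ M := (norm_nonneg _).trans (hM 0 (by simpa using hR.le))
  have hcr : ContinuousOn (fun t : ℝ => f t) (uIcc (-R) R) := by
    refine hc.comp continuous_ofReal.continuousOn fun t ht => hmem t ?_
    rw [uIcc_of_le (by linarith)] at ht
    exact abs_le.2 ht
  have hint : ∀ a b : ℝ, |a| ≤ R → |b| ≤ R → IntervalIntegrable (fun t : ℝ => f t) volume a b := by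
    intro a b ha hb
    refine (hcr.mono ?_).intervalIntegrable
    refine uIcc_subset_uIcc ?_ ?_ <;> rw [uIcc_of_le (by linarith)] <;> [exact abs_le.1 ha; exact abs_le.1 hb]
  set X := (∫ t in -R..R, f t) +
      I * ∫ θ in (0 : ℝ)..Real.pi, f (R * exp (θ * I)) * (R * exp (θ * I)) with hX
  -- By the half-annulus case `X` equals the same expression over the half-disc of radius `r`, which
  -- is `O(r)` since `f` is bounded.
  have bound : ∀ r : ℝ, 0 < r → r ≤ R → ‖X‖ ≤ (2 * M + Real.pi * M) * r := by
    intro r hr hrR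
    have h := integral_halfAnnulus_eq_zero hr hrR hc hd
    have e1 : (∫ t in r..R, f (-t)) = ∫ t in -R..-r, f t := by
      have := intervalIntegral.integral_comp_neg (a := r) (b := R) (fun t : ℝ => f t)
      simpa using this
    have hr' : |r| ≤ R := by rwa [abs_of_pos hr]
    have e2 : (∫ t in -R..R, f t) = (∫ t in -R..-r, f t) + (∫ t in -r..r, f t) + ∫ t in r..R, f t := by
      rw [intervalIntegral.integral_add_adjacent_intervals,
        intervalIntegral.integral_add_adjacent_intervals] <;> apply hint <;>
        simp [abs_of_pos hR, hr']
    have e3 : X = (∫ t in -r..r, f t) +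
        I * ∫ θ in (0 : ℝ)..Real.pi, f (r * exp (θ * I)) * (r * exp (θ * I)) := by
      rw [hX, e2, ← e1]; linear_combination h
    have b1 : ‖∫ t in -r..r, f t‖ ≤ M * |r - -r| := by
      refine intervalIntegral.norm_integral_le_of_norm_le_const fun t ht => hM _ (hmem t ?_)
      rw [uIoc_of_le (by linarith)] at ht
      exact (abs_le.2 ⟨ht.1.le, ht.2⟩).trans hrR
    have b2 : ‖∫ θ in (0 : ℝ)..Real.pi, f (r * exp (θ * I)) * (r * exp (θ * I))‖
        ≤ M * r * |Real.pi - 0| := by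
      refine intervalIntegral.norm_integral_le_of_norm_le_const fun t ht => ?_
      rw [uIoc_of_le Real.pi_pos.le] at ht
      have hn : ‖(r : ℂ) * exp (t * I)‖ = r := by
        rw [norm_mul, norm_exp_ofReal_mul_I, mul_one, norm_real, Real.norm_of_nonneg hr.le]
      rw [norm_mul, hn]
      refine mul_le_mul_of_nonneg_right (hM _ ⟨?_, by rw [hn]; exact hrR⟩) hr.le
      rw [im_ofReal_mul, exp_ofReal_mul_I_im]
      exact mul_nonneg hr.le (Real.sin_nonneg_of_nonneg_of_le_pi ht.1.le ht.2)
    rw [e3]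
    refine (norm_add_le _ _).trans ?_
    rw [norm_mul, norm_I, one_mul]
    rw [sub_neg_eq_add, abs_of_pos (by linarith)] at b1
    rw [sub_zero, abs_of_pos Real.pi_pos] at b2
    linarith
  by_contra hne
  have hpos : 0 < ‖X‖ := norm_pos_iff.2 hne
  have hpi := Real.pi_pos
  have hlim : Tendsto (fun r : ℝ => (2 * M + Real.pi * M) * r) (𝓝[>] 0) (𝓝 0) := by
    have : Tendsto (fun r : ℝ => (2 * M + Real.pi * M) * r) (𝓝 0) (𝓝 ((2 * M + Real.pi * M) * 0)) :=
      (continuous_const.mul continuous_id).tendsto 0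
    rw [mul_zero] at this
    exact this.mono_left nhdsWithin_le_nhds
  have : ‖X‖ ≤ 0 := ge_of_tendsto hlim (by
    filter_upwards [Ioc_mem_nhdsGT hR] with r hr using bound r hr.1 hr.2)
  linarith

/-- The exponent whose exponential, for `0 < im z` and `‖z‖ = R`, has modulus
`exp (-K (1 + R²) / im z)`, while it is unimodular on the real line. -/
noncomputable def dampingExponent (K R : ℝ) (z : ℂ) : ℂ :=
  2 * I * K * (1 + R ^ 2) * z / (R ^ 2 - z ^ 2)

theorem re_dampingExponent (K R : ℝ) (z : ℂ) :
    (dampingExponent K R z).re =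
      -(2 * K * (1 + R ^ 2) * (z.im * (R ^ 2 + ‖z‖ ^ 2)) / Complex.normSq ((R : ℂ) ^ 2 - z ^ 2)) := by
  have h : dampingExponent K R z =
      (2 * K * (1 + R ^ 2) / Complex.normSq ((R : ℂ) ^ 2 - z ^ 2) : ℝ) *
        (I * (z * conj ((R : ℂ) ^ 2 - z ^ 2))) := by
    rw [dampingExponent, div_eq_mul_inv, inv_def]
    push_cast
    ring
  rw [h, re_ofReal_mul, I_mul_re, ← Complex.normSq_eq_norm_sq, Complex.normSq_apply z]
  simp only [mul_im, map_sub, sub_re, sub_im, pow_two, mul_re, conj_re,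
    conj_im, ofReal_re, ofReal_im]
  ring

theorem norm_exp_dampingExponent_le_one {K R : ℝ} (hK : 0 ≤ K) {z : ℂ} (hz : 0 ≤ z.im) :
    ‖exp (dampingExponent K R z)‖ ≤ 1 := by
  rw [norm_exp, re_dampingExponent, Real.exp_le_one_iff, neg_nonpos]
  have := Complex.normSq_nonneg ((R : ℂ) ^ 2 - z ^ 2)
  positivity

theorem norm_exp_dampingExponent_real (K R t : ℝ) :
    ‖exp (dampingExponent K R t)‖ = 1 := by
  rw [norm_exp, re_dampingExponent]
  simp

/-- On the circle `|R² - z²| = 2R|im z|`, so the damping has exactly the form of the growth to be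
beaten, uniformly down to the real line. -/
theorem norm_exp_dampingExponent_circle {K R : ℝ} {z : ℂ} (hz : 0 < z.im) (hR : ‖z‖ = R) :
    ‖exp (dampingExponent K R z)‖ = Real.exp (-(K * (1 + ‖z‖ ^ 2) / z.im)) := by
  have hn : Complex.normSq ((R : ℂ) ^ 2 - z ^ 2) = 4 * R ^ 2 * z.im ^ 2 := by
    have h2 : R ^ 2 = z.re ^ 2 + z.im ^ 2 := by
      rw [← hR, ← Complex.normSq_eq_norm_sq, Complex.normSq_apply]; ring
    have : (R : ℂ) ^ 2 = ((z.re ^ 2 + z.im ^ 2 : ℝ) : ℂ) := by rw [← h2]; push_cast; ring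
    rw [h2, this, Complex.normSq_apply]
    simp only [sub_re, sub_im, pow_two, mul_re, mul_im, ofReal_re, ofReal_im]
    ring
  have hR0 : 0 < R := by rw [← hR]; exact norm_pos_iff.2 (fun h => by simp [h] at hz)
  rw [norm_exp, re_dampingExponent, hn, hR]
  congr 1
  field_simp
  ring

/-- The damping does not disappear as `R → ∞`; what survives is the factor `exp(2iK't)` in
`integral_mul_exp_eq_zero`. -/
theorem tendsto_dampingExponent (K : ℝ) (z : ℂ) :
    Tendsto (fun R : ℝ => dampingExponent K R z) atTop (𝓝 (2 * I * K * z)) := by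
  have h0 : Tendsto (fun R : ℝ => ((R : ℂ) ^ 2)⁻¹) atTop (𝓝 0) := by
    have : Tendsto (fun R : ℝ => (R ^ 2)⁻¹) atTop (𝓝 0) :=
      tendsto_inv_atTop_zero.comp (tendsto_pow_atTop two_ne_zero)
    have := (continuous_ofReal.tendsto 0).comp this
    simpa [Function.comp_def] using this
  have h1 : Tendsto (fun R : ℝ => 2 * I * K * z * (((R : ℂ) ^ 2)⁻¹ + 1) /
      (1 - z ^ 2 * ((R : ℂ) ^ 2)⁻¹)) atTop (𝓝 (2 * I * K * z * (0 + 1) / (1 - z ^ 2 * 0))) :=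
    ((h0.add_const 1).const_mul _).div ((h0.const_mul (z ^ 2)).const_sub 1) (by simp)
  simp only [zero_add, mul_one, mul_zero, sub_zero, div_one] at h1
  refine h1.congr' ?_
  filter_upwards [eventually_gt_atTop 0] with R hR
  have hR' : (R : ℂ) ≠ 0 := by exact_mod_cast hR.ne'
  have hR2 : (R : ℂ) ^ 2 ≠ 0 := pow_ne_zero 2 hR'
  rw [dampingExponent]
  have e1 : 1 - z ^ 2 * ((R : ℂ) ^ 2)⁻¹ = ((R : ℂ) ^ 2)⁻¹ * (R ^ 2 - z ^ 2) := by
    field_simp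
  have e2 : 2 * I * K * z * (((R : ℂ) ^ 2)⁻¹ + 1) = ((R : ℂ) ^ 2)⁻¹ * (2 * I * K * (1 + R ^ 2) * z) := by
    field_simp
  rw [e1, e2, mul_div_mul_left _ _ (inv_ne_zero hR2)]

theorem im_mul_norm_le {z : ℂ} (hz : 0 < z.im) : ‖z‖ ≤ (1 + ‖z‖ ^ 2) / z.im := by
  rw [le_div_iff₀ hz]
  have h1 : z.im ≤ ‖z‖ := (le_abs_self _).trans (abs_im_le_norm z)
  nlinarith [norm_nonneg z]

/-- A Phragmén–Lindelöf type version of Cauchy's theorem in the upper half-plane. -/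
theorem integral_mul_exp_eq_zero {v : ℂ → ℂ} {M K K' : ℝ}
    (hd : ∀ z : ℂ, 0 ≤ z.im → DifferentiableAt ℂ v z)
    (hb : ∀ z : ℂ, 0 < z.im → ‖v z‖ ≤ M * Real.exp (K * (1 + ‖z‖ ^ 2) / z.im))
    (hi : Integrable (fun t : ℝ => v t)) (hK' : 0 ≤ K') (hKK : K < K') :
    ∫ t : ℝ, v t * exp (2 * I * K' * t) = 0 := by
  have hM : 0 ≤ M := by
    have := (norm_nonneg _).trans (hb I (by simp))
    exact nonneg_of_mul_nonneg_left this (Real.exp_pos _)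
  -- The factor `1 - z²/R²` vanishes at the poles `±R` of the exponent. The damping is bounded by
  -- `1` in the closed half-plane, so `f R` is continuous there with value `0` at `±R`.
  let f : ℝ → ℂ → ℂ := fun R z => v z * exp (dampingExponent K' R z) * (1 - z ^ 2 / R ^ 2)
  have hden : ∀ {R : ℝ} {z : ℂ}, 0 < R → (z ^ 2 - (R : ℂ) ^ 2 = 0 ↔ z = R ∨ z = -R) := by
    intro R z _
    rw [sub_eq_zero, sq_eq_sq_iff_eq_or_eq_neg]
  have hdf : ∀ {R : ℝ} {z : ℂ}, 0 < R → 0 ≤ z.im → z ^ 2 - (R : ℂ) ^ 2 ≠ 0 →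
      DifferentiableAt ℂ (f R) z := by
    intro R z hR hz hne
    have hne' : (R : ℂ) ^ 2 - z ^ 2 ≠ 0 := fun h => hne (by linear_combination -h)
    have : DifferentiableAt ℂ (dampingExponent K' R) z := by
      unfold dampingExponent
      fun_prop (disch := assumption)
    exact ((hd z hz).mul this.cexp).mul (by fun_prop)
  have hcf : ∀ {R : ℝ}, 0 < R → ContinuousOn (f R) {z | 0 ≤ z.im ∧ ‖z‖ ≤ R} := by
    intro R hR z hz
    by_cases hne : z ^ 2 - (R : ℂ) ^ 2 = 0
    · have hR' : (R : ℂ) ^ 2 ≠ 0 := pow_ne_zero 2 (by exact_mod_cast hR.ne')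
      have h1 : 1 - z ^ 2 / (R : ℂ) ^ 2 = 0 := by
        rw [sub_eq_zero.1 hne, div_self hR', sub_self]
      have h0 : f R z = 0 := by simp only [f]; rw [h1, mul_zero]
      rw [ContinuousWithinAt, h0]
      have hlim : Tendsto (fun w : ℂ => ‖v w‖ * ‖1 - w ^ 2 / (R : ℂ) ^ 2‖)
          (𝓝[{z | 0 ≤ z.im ∧ ‖z‖ ≤ R}] z) (𝓝 0) := by
        have : ContinuousAt (fun w : ℂ => ‖v w‖ * ‖1 - w ^ 2 / (R : ℂ) ^ 2‖) z :=
          (hd z hz.1).continuousAt.norm.mul (by fun_prop)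
        have h2 := this.tendsto
        rw [h1, norm_zero, mul_zero] at h2
        exact h2.mono_left nhdsWithin_le_nhds
      refine squeeze_zero_norm' ?_ hlim
      filter_upwards [self_mem_nhdsWithin] with w hw
      simp only [f, norm_mul]
      refine mul_le_mul_of_nonneg_right ?_ (norm_nonneg _)
      exact mul_le_of_le_one_right (norm_nonneg _) (norm_exp_dampingExponent_le_one hK' hw.1)
    · exact (hdf hR hz.1 hne).continuousAt.continuousWithinAt
  have hdo : ∀ {R : ℝ}, 0 < R → DifferentiableOn ℂ (f R) {z | 0 < z.im ∧ ‖z‖ < R} := by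
    intro R hR z hz
    refine (hdf hR hz.1.le fun h => ?_).differentiableWithinAt
    rcases (hden hR).1 h with h | h <;> · have := hz.1; rw [h] at this; simp at this
  -- Growth at rate `K` against damping at rate `K'` leaves `exp(-(K' - K)(1 + R²)/im z)`, and `(1 +
  -- R²)/im z ≥ R`.
  have harc : ∀ {R : ℝ}, 0 < R → ∀ z : ℂ, 0 ≤ z.im → ‖z‖ = R →
      ‖f R z‖ ≤ 2 * M * Real.exp (-((K' - K) * R)) := by
    intro R hR z hz hzR
    have hR' : (R : ℂ) ^ 2 ≠ 0 := pow_ne_zero 2 (by exact_mod_cast hR.ne')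
    rcases hz.eq_or_lt with h0 | h0
    · have : z ^ 2 = (R : ℂ) ^ 2 := by
        have hre : z = (z.re : ℂ) := by apply Complex.ext <;> simp [← h0]
        have : z.re ^ 2 = R ^ 2 := by
          rw [← hzR, ← Complex.normSq_eq_norm_sq, Complex.normSq_apply, ← h0]; ring
        rw [hre]; exact_mod_cast this
      have : f R z = 0 := by simp only [f]; rw [this, div_self hR', sub_self, mul_zero]
      rw [this, norm_zero]; positivity
    · have h1 : ‖1 - z ^ 2 / (R : ℂ) ^ 2‖ ≤ 2 := by
        refine (norm_sub_le _ _).trans ?_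
        rw [norm_one, norm_div, norm_pow, norm_pow, hzR, norm_real, Real.norm_of_nonneg hR.le,
          div_self (by positivity)]
        norm_num
      simp only [f, norm_mul]
      rw [norm_exp_dampingExponent_circle h0 hzR]
      have h2 : ‖v z‖ * Real.exp (-(K' * (1 + ‖z‖ ^ 2) / z.im)) ≤ M * Real.exp (-((K' - K) * R)) := by
        refine (mul_le_mul_of_nonneg_right (hb z h0) (Real.exp_pos _).le).trans ?_
        rw [mul_assoc, ← Real.exp_add]
        refine mul_le_mul_of_nonneg_left (Real.exp_le_exp.2 ?_) hM
        have := mul_le_mul_of_nonneg_left (im_mul_norm_le h0) (sub_pos.2 hKK).le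
        rw [hzR] at this ⊢
        have e : K * (1 + R ^ 2) / z.im + -(K' * (1 + R ^ 2) / z.im) =
          -((K' - K) * ((1 + R ^ 2) / z.im)) := by ring
        rw [e]; linarith
      calc _ ≤ M * Real.exp (-((K' - K) * R)) * 2 :=
            mul_le_mul h2 h1 (norm_nonneg _) (by positivity)
        _ = _ := by ring
  have hseg : ∀ {R : ℝ}, 0 < R →
      ‖∫ t in -R..R, f R t‖ ≤ 2 * M * Real.exp (-((K' - K) * R)) * R * Real.pi := by
    intro R hR
    have h := integral_halfDisc_eq_zero hR (hcf hR) (hdo hR)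
    rw [add_eq_zero_iff_eq_neg] at h
    rw [h, norm_neg, norm_mul, norm_I, one_mul]
    have := intervalIntegral.norm_integral_le_of_norm_le_const (a := (0 : ℝ)) (b := Real.pi)
      (C := 2 * M * Real.exp (-((K' - K) * R)) * R)
      (f := fun θ : ℝ => f R (R * exp (θ * I)) * (R * exp (θ * I))) (fun t ht => by
        rw [uIoc_of_le Real.pi_pos.le] at ht
        have hn : ‖(R : ℂ) * exp (t * I)‖ = R := by
          rw [norm_mul, norm_exp_ofReal_mul_I, mul_one, norm_real, Real.norm_of_nonneg hR.le]
        rw [norm_mul, hn]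
        refine mul_le_mul_of_nonneg_right (harc hR _ ?_ hn) hR.le
        rw [im_ofReal_mul, exp_ofReal_mul_I_im]
        exact mul_nonneg hR.le (Real.sin_nonneg_of_nonneg_of_le_pi ht.1.le ht.2))
    rwa [sub_zero, abs_of_pos Real.pi_pos] at this
  have hzero : Tendsto (fun R : ℝ => ∫ t in -R..R, f R t) atTop (𝓝 0) := by
    have hκ : 0 < K' - K := sub_pos.2 hKK
    have h1 : Tendsto (fun R : ℝ => (2 * M * Real.pi) * (R * Real.exp (-((K' - K) * R)))) atTop
        (𝓝 ((2 * M * Real.pi) * 0)) := by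
      refine Tendsto.const_mul _ ?_
      have := (Real.tendsto_pow_mul_exp_neg_atTop_nhds_zero 1).comp
        (tendsto_id.const_mul_atTop hκ)
      have h2 := this.const_mul (K' - K)⁻¹
      rw [mul_zero] at h2
      refine h2.congr fun R => ?_
      simp only [Function.comp_apply, id, pow_one]
      field_simp
    rw [mul_zero] at h1
    refine squeeze_zero_norm' ?_ h1
    filter_upwards [eventually_gt_atTop 0] with R hR
    refine (hseg hR).trans (le_of_eq (by ring))
  have hlim : Tendsto (fun R : ℝ => ∫ t in -R..R, f R t) atTop
      (𝓝 (∫ t : ℝ, v t * exp (2 * I * K' * t))) := by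
    have hdom : Tendsto (fun R : ℝ => ∫ t : ℝ, (Ioc (-R) R).indicator (fun t : ℝ => f R t) t) atTop
        (𝓝 (∫ t : ℝ, v t * exp (2 * I * K' * t))) := by
      refine tendsto_integral_filter_of_dominated_convergence (fun t => ‖v t‖) ?_ ?_ hi.norm ?_
      · filter_upwards [eventually_gt_atTop 0] with R hR
        rw [aestronglyMeasurable_indicator_iff measurableSet_Ioc]
        refine ContinuousOn.aestronglyMeasurable ?_ measurableSet_Ioc
        refine (hcf hR).comp continuous_ofReal.continuousOn fun t ht => ?_
        simpa using abs_le.2 ⟨ht.1.le, ht.2⟩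
      · filter_upwards [eventually_gt_atTop 0] with R hR
        refine Eventually.of_forall fun t => ?_
        by_cases ht : t ∈ Ioc (-R) R
        · rw [indicator_of_mem ht]
          simp only [f, norm_mul, norm_exp_dampingExponent_real, mul_one]
          refine mul_le_of_le_one_right (norm_nonneg _) ?_
          have hle : t ^ 2 / R ^ 2 ≤ 1 := by
            rw [div_le_one (by positivity)]
            exact sq_le_sq' ht.1.le ht.2
          have : (1 - (t : ℂ) ^ 2 / (R : ℂ) ^ 2) = ((1 - t ^ 2 / R ^ 2 : ℝ) : ℂ) := by push_cast; ring
          rw [this, norm_real, Real.norm_of_nonneg (by linarith)]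
          have : 0 ≤ t ^ 2 / R ^ 2 := by positivity
          linarith
        · rw [indicator_of_notMem ht, norm_zero]; exact norm_nonneg _
      · refine Eventually.of_forall fun t => ?_
        have h0 : Tendsto (fun R : ℝ => 1 - (t : ℂ) ^ 2 / (R : ℂ) ^ 2) atTop (𝓝 1) := by
          have : Tendsto (fun R : ℝ => 1 - t ^ 2 / R ^ 2) atTop (𝓝 (1 - 0)) :=
            Tendsto.const_sub 1 (Tendsto.const_div_atTop (tendsto_pow_atTop two_ne_zero) _)
          have := (continuous_ofReal.tendsto _).comp this
          simpa [Function.comp_def] using this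
        have h1 : Tendsto (fun R : ℝ => f R t) atTop (𝓝 (v t * exp (2 * I * K' * t) * 1)) :=
          (((continuous_exp.tendsto _).comp (tendsto_dampingExponent K' t)).const_mul _).mul h0
        rw [mul_one] at h1
        refine h1.congr' ?_
        filter_upwards [eventually_gt_atTop |t|] with R hR
        rw [indicator_of_mem]
        exact ⟨(abs_lt.1 hR).1, (abs_lt.1 hR).2.le⟩
    refine hdom.congr' ?_
    filter_upwards [eventually_gt_atTop 0] with R hR
    rw [integral_indicator measurableSet_Ioc, intervalIntegral.integral_of_le (by linarith)]
  exact tendsto_nhds_unique hlim hzero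

/-- Cauchy's theorem on the real line for functions of subexponential growth in the upper
half-plane. -/
theorem integral_eq_zero_of_growth {v : ℂ → ℂ}
    (hd : ∀ z : ℂ, 0 ≤ z.im → DifferentiableAt ℂ v z)
    (hb : ∀ K > 0, ∃ M, ∀ z : ℂ, 0 < z.im → ‖v z‖ ≤ M * Real.exp (K * (1 + ‖z‖ ^ 2) / z.im))
    (hi : Integrable (fun t : ℝ => v t)) :
    ∫ t : ℝ, v t = 0 := by
  -- Every rate `K > 0` is admissible here, so the surviving factor `exp(2iKt)` can be removed by
  -- letting `K → 0`.
  have h0 : ∀ K : ℝ, 0 < K → ∫ t : ℝ, v t * exp (2 * I * K * t) = 0 := by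
    intro K hK
    obtain ⟨M, hM⟩ := hb (K / 2) (half_pos hK)
    exact integral_mul_exp_eq_zero hd hM hi hK.le (half_lt_self hK)
  have hlim : Tendsto (fun K : ℝ => ∫ t : ℝ, v t * exp (2 * I * K * t)) (𝓝[>] 0)
      (𝓝 (∫ t : ℝ, v t)) := by
    refine tendsto_integral_filter_of_dominated_convergence (fun t => ‖v t‖) ?_ ?_ hi.norm ?_
    · refine Eventually.of_forall fun K => hi.aestronglyMeasurable.mul ?_
      exact Continuous.aestronglyMeasurable (by fun_prop)
    · refine Eventually.of_forall fun K => Eventually.of_forall fun t => ?_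
      rw [norm_mul, norm_exp]
      simp
    · refine Eventually.of_forall fun t => ?_
      have : Continuous fun K : ℝ => v t * exp (2 * I * K * t) := by fun_prop
      have := this.tendsto 0
      simp only [ofReal_zero, mul_zero, zero_mul, exp_zero, mul_one] at this
      exact this.mono_left nhdsWithin_le_nhds
  refine tendsto_nhds_unique hlim ?_
  refine tendsto_const_nhds.congr' ?_
  filter_upwards [self_mem_nhdsWithin] with K hK
  exact (h0 K hK).symm

/-! ### The Poisson formula and pointwise bounds by the `L²` norm. -/

/-- The Poisson kernel of the upper half-plane. -/
noncomputable def poissonUpper (w : ℂ) (t : ℝ) : ℝ := w.im / (Real.pi * Complex.normSq (t - w))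

/-- Being the density of a Cauchy distribution, the Poisson kernel is integrable with integral one.
-/
theorem poissonUpper_eq_cauchyPDFReal {w : ℂ} (hw : 0 < w.im) :
    poissonUpper w = ProbabilityTheory.cauchyPDFReal w.re w.im.toNNReal := by
  ext t
  rw [poissonUpper, ProbabilityTheory.cauchyPDFReal_def, normSq_apply]
  simp only [sub_re, ofReal_re, sub_im, ofReal_im, Real.coe_toNNReal _ hw.le]
  have : (t - w.re) * (t - w.re) + (0 - w.im) * (0 - w.im) = (t - w.re) ^ 2 + w.im ^ 2 := by ring
  rw [this, div_eq_mul_inv, mul_inv]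
  ring

theorem normSq_real_sub_ge (w : ℂ) (t : ℝ) : w.im ^ 2 ≤ Complex.normSq (t - w) := by
  rw [normSq_apply]
  simp only [sub_re, ofReal_re, sub_im, ofReal_im]
  nlinarith [sq_nonneg (t - w.re)]

theorem poissonUpper_nonneg {w : ℂ} (hw : 0 < w.im) (t : ℝ) : 0 ≤ poissonUpper w t := by
  have := normSq_nonneg ((t : ℂ) - w)
  have := Real.pi_pos
  unfold poissonUpper
  positivity

theorem poissonUpper_le {w : ℂ} (hw : 0 < w.im) (t : ℝ) :
    poissonUpper w t ≤ 1 / (Real.pi * w.im) := by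
  have h := normSq_real_sub_ge w t
  have := Real.pi_pos
  have h2 : 0 < w.im ^ 2 := by positivity
  have h3 : 0 < Complex.normSq (t - w) := h2.trans_le h
  rw [poissonUpper, div_le_div_iff₀ (by positivity) (by positivity)]
  nlinarith

theorem integrable_poissonUpper {w : ℂ} (hw : 0 < w.im) : Integrable (poissonUpper w) := by
  rw [poissonUpper_eq_cauchyPDFReal hw]
  exact ProbabilityTheory.integrable_cauchyPDFReal _

theorem integrable_poissonUpper_ofReal {w : ℂ} (hw : 0 < w.im) :
    Integrable (fun t => (poissonUpper w t : ℂ)) :=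
  (integrable_poissonUpper hw).ofReal

theorem integral_poissonUpper {w : ℂ} (hw : 0 < w.im) : ∫ t, poissonUpper w t = 1 := by
  rw [poissonUpper_eq_cauchyPDFReal hw]
  exact ProbabilityTheory.integral_cauchyPDFReal_eq_one _ (Real.toNNReal_pos.2 hw).ne'

theorem sq_poissonUpper_le {w : ℂ} (hw : 0 < w.im) (t : ℝ) :
    poissonUpper w t ^ 2 ≤ 1 / (Real.pi * w.im) * poissonUpper w t := by
  rw [pow_two]
  exact mul_le_mul_of_nonneg_right (poissonUpper_le hw t) (poissonUpper_nonneg hw t)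

theorem integrable_sq_poissonUpper {w : ℂ} (hw : 0 < w.im) :
    Integrable (fun t => poissonUpper w t ^ 2) := by
  have hi := integrable_poissonUpper hw
  refine (hi.const_mul (1 / (Real.pi * w.im))).mono' (hi.aestronglyMeasurable.pow 2) ?_
  refine Eventually.of_forall fun t => ?_
  rw [Real.norm_of_nonneg (by positivity)]
  exact sq_poissonUpper_le hw t

theorem memLp_poissonUpper {w : ℂ} (hw : 0 < w.im) : MemLp (poissonUpper w) 2 := by
  rw [memLp_two_iff_integrable_sq (integrable_poissonUpper hw).aestronglyMeasurable]
  exact integrable_sq_poissonUpper hw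

theorem integral_sq_poissonUpper_le {w : ℂ} (hw : 0 < w.im) :
    ∫ t, poissonUpper w t ^ 2 ≤ 1 / (Real.pi * w.im) := by
  calc _ ≤ ∫ t, 1 / (Real.pi * w.im) * poissonUpper w t :=
        integral_mono (integrable_sq_poissonUpper hw) ((integrable_poissonUpper hw).const_mul _)
          (sq_poissonUpper_le hw)
    _ = _ := by rw [integral_const_mul, integral_poissonUpper hw, mul_one]

theorem integral_mul_le_sqrt {f g : ℝ → ℝ} (hf0 : ∀ t, 0 ≤ f t) (hg0 : ∀ t, 0 ≤ g t)
    (hf : MemLp f 2) (hg : MemLp g 2) :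
    ∫ t, f t * g t ≤ √(∫ t, f t ^ 2) * √(∫ t, g t ^ 2) := by
  have h := integral_mul_le_Lp_mul_Lq_of_nonneg (μ := volume) Real.HolderConjugate.two_two
    (Eventually.of_forall hf0) (Eventually.of_forall hg0) (by simpa using hf) (by simpa using hg)
  rw [Real.sqrt_eq_rpow, Real.sqrt_eq_rpow]
  simpa using h

theorem differentiableAt_dslope {u : ℂ → ℂ} {w z : ℂ} (hw : AnalyticAt ℂ u w)
    (hz : AnalyticAt ℂ u z) : DifferentiableAt ℂ (dslope u w) z := by
  rcases eq_or_ne z w with rfl | hne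
  · obtain ⟨s, hs, hd⟩ := hw.exists_mem_nhds_analyticOnNhd
    exact ((differentiableOn_dslope hs).2 hd.differentiableOn).differentiableAt hs
  · exact (differentiableAt_dslope_of_ne hne).2 hz.differentiableAt

theorem one_le_exp_growth {K : ℝ} (hK : 0 ≤ K) {z : ℂ} (hz : 0 < z.im) :
    1 ≤ Real.exp (K * (1 + ‖z‖ ^ 2) / z.im) :=
  Real.one_le_exp (by positivity)

/-- Within distance one of `w` compactness bounds the quotient; farther away, division by `z - w`
does not increase it. Constants are absorbed because the growth factor is at least one. -/
theorem exists_dslope_growth {u : ℂ → ℂ} {w : ℂ} (hu : ∀ z : ℂ, 0 ≤ z.im → AnalyticAt ℂ u z)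
    (hw : 0 ≤ w.im) {M K : ℝ} (hK : 0 ≤ K)
    (hb : ∀ z : ℂ, 0 < z.im → ‖u z‖ ≤ M * Real.exp (K * (1 + ‖z‖ ^ 2) / z.im)) :
    ∃ M', 0 ≤ M' ∧
      ∀ z : ℂ, 0 < z.im → ‖dslope u w z‖ ≤ M' * Real.exp (K * (1 + ‖z‖ ^ 2) / z.im) := by
  have hM : 0 ≤ M := by
    have := (norm_nonneg _).trans (hb I (by simp))
    exact nonneg_of_mul_nonneg_left this (Real.exp_pos _)
  have hcomp : IsCompact (Metric.closedBall w 1 ∩ {z : ℂ | 0 ≤ z.im}) :=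
    (isCompact_closedBall _ _).inter_right (isClosed_le continuous_const continuous_im)
  obtain ⟨B, hB⟩ := hcomp.exists_bound_of_continuousOn (f := dslope u w) (fun z hz =>
    (differentiableAt_dslope (hu w hw) (hu z hz.2)).continuousAt.continuousWithinAt)
  have hB0 : 0 ≤ B := (norm_nonneg _).trans (hB w ⟨by simp, hw⟩)
  refine ⟨B + M + ‖u w‖, by positivity, fun z hz => ?_⟩
  have h1 := one_le_exp_growth hK hz
  by_cases hzw : z ∈ Metric.closedBall w 1
  · calc _ ≤ B * 1 := by rw [mul_one]; exact hB z ⟨hzw, hz.le⟩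
      _ ≤ _ := mul_le_mul (by nlinarith [norm_nonneg (u w)]) h1 zero_le_one (by positivity)
  · rw [Metric.mem_closedBall, not_le, dist_eq] at hzw
    have e : ‖z - w‖ * ‖dslope u w z‖ = ‖u z - u w‖ := by
      rw [← norm_mul, ← smul_eq_mul, sub_smul_dslope]
    have h2 : ‖dslope u w z‖ ≤ ‖u z - u w‖ := by
      rw [← e]; exact le_mul_of_one_le_left (norm_nonneg _) hzw.le
    refine (h2.trans (norm_sub_le _ _)).trans ?_
    have := hb z hz
    have h3 : ‖u w‖ ≤ ‖u w‖ * Real.exp (K * (1 + ‖z‖ ^ 2) / z.im) :=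
      le_mul_of_one_le_right (norm_nonneg _) h1
    have h4 : 0 ≤ B * Real.exp (K * (1 + ‖z‖ ^ 2) / z.im) := by positivity
    nlinarith

section Poisson

variable {u : ℂ → ℂ} {w : ℂ}

/-- The analytic function whose boundary values are `(u t - u w)` times the Poisson kernel. -/
noncomputable def poissonQuotient (u : ℂ → ℂ) (w z : ℂ) : ℂ :=
  (w.im / Real.pi : ℝ) * (dslope u w z / (z - conj w))

theorem poissonQuotient_real (hw : 0 < w.im) (t : ℝ) :
    poissonQuotient u w t = (u t - u w) * poissonUpper w t := by
  have hne : (t : ℂ) ≠ w := fun h => by rw [← h] at hw; simp at hw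
  have h1 : (t : ℂ) - w ≠ 0 := sub_ne_zero.2 hne
  have h2 : (t : ℂ) - conj w ≠ 0 := fun h => h1 (by simpa using congrArg conj h)
  have hn : (Complex.normSq ((t : ℂ) - w) : ℂ) = (t - w) * (t - conj w) := by
    rw [normSq_eq_conj_mul_self]; simp [mul_comm]
  have hpi : (Real.pi : ℂ) ≠ 0 := by exact_mod_cast Real.pi_ne_zero
  rw [poissonQuotient, dslope_of_ne _ hne, slope_def_field, poissonUpper]
  push_cast
  rw [hn]
  field_simp

theorem im_le_norm_sub_conj {z : ℂ} (hz : 0 ≤ z.im) : w.im ≤ ‖z - conj w‖ := by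
  refine le_trans ?_ (abs_im_le_norm _)
  refine le_trans ?_ (le_abs_self _)
  simp [hz]

theorem differentiableAt_poissonQuotient (hu : ∀ z : ℂ, 0 ≤ z.im → AnalyticAt ℂ u z)
    (hw : 0 < w.im) {z : ℂ} (hz : 0 ≤ z.im) : DifferentiableAt ℂ (poissonQuotient u w) z := by
  have hne : z - conj w ≠ 0 := norm_pos_iff.1 (hw.trans_le (im_le_norm_sub_conj hz))
  exact ((differentiableAt_dslope (hu w hw.le) (hu z hz)).div (by fun_prop) hne).const_mul _

theorem exists_poissonQuotient_growth (hu : ∀ z : ℂ, 0 ≤ z.im → AnalyticAt ℂ u z)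
    (hw : 0 < w.im) {M K : ℝ} (hK : 0 ≤ K)
    (hb : ∀ z : ℂ, 0 < z.im → ‖u z‖ ≤ M * Real.exp (K * (1 + ‖z‖ ^ 2) / z.im)) :
    ∃ M', ∀ z : ℂ, 0 < z.im →
      ‖poissonQuotient u w z‖ ≤ M' * Real.exp (K * (1 + ‖z‖ ^ 2) / z.im) := by
  obtain ⟨M', hM', h⟩ := exists_dslope_growth hu hw.le hK hb
  refine ⟨w.im / Real.pi * (M' / w.im), fun z hz => ?_⟩
  have hpi := Real.pi_pos
  rw [poissonQuotient, norm_mul, norm_div, norm_real, Real.norm_of_nonneg (by positivity),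
    mul_assoc]
  refine mul_le_mul_of_nonneg_left ?_ (by positivity)
  calc _ ≤ (M' * Real.exp (K * (1 + ‖z‖ ^ 2) / z.im)) / w.im :=
        div_le_div₀ (by positivity) (h z hz) hw (im_le_norm_sub_conj hz.le)
    _ = _ := by ring

theorem integrable_poissonQuotient (hw : 0 < w.im)
    (hi : Integrable (fun t : ℝ => u t * poissonUpper w t)) :
    Integrable (fun t : ℝ => poissonQuotient u w t) := by
  simp only [poissonQuotient_real hw, sub_mul]
  exact hi.sub ((integrable_poissonUpper_ofReal hw).const_mul _)

/-- The Poisson formula for functions of subexponential growth. -/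
theorem integral_mul_poissonUpper (hu : ∀ z : ℂ, 0 ≤ z.im → AnalyticAt ℂ u z) (hw : 0 < w.im)
    (hb : ∀ K > 0, ∃ M, ∀ z : ℂ, 0 < z.im → ‖u z‖ ≤ M * Real.exp (K * (1 + ‖z‖ ^ 2) / z.im))
    (hi : Integrable (fun t : ℝ => u t * poissonUpper w t)) :
    ∫ t : ℝ, u t * poissonUpper w t = u w := by
  have h := integral_eq_zero_of_growth
    (fun z hz => differentiableAt_poissonQuotient hu hw hz) (fun K hK => by
      obtain ⟨M, hM⟩ := hb K hK
      exact exists_poissonQuotient_growth hu hw hK.le hM) (integrable_poissonQuotient hw hi)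
  simp only [poissonQuotient_real hw, sub_mul] at h
  rw [integral_sub hi ((integrable_poissonUpper_ofReal hw).const_mul (u w)), integral_const_mul,
    integral_complex_ofReal, integral_poissonUpper hw, ofReal_one, mul_one, sub_eq_zero] at h
  exact h

theorem norm_exp_two_I_mul (K : ℝ) (z : ℂ) : ‖exp (2 * I * K * z)‖ = Real.exp (-(2 * K * z.im)) := by
  rw [norm_exp]
  congr 1
  simp

/-- The Poisson formula for functions of exponential growth, after damping. -/
theorem integral_mul_exp_mul_poissonUpper (hu : ∀ z : ℂ, 0 ≤ z.im → AnalyticAt ℂ u z)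
    (hw : 0 < w.im) {M K K' : ℝ} (hK : 0 ≤ K) (hKK : K < K')
    (hb : ∀ z : ℂ, 0 < z.im → ‖u z‖ ≤ M * Real.exp (K * (1 + ‖z‖ ^ 2) / z.im))
    (hi : Integrable (fun t : ℝ => u t * poissonUpper w t)) :
    ∫ t : ℝ, u t * poissonUpper w t * exp (2 * I * K' * t) = u w * exp (2 * I * K' * w) := by
  have hK' : 0 ≤ K' := hK.trans hKK.le
  obtain ⟨M', hM'⟩ := exists_poissonQuotient_growth hu hw hK hb
  have h := integral_mul_exp_eq_zero (fun z hz => differentiableAt_poissonQuotient hu hw hz) hM'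
    (integrable_poissonQuotient hw hi) hK' hKK
  have hP := integrable_poissonUpper_ofReal hw
  have hbd : ∀ t : ℝ, ‖exp (2 * I * K' * t)‖ = 1 := fun t => by
    rw [norm_exp_two_I_mul]; simp
  have hmul : ∀ {g : ℝ → ℂ}, Integrable g → Integrable (fun t : ℝ => g t * exp (2 * I * K' * t)) :=
    fun {g} hg => hg.mul_bdd (c := 1) (Continuous.aestronglyMeasurable (by fun_prop))
      (Eventually.of_forall fun t => (hbd t).le)
  -- The exponential itself is bounded by one in the upper half-plane, so the undamped Poisson
  -- formula applies to it.
  have hexp : ∫ t : ℝ, exp (2 * I * K' * t) * poissonUpper w t = exp (2 * I * K' * w) := by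
    refine integral_mul_poissonUpper (u := fun z => exp (2 * I * K' * z))
      (fun z _ => by fun_prop) hw (fun k hk => ⟨1, fun z hz => ?_⟩) ?_
    · rw [norm_exp_two_I_mul, one_mul]
      refine le_trans ?_ (one_le_exp_growth hk.le hz)
      rw [Real.exp_le_one_iff, neg_nonpos]
      positivity
    · exact (hmul hP).congr (Eventually.of_forall fun t => mul_comm _ _)
  simp only [poissonQuotient_real hw, sub_mul] at h
  have e : ∀ t : ℝ, u w * poissonUpper w t * exp (2 * I * K' * t) =
      u w * (exp (2 * I * K' * t) * poissonUpper w t) := fun t => by ring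
  rw [integral_sub (hmul hi) (hmul (hP.const_mul (u w)))] at h
  simp only [e] at h
  rw [integral_const_mul, hexp, sub_eq_zero] at h
  exact h

theorem integrable_mul_poissonUpper (hw : 0 < w.im) (h2 : MemLp (fun t : ℝ => u t) 2) :
    Integrable (fun t : ℝ => u t * poissonUpper w t) :=
  h2.integrable_mul (memLp_poissonUpper hw).ofReal

theorem integral_norm_mul_poissonUpper_le (hw : 0 < w.im) (h2 : MemLp (fun t : ℝ => u t) 2) :
    ∫ t : ℝ, ‖u t‖ * poissonUpper w t ≤ √(∫ t : ℝ, ‖u t‖ ^ 2) / √(Real.pi * w.im) := by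
  refine (integral_mul_le_sqrt (fun t => norm_nonneg _) (poissonUpper_nonneg hw) h2.norm
    (memLp_poissonUpper hw)).trans ?_
  rw [div_eq_mul_one_div, ← Real.sqrt_one, ← Real.sqrt_div zero_le_one]
  exact mul_le_mul_of_nonneg_left (Real.sqrt_le_sqrt (integral_sq_poissonUpper_le hw))
    (Real.sqrt_nonneg _)

/-- The Poisson formula with Cauchy–Schwarz: the kernel `P` satisfies `P ≤ 1/(π im w)` and `∫ P =
1`, hence `∫ P² ≤ 1/(π im w)`. -/
theorem norm_le_of_growth (hu : ∀ z : ℂ, 0 ≤ z.im → AnalyticAt ℂ u z) (hw : 0 < w.im)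
    (hb : ∀ K > 0, ∃ M, ∀ z : ℂ, 0 < z.im → ‖u z‖ ≤ M * Real.exp (K * (1 + ‖z‖ ^ 2) / z.im))
    (h2 : MemLp (fun t : ℝ => u t) 2) :
    ‖u w‖ ≤ √(∫ t : ℝ, ‖u t‖ ^ 2) / √(Real.pi * w.im) := by
  rw [← integral_mul_poissonUpper hu hw hb (integrable_mul_poissonUpper hw h2)]
  refine (norm_integral_le_integral_norm _).trans ?_
  refine le_trans (le_of_eq ?_) (integral_norm_mul_poissonUpper_le hw h2)
  congr 1 with t
  rw [norm_mul, norm_real, Real.norm_of_nonneg (poissonUpper_nonneg hw t)]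

/-- When the growth is controlled at one rate only, damping costs an exponential factor, which the
mean type condition later removes. -/
theorem norm_le_exp_mul_of_growth (hu : ∀ z : ℂ, 0 ≤ z.im → AnalyticAt ℂ u z)
    (hw : 0 < w.im) {M K K' : ℝ} (hK : 0 ≤ K) (hKK : K < K')
    (hb : ∀ z : ℂ, 0 < z.im → ‖u z‖ ≤ M * Real.exp (K * (1 + ‖z‖ ^ 2) / z.im))
    (h2 : MemLp (fun t : ℝ => u t) 2) :
    ‖u w‖ ≤ √(∫ t : ℝ, ‖u t‖ ^ 2) / √(Real.pi * w.im) * Real.exp (2 * K' * w.im) := by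
  have h := integral_mul_exp_mul_poissonUpper hu hw hK hKK hb (integrable_mul_poissonUpper hw h2)
  have h3 : ‖u w * exp (2 * I * K' * w)‖ ≤ √(∫ t : ℝ, ‖u t‖ ^ 2) / √(Real.pi * w.im) := by
    rw [← h]
    refine (norm_integral_le_integral_norm _).trans ?_
    refine le_trans (le_of_eq ?_) (integral_norm_mul_poissonUpper_le hw h2)
    congr 1 with t
    rw [norm_mul, norm_mul, norm_real, Real.norm_of_nonneg (poissonUpper_nonneg hw t),
      norm_exp_two_I_mul]
    simp
  rw [norm_mul, norm_exp_two_I_mul, Real.exp_neg, ← div_eq_mul_inv,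
    div_le_iff₀ (Real.exp_pos _)] at h3
  exact h3

end Poisson

/-! ### Growth of quotients of bounded analytic functions in the disc. -/

/-- Real trigonometric approximation on the unit circle, by real parts of entire functions. -/
theorem exists_entire_re_approx {p : ℂ → ℝ} (hp : ContinuousOn p (Metric.sphere 0 1)) {ε : ℝ}
    (hε : 0 < ε) :
    ∃ P : ℂ → ℂ, Differentiable ℂ P ∧ ∀ z ∈ Metric.sphere (0 : ℂ) 1, |p z - (P z).re| ≤ ε := by
  have : Fact (0 < 2 * Real.pi) := ⟨Real.two_pi_pos⟩
  let q : C(AddCircle (2 * Real.pi), ℂ) :=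
    ⟨fun x => (p (AddCircle.toCircle x : ℂ) : ℂ), by
      refine continuous_ofReal.comp ?_
      refine hp.comp_continuous (continuous_subtype_val.comp AddCircle.continuous_toCircle) ?_
      intro x
      rw [mem_sphere_zero_iff_norm]
      exact Circle.norm_coe _⟩
  have hq : q ∈ (Submodule.span ℂ (range (@fourier (2 * Real.pi)))).topologicalClosure := by
    rw [span_fourier_closure_eq_top]; trivial
  obtain ⟨g, hg, hgq⟩ := Metric.mem_closure_iff.1 hq ε hε
  -- Nonnegative frequencies are powers of `z` and nonpositive ones are conjugates of powers. The
  -- real part of `A + conj B` is that of the entire function `A + B`.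
  have hform : ∃ A B : ℂ → ℂ, Differentiable ℂ A ∧ Differentiable ℂ B ∧
      ∀ x, g x = A (AddCircle.toCircle x : ℂ) + conj (B (AddCircle.toCircle x : ℂ)) := by
    clear hgq
    induction hg using Submodule.span_induction with
    | mem g hg =>
      obtain ⟨n, rfl⟩ := hg
      rcases le_total 0 n with hn | hn
      · lift n to ℕ using hn
        refine ⟨fun z => z ^ n, fun _ => 0, by fun_prop, by fun_prop, fun x => ?_⟩
        simp [fourier_apply, AddCircle.toCircle_nsmul]
      · obtain ⟨m, rfl⟩ := Int.exists_eq_neg_ofNat hn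
        refine ⟨fun _ => 0, fun z => z ^ m, by fun_prop, by fun_prop, fun x => ?_⟩
        simp only [fourier_neg, zero_add]
        simp [fourier_apply, AddCircle.toCircle_nsmul]
    | zero => exact ⟨fun _ => 0, fun _ => 0, by fun_prop, by fun_prop, fun x => by simp⟩
    | add g₁ g₂ _ _ h₁ h₂ =>
      obtain ⟨A₁, B₁, a₁, b₁, e₁⟩ := h₁
      obtain ⟨A₂, B₂, a₂, b₂, e₂⟩ := h₂
      refine ⟨A₁ + A₂, B₁ + B₂, a₁.add a₂, b₁.add b₂, fun x => ?_⟩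
      simp only [ContinuousMap.add_apply, e₁, e₂, Pi.add_apply, map_add]
      ring
    | smul c g _ h =>
      obtain ⟨A, B, a, b, e⟩ := h
      refine ⟨fun z => c * A z, fun z => conj c * B z, a.const_mul c, b.const_mul _, fun x => ?_⟩
      simp only [ContinuousMap.smul_apply, e, smul_eq_mul, map_mul, conj_conj]
      ring
  obtain ⟨A, B, hA, hB, e⟩ := hform
  refine ⟨A + B, hA.add hB, fun z hz => ?_⟩
  obtain ⟨x, hx⟩ : ∃ x : AddCircle (2 * Real.pi), (AddCircle.toCircle x : ℂ) = z := by
    have hz' : ‖z‖ = 1 := by simpa using hz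
    refine ⟨(z.arg : ℝ), ?_⟩
    rw [AddCircle.toCircle_apply_mk]
    simp only [Circle.coe_exp]
    have := norm_mul_exp_arg_mul_I z
    rw [hz', ofReal_one, one_mul] at this
    convert! this using 3
    have : (2 * Real.pi) ≠ 0 := Real.two_pi_pos.ne'
    rw [div_self this, one_mul]
  have h1 : dist (q x) (g x) < ε := (ContinuousMap.dist_apply_le_dist x).trans_lt hgq
  have h2 : p z - ((A + B) z).re = (q x - g x).re := by
    rw [e x, hx]
    simp only [q, ContinuousMap.coe_mk, hx, sub_re, add_re, conj_re, ofReal_re, Pi.add_apply]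
  rw [h2]
  rw [dist_eq] at h1
  exact (abs_re_le_norm _).trans h1.le

/-- Growth in the disc of an analytic quotient of two bounded analytic functions. -/
theorem norm_le_of_disc_quotient {U H : ℂ → ℂ} (hU : DifferentiableOn ℂ U (Metric.ball 0 1))
    (hH : DifferentiableOn ℂ H (Metric.ball 0 1)) (hH1 : ∀ z ∈ Metric.ball (0 : ℂ) 1, ‖H z‖ ≤ 1)
    (hUH : ∀ z ∈ Metric.ball (0 : ℂ) 1, ‖U z * H z‖ ≤ 1) (h0 : H 0 ≠ 0) {ζ : ℂ} (hζ : ‖ζ‖ < 1) :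
    ‖U ζ‖ ≤ Real.exp (4 * (4 - Real.log ‖H 0‖) / (1 - ‖ζ‖)) := by
  set ρ := ‖ζ‖ with hρ
  have hρ0 : 0 ≤ ρ := norm_nonneg _
  -- The radius halfway between `|ζ|` and `1` keeps `1 - |ζ|/r` at least half of `1 - |ζ|`.
  set r : ℝ := (1 + ρ) / 2 with hr
  have hr0 : 0 < r := by positivity
  have hr1 : r < 1 := by rw [hr]; linarith
  set L := -Real.log ‖H 0‖ with hL
  have hL0 : 0 ≤ L := by
    rw [hL, neg_nonneg]
    exact Real.log_nonpos (norm_nonneg _) (hH1 0 (by simp))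
  have hin : ∀ z : ℂ, ‖z‖ ≤ 1 → (r : ℂ) * z ∈ Metric.ball (0 : ℂ) 1 := fun z hz => by
    rw [mem_ball_zero_iff, norm_mul, norm_real, Real.norm_of_nonneg hr0.le]
    nlinarith [norm_nonneg z]
  have hdiff : ∀ {V : ℂ → ℂ}, DifferentiableOn ℂ V (Metric.ball 0 1) → ∀ z : ℂ, ‖z‖ ≤ 1 →
      DifferentiableAt ℂ (fun z => V (r * z)) z := fun {V} hV z hz =>
    DifferentiableAt.comp z (hV.differentiableAt (Metric.isOpen_ball.mem_nhds (hin z hz)))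
      (by fun_prop)
  have hmax : ∀ {V : ℂ → ℂ} {C : ℝ}, (∀ z : ℂ, ‖z‖ ≤ 1 → DifferentiableAt ℂ V z) →
      (∀ z : ℂ, ‖z‖ = 1 → ‖V z‖ ≤ C) → ∀ z : ℂ, ‖z‖ ≤ 1 → ‖V z‖ ≤ C := by
    intro V C hV hC z hz
    have hcl : closure (Metric.ball (0 : ℂ) 1) = Metric.closedBall 0 1 :=
      closure_ball _ one_ne_zero
    refine Complex.norm_le_of_forall_mem_frontier_norm_le (U := Metric.ball 0 1)
      Metric.isBounded_ball ?_ ?_ (by rw [hcl]; simpa using hz)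
    · refine DifferentiableOn.diffContOnCl ?_
      rw [hcl]
      exact fun w hw => (hV w (by simpa using hw)).differentiableWithinAt
    · rw [frontier_ball _ one_ne_zero]
      exact fun w hw => hC w (by simpa using hw)
  have hp : ContinuousOn (fun z : ℂ => Real.log (max 1 ‖U (r * z)‖)) (Metric.sphere 0 1) := by
    refine ContinuousOn.log ?_ fun z _ => (lt_max_of_lt_left one_pos).ne'
    refine continuousOn_const.sup (ContinuousOn.norm fun z hz => ?_)
    exact (hdiff hU z (by simpa using (mem_sphere_zero_iff_norm.1 hz).le)).continuousAt.continuousWithinAt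
  -- `exp P` is an approximate outer function: `re P` agrees with `log⁺ |U(r·)|` on the unit circle
  -- up to `1`. The maximum principle then gives `|U(r·)| ≤ e·e^{re P}` and `re P ≥ -1` in the disc.
  obtain ⟨P, hP, hPp⟩ := exists_entire_re_approx hp one_pos
  have hsph : ∀ z : ℂ, ‖z‖ = 1 → 0 ≤ Real.log (max 1 ‖U (r * z)‖) ∧
      Real.log (max 1 ‖U (r * z)‖) - 1 ≤ (P z).re ∧ (P z).re ≤ Real.log (max 1 ‖U (r * z)‖) + 1 := by
    intro z hz
    have := abs_le.1 (hPp z (by simpa using hz))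
    exact ⟨Real.log_nonneg (le_max_left _ _), by linarith, by linarith⟩
  have hexplog : ∀ z : ℂ, Real.exp (Real.log (max 1 ‖U (r * z)‖)) = max 1 ‖U (r * z)‖ := fun z =>
    Real.exp_log (lt_max_of_lt_left one_pos)
  have hA : ∀ z : ℂ, ‖z‖ ≤ 1 → ‖U (r * z) * exp (-P z)‖ ≤ Real.exp 1 := by
    refine hmax (fun z hz => (hdiff hU z hz).mul (hP z).neg.cexp) fun z hz => ?_
    obtain ⟨_, h2, _⟩ := hsph z hz
    rw [norm_mul, norm_exp, neg_re]
    calc _ ≤ max 1 ‖U (r * z)‖ * Real.exp (-(P z).re) :=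
          mul_le_mul_of_nonneg_right (le_max_right _ _) (Real.exp_pos _).le
      _ = Real.exp (Real.log (max 1 ‖U (r * z)‖) + -(P z).re) := by rw [Real.exp_add, hexplog]
      _ ≤ _ := Real.exp_le_exp.2 (by linarith)
  -- Since `|H| max(1, |U|) ≤ 1`, the product `H e^P` is bounded; at the origin this bounds `re P`
  -- above by `1 - log |H 0|`.
  have hB : ∀ z : ℂ, ‖z‖ ≤ 1 → ‖H (r * z) * exp (P z)‖ ≤ Real.exp 1 := by
    refine hmax (fun z hz => (hdiff hH z hz).mul (hP z).cexp) fun z hz => ?_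
    obtain ⟨_, _, h3⟩ := hsph z hz
    rw [norm_mul, norm_exp]
    have h4 : ‖H (r * z)‖ * max 1 ‖U (r * z)‖ ≤ 1 := by
      rw [mul_max_of_nonneg _ _ (norm_nonneg _), mul_one]
      refine max_le (hH1 _ (hin z hz.le)) ?_
      rw [← norm_mul, mul_comm]
      exact hUH _ (hin z hz.le)
    calc _ ≤ ‖H (r * z)‖ * (max 1 ‖U (r * z)‖ * Real.exp 1) := by
          rw [← hexplog, ← Real.exp_add]
          exact mul_le_mul_of_nonneg_left (Real.exp_le_exp.2 h3) (norm_nonneg _)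
      _ ≤ 1 * Real.exp 1 := by
          rw [← mul_assoc]; exact mul_le_mul_of_nonneg_right h4 (Real.exp_pos _).le
      _ = _ := one_mul _
  have hC : ∀ z : ℂ, ‖z‖ ≤ 1 → -1 ≤ (P z).re := by
    intro z hz
    have : ‖exp (-P z)‖ ≤ Real.exp 1 := by
      refine hmax (V := fun z => exp (-P z)) (fun z _ => (hP z).neg.cexp) (fun z hz => ?_) z hz
      obtain ⟨h1, h2, _⟩ := hsph z hz
      rw [norm_exp, neg_re]
      exact Real.exp_le_exp.2 (by linarith)
    rw [norm_exp, neg_re, Real.exp_le_exp] at this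
    linarith
  have hP0 : |(P 0).re| ≤ 1 + L := by
    have h1 := hB 0 (by simp)
    rw [mul_zero, norm_mul, norm_exp] at h1
    have h2 : Real.log ‖H 0‖ + (P 0).re ≤ 1 := by
      have hpos : 0 < ‖H 0‖ := norm_pos_iff.2 h0
      rw [← Real.exp_le_exp, Real.exp_add, Real.exp_log hpos]
      exact h1
    exact abs_le.2 ⟨by linarith [hC 0 (by simp)], by linarith⟩
  set w : ℂ := ζ / r with hw
  have hwn : ‖w‖ = ρ / r := by rw [hw, norm_div, norm_real, Real.norm_of_nonneg hr0.le]
  have hw1 : ‖w‖ < 1 := by rw [hwn, div_lt_one hr0, hr]; linarith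
  have hrw : (r : ℂ) * w = ζ := by
    rw [hw, mul_div_cancel₀ _ (by exact_mod_cast hr0.ne')]
  -- Adding `i im P(0)` to `-P` makes the value at the origin real, hence controlled by `|re P(0)|`;
  -- the one-sided bound needed is `re P ≥ -1`.
  have hbc := Complex.borelCaratheodory (f := fun z => (P 0).im * I - P z) (M := 1) (R := 1) (z := w)
    one_pos (by fun_prop) (fun z hz => by
      have := hC z (mem_ball_zero_iff.1 hz).le
      simp only [mem_ofPred_eq, sub_re, mul_re, I_re, I_im, ofReal_im, ofReal_re, mul_zero,
        zero_mul, sub_zero, zero_sub]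
      linarith) one_pos (by simpa using hw1)
  have hf0 : ‖((P 0).im : ℂ) * I - P 0‖ = |(P 0).re| := by
    have : ((P 0).im : ℂ) * I - P 0 = ((-(P 0).re : ℝ) : ℂ) := by
      apply Complex.ext <;> simp
    rw [this, norm_real, Real.norm_eq_abs, abs_neg]
  rw [hf0] at hbc
  have hκ : 1 / (1 - ‖w‖) ≤ 2 / (1 - ρ) := by
    rw [hwn, div_le_div_iff₀ (by rw [← hwn]; linarith) (by linarith)]
    have : ρ / r = 2 * ρ / (1 + ρ) := by rw [hr]; field_simp
    rw [this]
    have : 2 * (1 - 2 * ρ / (1 + ρ)) = 2 * (1 - ρ) / (1 + ρ) := by field_simp; ring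
    rw [this, le_div_iff₀ (by linarith)]
    nlinarith
  have hre : (P w).re ≤ 2 * (2 + L) * (2 / (1 - ρ)) := by
    have h1 : (P w).re ≤ ‖((P 0).im : ℂ) * I - P w‖ := by
      have := neg_le_of_abs_le (abs_re_le_norm (((P 0).im : ℂ) * I - P w))
      simp at this
      linarith
    refine h1.trans (hbc.trans ?_)
    have hw0 := norm_nonneg w
    have : 2 * 1 * ‖w‖ / (1 - ‖w‖) + |(P 0).re| * (1 + ‖w‖) / (1 - ‖w‖) =
        (2 * ‖w‖ + |(P 0).re| * (1 + ‖w‖)) * (1 / (1 - ‖w‖)) := by ring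
    rw [this]
    have h3 : 0 ≤ 1 / (1 - ‖w‖) := by
      have : 0 < 1 - ‖w‖ := by linarith
      positivity
    refine mul_le_mul ?_ hκ h3 (by positivity)
    nlinarith [abs_nonneg (P 0).re]
  have hfin := hA w hw1.le
  rw [hrw, norm_mul, norm_exp, neg_re, Real.exp_neg, ← div_eq_mul_inv,
    div_le_iff₀ (Real.exp_pos _), ← Real.exp_add] at hfin
  refine hfin.trans (Real.exp_le_exp.2 ?_)
  have h5 : 1 ≤ 1 / (1 - ρ) := by
    rw [le_div_iff₀ (by linarith)]; linarith
  have h6 : 4 * (4 - Real.log ‖H 0‖) / (1 - ρ) = 2 * (2 + L) * (2 / (1 - ρ)) + 8 * (1 / (1 - ρ)) := by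
    rw [hL]; ring
  rw [h6]
  linarith

/-! ### Transfer of growth bounds to the upper half-plane. -/

/-- The inverse Cayley transform, mapping the unit disc to the upper half-plane and `0` to `a`. -/
noncomputable def invCayley (a ζ : ℂ) : ℂ := (a - conj a * ζ) / (1 - ζ)

/-- The Cayley transform, mapping the upper half-plane to the unit disc and `a` to `0`. -/
noncomputable def cayley (a z : ℂ) : ℂ := (z - a) / (z - conj a)

theorem invCayley_zero (a : ℂ) : invCayley a 0 = a := by simp [invCayley]

theorem one_sub_ne_zero_of_norm_lt {ζ : ℂ} (hζ : ‖ζ‖ < 1) : 1 - ζ ≠ 0 := fun h => by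
  rw [← sub_eq_zero.1 h] at hζ; simp at hζ

theorem im_invCayley_pos {a ζ : ℂ} (ha : 0 < a.im) (hζ : ‖ζ‖ < 1) : 0 < (invCayley a ζ).im := by
  have hne := one_sub_ne_zero_of_norm_lt hζ
  have hn : 0 < Complex.normSq (1 - ζ) := normSq_pos.2 hne
  have h1 : ζ.re * ζ.re + ζ.im * ζ.im < 1 := by
    rw [← normSq_apply, normSq_eq_norm_sq]
    nlinarith [norm_nonneg ζ]
  have : (invCayley a ζ).im = a.im * (1 - (ζ.re * ζ.re + ζ.im * ζ.im)) / Complex.normSq (1 - ζ) := by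
    rw [invCayley, div_im]
    simp only [sub_im, mul_im, conj_re, conj_im, sub_re, one_re, mul_re, one_im]
    ring
  rw [this]
  have : 0 < 1 - (ζ.re * ζ.re + ζ.im * ζ.im) := by linarith
  positivity

theorem differentiableAt_invCayley {a ζ : ℂ} (hζ : ‖ζ‖ < 1) :
    DifferentiableAt ℂ (invCayley a) ζ := by
  have hne := one_sub_ne_zero_of_norm_lt hζ
  unfold invCayley
  fun_prop (disch := assumption)

theorem sub_conj_ne_zero {a z : ℂ} (ha : 0 < a.im) (hz : 0 < z.im) : z - conj a ≠ 0 := fun h => by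
  have := congrArg Complex.im h
  simp at this
  linarith

theorem invCayley_cayley {a z : ℂ} (ha : 0 < a.im) (hz : 0 < z.im) :
    invCayley a (cayley a z) = z := by
  have h1 := sub_conj_ne_zero ha hz
  have h2 : a - conj a ≠ 0 := sub_conj_ne_zero ha ha
  have h3 : 1 - cayley a z = (a - conj a) / (z - conj a) := by
    rw [cayley]; field_simp; ring
  rw [invCayley, h3, cayley]
  field_simp
  ring

theorem one_sub_sq_norm_cayley {a z : ℂ} (ha : 0 < a.im) (hz : 0 < z.im) :
    1 - ‖cayley a z‖ ^ 2 = 4 * z.im * a.im / ‖z - conj a‖ ^ 2 := by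
  have h1 := sub_conj_ne_zero ha hz
  have hn : 0 < ‖z - conj a‖ ^ 2 := by positivity
  rw [cayley, norm_div, div_pow, eq_div_iff hn.ne', sub_mul, div_mul_cancel₀ _ hn.ne', one_mul,
    ← normSq_eq_norm_sq, ← normSq_eq_norm_sq, normSq_apply, normSq_apply]
  simp only [sub_re, sub_im, conj_re, conj_im]
  ring

theorem norm_cayley_lt_one {a z : ℂ} (ha : 0 < a.im) (hz : 0 < z.im) : ‖cayley a z‖ < 1 := by
  have h := one_sub_sq_norm_cayley ha hz
  have h1 := sub_conj_ne_zero ha hz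
  have : 0 < 4 * z.im * a.im / ‖z - conj a‖ ^ 2 := by positivity
  nlinarith [norm_nonneg (cayley a z)]

/-- This turns distance to the unit circle into the gauge `(1 + |z|²)/im z` used in all growth
bounds. It uses `1 - |c| ≥ (1 - |c|²)/2` for `c = cayley a z`, and `|z - conj a|² ≤ (1 + |z|²)(1 +
|a|²)`. -/
theorem inv_one_sub_norm_cayley_le {a z : ℂ} (ha : 0 < a.im) (hz : 0 < z.im) :
    1 / (1 - ‖cayley a z‖) ≤ (1 + ‖a‖ ^ 2) / (2 * a.im) * ((1 + ‖z‖ ^ 2) / z.im) := by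
  have h := one_sub_sq_norm_cayley ha hz
  have h1 := sub_conj_ne_zero ha hz
  have hlt := norm_cayley_lt_one ha hz
  have h0 := norm_nonneg (cayley a z)
  have hn : 0 < ‖z - conj a‖ ^ 2 := by positivity
  have h2 : ‖z - conj a‖ ^ 2 ≤ (1 + ‖z‖ ^ 2) * (1 + ‖a‖ ^ 2) := by
    have : ‖z - conj a‖ ≤ ‖z‖ + ‖a‖ := (norm_sub_le _ _).trans (by rw [RCLike.norm_conj])
    nlinarith [sq_nonneg (1 - ‖z‖ * ‖a‖), norm_nonneg (z - conj a), norm_nonneg z, norm_nonneg a]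
  have h3 : 2 * z.im * a.im / ‖z - conj a‖ ^ 2 ≤ 1 - ‖cayley a z‖ := by
    have : 4 * z.im * a.im / ‖z - conj a‖ ^ 2 = 2 * (2 * z.im * a.im / ‖z - conj a‖ ^ 2) := by ring
    nlinarith
  calc _ ≤ 1 / (2 * z.im * a.im / ‖z - conj a‖ ^ 2) :=
        one_div_le_one_div_of_le (by positivity) h3
    _ = ‖z - conj a‖ ^ 2 / (2 * z.im * a.im) := one_div_div _ _
    _ ≤ (1 + ‖z‖ ^ 2) * (1 + ‖a‖ ^ 2) / (2 * z.im * a.im) := by gcongr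
    _ = _ := by field_simp

/-- Functions of bounded type have limited growth in the upper half-plane. -/
theorem BoundedType.exists_growth {u : ℂ → ℂ} (hu : BoundedType u) :
    ∃ K : ℝ, 0 ≤ K ∧ ∀ z : ℂ, 0 < z.im → ‖u z‖ ≤ 1 * Real.exp (K * (1 + ‖z‖ ^ 2) / z.im) := by
  obtain ⟨hd, g, h, _, hh, ⟨Mg, hMg⟩, ⟨Mh, hMh⟩, ⟨a, ha, hha⟩, heq⟩ := hu
  have ha' : 0 < a.im := ha
  -- Dividing by a common bound `M` normalizes numerator and denominator; the point `a` with `h a ≠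
  -- 0` becomes the centre of the disc.
  set M : ℝ := max 1 (max Mg Mh) with hM
  have hM0 : 0 < M := lt_max_of_lt_left one_pos
  have hmaps : ∀ ζ ∈ Metric.ball (0 : ℂ) 1, invCayley a ζ ∈ upper := fun ζ hζ =>
    im_invCayley_pos ha' (by simpa using hζ)
  have hdi : DifferentiableOn ℂ (invCayley a) (Metric.ball 0 1) := fun ζ hζ =>
    (differentiableAt_invCayley (by simpa using hζ)).differentiableWithinAt
  set L := 4 * (4 - Real.log ‖h (invCayley a 0) / M‖) with hL
  have hbound : ∀ z : ℂ, 0 < z.im → ‖u z‖ ≤ Real.exp (L / (1 - ‖cayley a z‖)) := by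
    intro z hz
    have := norm_le_of_disc_quotient (U := fun ζ => u (invCayley a ζ))
      (H := fun ζ => h (invCayley a ζ) / M) (hd.comp hdi hmaps) ((hh.comp hdi hmaps).div_const _)
      (fun ζ hζ => by
        rw [norm_div, norm_real, Real.norm_of_nonneg hM0.le, div_le_one hM0]
        exact (hMh _ (hmaps ζ hζ)).trans ((le_max_right _ _).trans (le_max_right _ _)))
      (fun ζ hζ => by
        rw [← mul_div_assoc, heq _ (hmaps ζ hζ), norm_div, norm_real, Real.norm_of_nonneg hM0.le,
          div_le_one hM0]
        exact (hMg _ (hmaps ζ hζ)).trans ((le_max_left _ _).trans (le_max_right _ _)))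
      (by
        rw [invCayley_zero]
        exact div_ne_zero hha (by exact_mod_cast hM0.ne'))
      (norm_cayley_lt_one ha' hz)
    simpa only [invCayley_cayley ha' hz] using this
  refine ⟨|L| * ((1 + ‖a‖ ^ 2) / (2 * a.im)), by positivity, fun z hz => ?_⟩
  rw [one_mul]
  refine (hbound z hz).trans (Real.exp_le_exp.2 ?_)
  have h1 := inv_one_sub_norm_cayley_le ha' hz
  have h2 := norm_cayley_lt_one ha' hz
  calc L / (1 - ‖cayley a z‖) = L * (1 / (1 - ‖cayley a z‖)) := by ring
    _ ≤ |L| * (1 / (1 - ‖cayley a z‖)) :=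
        mul_le_mul_of_nonneg_right (le_abs_self L) (one_div_nonneg.2 (by linarith))
    _ ≤ |L| * ((1 + ‖a‖ ^ 2) / (2 * a.im) * ((1 + ‖z‖ ^ 2) / z.im)) :=
        mul_le_mul_of_nonneg_left h1 (abs_nonneg _)
    _ = _ := by ring

/-- Growth of analytic functions with nonnegative real part in the upper half-plane. -/
theorem exists_norm_le_of_re_nonneg {W : ℂ → ℂ} (hd : DifferentiableOn ℂ W upper)
    (hre : ∀ z ∈ upper, 0 ≤ (W z).re) :
    ∃ C : ℝ, 0 ≤ C ∧ ∀ z : ℂ, 0 < z.im → ‖W z‖ ≤ C * ((1 + ‖z‖ ^ 2) / z.im) := by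
  have hI : 0 < (I : ℂ).im := by simp
  have hmaps : ∀ ζ ∈ Metric.ball (0 : ℂ) 1, invCayley I ζ ∈ upper := fun ζ hζ =>
    im_invCayley_pos hI (by simpa using hζ)
  have hdi : DifferentiableOn ℂ (invCayley I) (Metric.ball 0 1) := fun ζ hζ =>
    (differentiableAt_invCayley (by simpa using hζ)).differentiableWithinAt
  refine ⟨2 + 2 * ‖W I‖, by positivity, fun z hz => ?_⟩
  have h2 := norm_cayley_lt_one hI hz
  have h := Complex.borelCaratheodory (f := fun ζ => - W (invCayley I ζ)) (M := 1) (R := 1)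
    (z := cayley I z) one_pos (hd.comp hdi hmaps).neg (fun ζ hζ => by
      have := hre _ (hmaps ζ hζ)
      simp only [mem_ofPred_eq, neg_re]
      linarith) one_pos (by simpa using h2)
  rw [norm_neg, norm_neg, invCayley_cayley hI hz, invCayley_zero] at h
  have h1 := inv_one_sub_norm_cayley_le hI hz
  simp only [norm_I, I_im] at h1
  norm_num at h1
  refine h.trans ?_
  have h0 := norm_nonneg (cayley I z)
  have hp : 0 ≤ 1 / (1 - ‖cayley I z‖) := one_div_nonneg.2 (by linarith)
  calc _ = (2 * ‖cayley I z‖ + ‖W I‖ * (1 + ‖cayley I z‖)) * (1 / (1 - ‖cayley I z‖)) := by ring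
    _ ≤ (2 + 2 * ‖W I‖) * ((1 + ‖z‖ ^ 2) / z.im) := by
        refine mul_le_mul ?_ (by simpa using h1) hp (by positivity)
        nlinarith [norm_nonneg (W I)]

/-! ### Mean type and the Smirnov-type estimate. -/

theorem eventually_norm_le_of_meanType_le {u : ℂ → ℂ} (hu : meanType u ≤ 0) {ε : ℝ} (hε : 0 < ε) :
    ∀ᶠ y : ℝ in atTop, ‖u (y * I)‖ ≤ Real.exp (ε * y) := by
  have h : meanType u < (ε : EReal) := hu.trans_lt (by exact_mod_cast hε)
  filter_upwards [eventually_lt_of_limsup_lt h, eventually_gt_atTop 0] with y hy hy0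
  rw [EReal.div_lt_iff (by exact_mod_cast hy0) (EReal.coe_ne_top y), ← EReal.coe_mul] at hy
  have e : ((ε * y : ℝ) : EReal) = ENNReal.log (ENNReal.ofReal (Real.exp (ε * y))) := by
    rw [ENNReal.log_ofReal_of_pos (Real.exp_pos _), Real.log_exp]
  rw [e, ENNReal.log_lt_log_iff, ← ofReal_norm] at hy
  exact ((ENNReal.ofReal_lt_ofReal_iff (Real.exp_pos _)).1 hy).le

/-- Phragmén–Lindelöf in the half-plane `im z ≥ 1`, for functions of exponential growth and
nonpositive mean type. -/
theorem norm_le_of_meanType_le {u : ℂ → ℂ} (hu : ∀ z : ℂ, 0 ≤ z.im → AnalyticAt ℂ u z)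
    {C k : ℝ} (hk : 0 ≤ k) (hb : ∀ z : ℂ, 1 ≤ z.im → ‖u z‖ ≤ C * Real.exp (k * z.im))
    (hm : meanType u ≤ 0) {z : ℂ} (hz : 1 ≤ z.im) : ‖u z‖ ≤ C * Real.exp k := by
  have hC : 0 ≤ C := by
    have := (norm_nonneg _).trans (hb z hz)
    exact nonneg_of_mul_nonneg_left this (Real.exp_pos _)
  have him : ∀ ζ : ℂ, (I * (ζ + 1)).im = ζ.re + 1 := fun ζ => by simp
  have hε : ∀ ε : ℝ, 0 < ε → ‖u z‖ * Real.exp (-(ε * (z.im - 1))) ≤ C * Real.exp k := by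
    intro ε hε
    -- The map `ζ ↦ i(ζ + 1)` takes the right half-plane to `im z > 1`. The factor `exp(-εζ)`
    -- cancels the growth `e^{εy}` that the mean type permits on the imaginary axis and is
    -- unimodular on the boundary line.
    set g : ℂ → ℂ := fun ζ => u (I * (ζ + 1)) * exp (-(ε * ζ)) with hg
    have hgn : ∀ ζ : ℂ, ‖g ζ‖ = ‖u (I * (ζ + 1))‖ * Real.exp (-(ε * ζ.re)) := fun ζ => by
      rw [hg, norm_mul, norm_exp]; simp
    have hda : ∀ ζ : ℂ, 0 ≤ ζ.re → DifferentiableAt ℂ g ζ := by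
      intro ζ hζ
      refine DifferentiableAt.mul ?_ (by fun_prop)
      refine DifferentiableAt.comp ζ (hu _ ?_).differentiableAt (by fun_prop)
      rw [him]; linarith
    have hcl : closure {ζ : ℂ | 0 < ζ.re} = {ζ : ℂ | 0 ≤ ζ.re} := closure_setOfPred_lt_re 0
    have h := PhragmenLindelof.right_half_plane_of_bounded_on_real (f := g) (C := C * Real.exp k)
      (z := -I * z - 1)
      (DifferentiableOn.diffContOnCl (by
        rw [hcl]; exact fun ζ hζ => (hda ζ hζ).differentiableWithinAt))
      ⟨1, one_lt_two, k, by
        refine Asymptotics.IsBigO.of_bound (C * Real.exp k) ?_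
        have : ∀ᶠ ζ : ℂ in Bornology.cobounded ℂ ⊓ 𝓟 {ζ : ℂ | 0 < ζ.re}, 0 < ζ.re :=
          eventually_inf_principal.2 (Eventually.of_forall fun _ h => h)
        filter_upwards [this] with ζ hζ
        rw [hgn, Real.norm_of_nonneg (Real.exp_pos _).le, Real.rpow_one]
        have h1 := hb (I * (ζ + 1)) (by rw [him]; linarith)
        rw [him] at h1
        have h2 : Real.exp (-(ε * ζ.re)) ≤ 1 := by
          rw [Real.exp_le_one_iff]; nlinarith
        calc _ ≤ ‖u (I * (ζ + 1))‖ := mul_le_of_le_one_right (norm_nonneg _) h2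
          _ ≤ C * Real.exp (k * (ζ.re + 1)) := h1
          _ ≤ C * Real.exp (k + k * ‖ζ‖) := by
              refine mul_le_mul_of_nonneg_left (Real.exp_le_exp.2 ?_) hC
              have := mul_le_mul_of_nonneg_left ((le_abs_self _).trans (abs_re_le_norm ζ)) hk
              linarith
          _ = _ := by rw [Real.exp_add, mul_assoc]⟩
      (by
        refine isBoundedUnder_of_eventually_le (a := Real.exp ε) ?_
        have h1 := (tendsto_atTop_add_const_right atTop (1 : ℝ) tendsto_id).eventually
          (eventually_norm_le_of_meanType_le hm hε)
        filter_upwards [h1] with x hx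
        rw [hgn]
        simp only [id, ofReal_add, ofReal_one] at hx
        rw [mul_comm I, ofReal_re]
        calc _ ≤ Real.exp (ε * (x + 1)) * Real.exp (-(ε * x)) :=
              mul_le_mul_of_nonneg_right hx (Real.exp_pos _).le
          _ = _ := by rw [← Real.exp_add]; congr 1; ring)
      (by
        intro x
        rw [hgn]
        have h1 := hb (I * (x * I + 1)) (by rw [him]; simp)
        rw [him] at h1
        simpa using h1)
      (by simp; linarith)
    rw [hgn] at h
    have e1 : I * (-I * z - 1 + 1) = z := by
      rw [sub_add_cancel, ← mul_assoc, mul_neg, I_mul_I, neg_neg, one_mul]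
    have e2 : (-I * z - 1).re = z.im - 1 := by simp
    rwa [e1, e2] at h
  have hlim : Tendsto (fun ε : ℝ => ‖u z‖ * Real.exp (-(ε * (z.im - 1)))) (𝓝[>] 0) (𝓝 (‖u z‖)) := by
    have : Continuous fun ε : ℝ => ‖u z‖ * Real.exp (-(ε * (z.im - 1))) := by fun_prop
    have := this.tendsto 0
    simp only [zero_mul, neg_zero, Real.exp_zero, mul_one] at this
    exact this.mono_left nhdsWithin_le_nhds
  refine le_of_tendsto hlim ?_
  filter_upwards [self_mem_nhdsWithin] with ε hε' using hε ε hε'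

theorem one_add_inv_sqrt_le_growth {y K : ℝ} (hy : 0 < y) (hK : 0 < K) {x : ℝ} (hx : 0 ≤ x) :
    1 + 1 / √y ≤ (2 + 1 / K) * Real.exp (K * (1 + x) / y) := by
  have h1 : 1 / √y ≤ 1 + 1 / y := by
    have hs : 0 < √y := Real.sqrt_pos.2 hy
    have : 1 / y = (1 / √y) ^ 2 := by rw [div_pow, Real.sq_sqrt hy.le, one_pow]
    rw [this]
    nlinarith [sq_nonneg (1 / √y - 1), show 0 < 1 / √y by positivity]
  have h2 : K / y ≤ K * (1 + x) / y := by
    gcongr; nlinarith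
  have h3 := Real.add_one_le_exp (K * (1 + x) / y)
  have h4 : 1 / y ≤ 1 / K * Real.exp (K * (1 + x) / y) := by
    calc 1 / y = 1 / K * (K / y) := by field_simp
      _ ≤ _ := by gcongr; linarith
  have h5 : 0 ≤ K * (1 + x) / y := by positivity
  nlinarith

/-- Boundedness of `u √(im z)` yields subexponential growth. -/
theorem growth_of_norm_le_inv_sqrt {u : ℂ → ℂ} {C : ℝ} (hC : 0 ≤ C)
    (hb : ∀ z : ℂ, 0 < z.im → ‖u z‖ ≤ C * (1 + 1 / √z.im)) :
    ∀ K > 0, ∃ M, ∀ z : ℂ, 0 < z.im → ‖u z‖ ≤ M * Real.exp (K * (1 + ‖z‖ ^ 2) / z.im) := by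
  intro K hK
  refine ⟨C * (2 + 1 / K), fun z hz => (hb z hz).trans ?_⟩
  rw [mul_assoc]
  exact mul_le_mul_of_nonneg_left (one_add_inv_sqrt_le_growth hz hK (by positivity)) hC

/-- The Smirnov-type theorem: bounded type, nonpositive mean type and square integrable boundary
values imply the Hardy space estimate. -/
theorem norm_le_of_boundedType {u : ℂ → ℂ} (hu : ∀ z : ℂ, 0 ≤ z.im → AnalyticAt ℂ u z)
    (hbt : BoundedType u) (hm : meanType u ≤ 0) (h2 : MemLp (fun t : ℝ => u t) 2)
    {w : ℂ} (hw : 0 < w.im) :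
    ‖u w‖ ≤ √(∫ t : ℝ, ‖u t‖ ^ 2) / √(Real.pi * w.im) := by
  obtain ⟨K, hK, hg⟩ := hbt.exists_growth
  set N := √(∫ t : ℝ, ‖u t‖ ^ 2) with hN
  have hN0 : 0 ≤ N := Real.sqrt_nonneg _
  have hpi := Real.pi_pos
  have hsp : 0 < √Real.pi := Real.sqrt_pos.2 hpi
  set k := 2 * (K + 1) with hk
  -- Bounded type gives growth at some rate `K`; damping at rate `K + 1` costs `exp(k im z)` with `k
  -- = 2(K + 1)`.
  have h1 : ∀ z : ℂ, 0 < z.im → ‖u z‖ ≤ N / √Real.pi * (1 / √z.im) * Real.exp (k * z.im) := by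
    intro z hz
    have := norm_le_exp_mul_of_growth hu hz hK (lt_add_one K) hg h2
    rw [Real.sqrt_mul hpi.le] at this
    refine this.trans (le_of_eq ?_)
    have hs : 0 < √z.im := Real.sqrt_pos.2 hz
    rw [← hN, ← hk]
    field_simp
  have h3 : ∀ z : ℂ, 1 ≤ z.im → ‖u z‖ ≤ N / √Real.pi * Real.exp k := by
    intro z hz
    refine norm_le_of_meanType_le hu (by positivity) (fun z hz => ?_) hm hz
    refine (h1 z (by linarith)).trans ?_
    refine mul_le_mul_of_nonneg_right ?_ (Real.exp_pos _).le
    refine mul_le_of_le_one_right (by positivity) ?_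
    rw [div_le_one (Real.sqrt_pos.2 (by linarith))]
    exact Real.one_le_sqrt.2 hz
  -- Above height one the exponential is removed by Phragmén–Lindelöf, below it is at most `e^k`. So
  -- `u = O(1 + 1/√(im z))`, which is growth at every positive rate, and the sharp bound follows.
  refine norm_le_of_growth hu hw (growth_of_norm_le_inv_sqrt (C := N / √Real.pi * Real.exp k)
    (by positivity) fun z hz => ?_) h2
  have hs : 0 < 1 / √z.im := one_div_pos.2 (Real.sqrt_pos.2 hz)
  rcases le_total 1 z.im with hz1 | hz1
  · refine (h3 z hz1).trans (le_mul_of_one_le_right (by positivity) (by linarith))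
  · calc _ ≤ N / √Real.pi * (1 / √z.im) * Real.exp (k * z.im) := h1 z hz
      _ ≤ N / √Real.pi * (1 / √z.im) * Real.exp k := by
          refine mul_le_mul_of_nonneg_left (Real.exp_le_exp.2 ?_) (by positivity)
          nlinarith
      _ = N / √Real.pi * Real.exp k * (1 / √z.im) := by ring
      _ ≤ _ := mul_le_mul_of_nonneg_left (by linarith) (by positivity)

/-! ### Hardy estimates for elements of the de Branges space. -/

theorem differentiable_star {f : ℂ → ℂ} (hf : Differentiable ℂ f) : Differentiable ℂ (star f) := by
  intro z
  have h := (hf (conj z)).conj_conj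
  rw [conj_conj] at h
  exact h

theorem star_star_apply (f : ℂ → ℂ) : star (star f) = f := by
  ext z; simp [star]

theorem star_ofReal (f : ℂ → ℂ) (t : ℝ) : star f t = conj (f t) := by simp [star]

theorem norm_star (f : ℂ → ℂ) (z : ℂ) : ‖star f z‖ = ‖f (conj z)‖ := by
  rw [star, RCLike.norm_conj]

section HermiteBiehler

variable {E f : ℂ → ℂ}

theorem HermiteBiehler.ne_zero (hE : HermiteBiehler E) (hr : NoRealZeros E) {z : ℂ}
    (hz : 0 ≤ z.im) : E z ≠ 0 := by
  rcases hz.eq_or_lt with h | h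
  · have : z = (z.re : ℂ) := by apply Complex.ext <;> simp [← h]
    rw [this]; exact hr _
  · exact norm_pos_iff.1 ((norm_nonneg _).trans_lt (hE.lt z h))

theorem HermiteBiehler.norm_star_div_lt (hE : HermiteBiehler E) {z : ℂ} (hz : 0 < z.im) :
    ‖star E z / E z‖ < 1 := by
  have h := hE.lt z hz
  rw [norm_div, norm_star, div_lt_one ((norm_nonneg _).trans_lt h)]
  exact h

theorem HermiteBiehler.analyticAt_div (hE : HermiteBiehler E) (hr : NoRealZeros E)
    (hf : Differentiable ℂ f) {z : ℂ} (hz : 0 ≤ z.im) : AnalyticAt ℂ (fun z => f z / E z) z :=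
  (hf.analyticAt z).fun_div (hE.entire.analyticAt z) (hE.ne_zero hr hz)

theorem continuous_div_real (hr : NoRealZeros E) (hE : HermiteBiehler E) (hf : Differentiable ℂ f) :
    Continuous fun t : ℝ => f t / E t :=
  (hf.continuous.comp continuous_ofReal).div (hE.entire.continuous.comp continuous_ofReal) hr

/-- Entire functions whose quotients by `E` satisfy the Hardy space estimate. -/
structure MemHardy (E f : ℂ → ℂ) : Prop where
  entire : Differentiable ℂ f
  memLp : MemLp (fun t : ℝ => f t / E t) 2
  bound : ∃ C : ℝ, ∀ z : ℂ, 0 < z.im → ‖f z / E z‖ ≤ C / √z.im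
  bound_star : ∃ C : ℝ, ∀ z : ℂ, 0 < z.im → ‖star f z / E z‖ ≤ C / √z.im

theorem norm_star_div_real (t : ℝ) : ‖star f t / E t‖ = ‖f t / E t‖ := by
  rw [norm_div, norm_star, conj_ofReal, norm_div]

theorem normSq_star : normSq E (star f) = normSq E f := by
  simp only [normSq, norm_star_div_real]

theorem norm_star_eq : norm E (star f) = norm E f := by rw [norm, normSq_star, norm]

theorem memLp_star (hE : HermiteBiehler E) (hr : NoRealZeros E) (hf : Differentiable ℂ f)
    (h : MemLp (fun t : ℝ => f t / E t) 2) : MemLp (fun t : ℝ => star f t / E t) 2 :=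
  h.of_le (continuous_div_real hr hE (differentiable_star hf)).aestronglyMeasurable
    (Eventually.of_forall fun t => (norm_star_div_real t).le)

theorem MemHardy.star (hE : HermiteBiehler E) (hr : NoRealZeros E) (hf : MemHardy E f) :
    MemHardy E (star f) where
  entire := differentiable_star hf.entire
  memLp := memLp_star hE hr hf.entire hf.memLp
  bound := hf.bound_star
  bound_star := by rw [star_star_apply]; exact hf.bound

/-- The only place where bounded type and mean type of elements of the space are exploited.
Afterwards `MemHardy` is used, whose bounds survive limits and multiplication by `F`. -/
theorem MemSpace.memHardy (hE : HermiteBiehler E) (hr : NoRealZeros E) (hf : MemSpace E f) :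
    MemHardy E f := by
  have hL : MemLp (fun t : ℝ => f t / E t) 2 := by
    rw [memLp_two_iff_integrable_sq_norm
      (continuous_div_real hr hE hf.entire).aestronglyMeasurable]
    exact hf.integrable
  have key : ∀ {g : ℂ → ℂ}, Differentiable ℂ g → MemLp (fun t : ℝ => g t / E t) 2 →
      BoundedType (fun z => g z / E z) → meanType (fun z => g z / E z) ≤ 0 →
      ∃ C : ℝ, ∀ z : ℂ, 0 < z.im → ‖g z / E z‖ ≤ C / √z.im := by
    intro g hg h2 hbt hm
    refine ⟨√(∫ t : ℝ, ‖g t / E t‖ ^ 2) / √Real.pi, fun z hz => ?_⟩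
    refine (norm_le_of_boundedType (fun w hw => hE.analyticAt_div hr hg hw) hbt hm h2 hz).trans ?_
    rw [Real.sqrt_mul Real.pi_pos.le, div_div]
  exact ⟨hf.entire, hL, key hf.entire hL hf.boundedType hf.meanType_le,
    key (differentiable_star hf.entire) (memLp_star hE hr hf.entire hL) hf.boundedType_star
      hf.meanType_star_le⟩

theorem MemHardy.growth (hf : MemHardy E f) :
    ∀ K > 0, ∃ M, ∀ z : ℂ, 0 < z.im → ‖f z / E z‖ ≤ M * Real.exp (K * (1 + ‖z‖ ^ 2) / z.im) := by
  obtain ⟨C, hC⟩ := hf.bound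
  have hC0 : 0 ≤ C := by
    have := (norm_nonneg _).trans (hC I (by simp))
    simpa using this
  refine growth_of_norm_le_inv_sqrt (u := fun z => f z / E z) hC0 fun z hz => ?_
  refine (hC z hz).trans ?_
  rw [div_eq_mul_one_div]
  exact mul_le_mul_of_nonneg_left (by linarith) hC0

/-- The unspecified constants in `MemHardy` give growth at every rate; the Poisson formula then
improves them to the norm itself. -/
theorem MemHardy.norm_le (hE : HermiteBiehler E) (hr : NoRealZeros E) (hf : MemHardy E f) {z : ℂ}
    (hz : 0 < z.im) : ‖f z / E z‖ ≤ norm E f / √(Real.pi * z.im) :=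
  norm_le_of_growth (u := fun z => f z / E z) (fun _ hw => hE.analyticAt_div hr hf.entire hw) hz
    hf.growth hf.memLp

theorem MemHardy.norm_star_le (hE : HermiteBiehler E) (hr : NoRealZeros E) (hf : MemHardy E f)
    {z : ℂ} (hz : 0 < z.im) : ‖DeBranges.star f z / E z‖ ≤ norm E f / √(Real.pi * z.im) := by
  rw [← norm_star_eq]
  exact (hf.star hE hr).norm_le hE hr hz

end HermiteBiehler

/-! ### Cauchy quotients at real points. -/

section CauchyReal

/-- A rational function analytic in the closed upper half-plane with value `1` at `x`. -/
noncomputable def cauchyFactor (x : ℝ) (z : ℂ) : ℂ := I / (z - x + I)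

theorem one_le_norm_sub_add_I (x : ℝ) {z : ℂ} (hz : 0 ≤ z.im) : 1 ≤ ‖z - x + I‖ := by
  refine le_trans ?_ (abs_im_le_norm _)
  refine le_trans ?_ (le_abs_self _)
  simp [hz]

theorem sub_add_I_ne_zero (x : ℝ) {z : ℂ} (hz : 0 ≤ z.im) : z - x + I ≠ 0 :=
  norm_pos_iff.1 (one_pos.trans_le (one_le_norm_sub_add_I x hz))

theorem norm_cauchyFactor_le (x : ℝ) {z : ℂ} (hz : 0 ≤ z.im) : ‖cauchyFactor x z‖ ≤ 1 := by
  rw [cauchyFactor, norm_div, norm_I]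
  exact div_le_one_of_le₀ (one_le_norm_sub_add_I x hz) (norm_nonneg _)

theorem cauchyFactor_self (x : ℝ) : cauchyFactor x x = 1 := by simp [cauchyFactor]

theorem analyticAt_cauchyFactor (x : ℝ) {z : ℂ} (hz : 0 ≤ z.im) :
    AnalyticAt ℂ (cauchyFactor x) z := by
  have := sub_add_I_ne_zero x hz
  unfold cauchyFactor
  fun_prop (disch := assumption)

theorem sq_norm_cauchyFactor (x t : ℝ) :
    ‖cauchyFactor x t‖ ^ 2 = 1 / ((t - x) ^ 2 + 1) := by
  rw [cauchyFactor, norm_div, norm_I, div_pow, one_pow, ← normSq_eq_norm_sq, normSq_apply]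
  congr 1
  simp
  ring

theorem poissonUpper_add_I (x t : ℝ) :
    poissonUpper (x + I) t = 1 / Real.pi * (1 / ((t - x) ^ 2 + 1)) := by
  rw [poissonUpper, normSq_apply]
  simp
  ring

theorem integrable_inv_sq_add_one (x : ℝ) : Integrable fun t : ℝ => 1 / ((t - x) ^ 2 + 1) := by
  have h := (integrable_poissonUpper (w := x + I) (by simp)).const_mul Real.pi
  refine h.congr (Eventually.of_forall fun t => ?_)
  have := Real.pi_ne_zero
  simp only [poissonUpper_add_I]
  field_simp

theorem continuous_cauchyFactor (x : ℝ) : Continuous fun t : ℝ => cauchyFactor x t := by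
  unfold cauchyFactor
  refine continuous_const.div (by fun_prop) fun t => sub_add_I_ne_zero x (by simp)

theorem memLp_cauchyFactor (x : ℝ) : MemLp (fun t : ℝ => cauchyFactor x t) 2 := by
  rw [memLp_two_iff_integrable_sq_norm (continuous_cauchyFactor x).aestronglyMeasurable]
  simp only [sq_norm_cauchyFactor]
  exact integrable_inv_sq_add_one x

variable {u : ℂ → ℂ}

/-- The difference quotient at `x` of `u`, corrected to be integrable on the real line. -/
noncomputable def cauchyQuotient (u : ℂ → ℂ) (x : ℝ) : ℂ → ℂ :=
  dslope (fun z => u z - u x * cauchyFactor x z) x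

theorem sub_mul_cauchyQuotient (x : ℝ) (z : ℂ) :
    (z - x) * cauchyQuotient u x z = u z - u x * cauchyFactor x z := by
  rw [cauchyQuotient, ← smul_eq_mul, sub_smul_dslope]
  simp [cauchyFactor_self]

theorem analyticAt_sub_cauchyFactor (hu : ∀ z : ℂ, 0 ≤ z.im → AnalyticAt ℂ u z) (x : ℝ) {z : ℂ}
    (hz : 0 ≤ z.im) : AnalyticAt ℂ (fun z => u z - u x * cauchyFactor x z) z :=
  (hu z hz).fun_sub (analyticAt_const.fun_mul (analyticAt_cauchyFactor x hz))

theorem differentiableAt_cauchyQuotient (hu : ∀ z : ℂ, 0 ≤ z.im → AnalyticAt ℂ u z) (x : ℝ) {z : ℂ}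
    (hz : 0 ≤ z.im) : DifferentiableAt ℂ (cauchyQuotient u x) z :=
  differentiableAt_dslope (analyticAt_sub_cauchyFactor hu x (by simp))
    (analyticAt_sub_cauchyFactor hu x hz)

/-- Near `x` the quotient is continuous. At distance at least one, `1/|t - x| ≤ 2|cauchyFactor x
t|`, so it is dominated by a product of two `L²` functions. Subtracting the constant `u x` instead
would leave a nonintegrable tail of order `1/|t|`. -/
theorem integrable_cauchyQuotient (hu : ∀ z : ℂ, 0 ≤ z.im → AnalyticAt ℂ u z) (x : ℝ)
    (h2 : MemLp (fun t : ℝ => u t) 2) : Integrable fun t : ℝ => cauchyQuotient u x t := by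
  have hc : Continuous fun t : ℝ => cauchyQuotient u x t := by
    rw [continuous_iff_continuousAt]
    intro t
    exact (differentiableAt_cauchyQuotient hu x (by simp)).continuousAt.comp
      continuous_ofReal.continuousAt
  obtain ⟨B, hB⟩ := (isCompact_Icc (a := x - 1) (b := x + 1)).exists_bound_of_continuousOn
    hc.continuousOn
  have hw : MemLp (fun t : ℝ => u t - u x * cauchyFactor x t) 2 :=
    h2.sub ((memLp_cauchyFactor x).const_mul _)
  have hi : Integrable fun t : ℝ => ‖u t - u x * cauchyFactor x t‖ * (2 * ‖cauchyFactor x t‖) :=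
    hw.norm.integrable_mul ((memLp_cauchyFactor x).norm.const_mul 2)
  have hind : Integrable ((Icc (x - 1) (x + 1)).indicator fun _ : ℝ => B) :=
    (integrable_indicator_iff measurableSet_Icc).2
      (integrableOn_const (by simp))
  refine (hind.add hi).mono' hc.aestronglyMeasurable (Eventually.of_forall fun t => ?_)
  simp only [Pi.add_apply]
  by_cases ht : t ∈ Icc (x - 1) (x + 1)
  · rw [indicator_of_mem ht]
    exact (hB t ht).trans (le_add_of_nonneg_right (by positivity))
  · rw [indicator_of_notMem ht, zero_add, ← sub_mul_cauchyQuotient, norm_mul]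
    have h1 : 1 ≤ |t - x| := by
      by_contra h
      rw [not_le, abs_lt] at h
      exact ht ⟨by linarith [h.1], by linarith [h.2]⟩
    have h3 : ‖(t : ℂ) - x‖ = |t - x| := by rw [← ofReal_sub, norm_real, Real.norm_eq_abs]
    have h4 : 1 ≤ |t - x| * (2 * ‖cauchyFactor x t‖) := by
      have h5 := sq_norm_cauchyFactor x t
      have h6 : 1 ≤ (|t - x| * (2 * ‖cauchyFactor x t‖)) ^ 2 := by
        rw [mul_pow, mul_pow, h5, sq_abs]
        have h7 : 1 ≤ (t - x) ^ 2 := by rw [← sq_abs]; nlinarith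
        rw [← mul_assoc, mul_one_div, le_div_iff₀ (by positivity)]
        nlinarith
      have h8 : 0 ≤ |t - x| * (2 * ‖cauchyFactor x t‖) := by positivity
      nlinarith
    rw [h3]
    calc _ = ‖cauchyQuotient u x t‖ * 1 := (mul_one _).symm
      _ ≤ ‖cauchyQuotient u x t‖ * (|t - x| * (2 * ‖cauchyFactor x t‖)) :=
          mul_le_mul_of_nonneg_left h4 (norm_nonneg _)
      _ = _ := by ring

theorem integral_cauchyQuotient (hu : ∀ z : ℂ, 0 ≤ z.im → AnalyticAt ℂ u z) (x : ℝ)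
    (hb : ∀ K > 0, ∃ M, ∀ z : ℂ, 0 < z.im → ‖u z‖ ≤ M * Real.exp (K * (1 + ‖z‖ ^ 2) / z.im))
    (h2 : MemLp (fun t : ℝ => u t) 2) : ∫ t : ℝ, cauchyQuotient u x t = 0 := by
  refine integral_eq_zero_of_growth (fun z hz => differentiableAt_cauchyQuotient hu x hz) ?_
    (integrable_cauchyQuotient hu x h2)
  intro K hK
  obtain ⟨M, hM⟩ := hb K hK
  obtain ⟨M', _, h⟩ := exists_dslope_growth (u := fun z => u z - u x * cauchyFactor x z)
    (w := x) (M := M + ‖u x‖) (fun z hz => analyticAt_sub_cauchyFactor hu x hz) (by simp) hK.le (fun z hz => by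
      refine (norm_sub_le _ _).trans ?_
      rw [add_mul, norm_mul]
      refine add_le_add (hM z hz) (mul_le_mul_of_nonneg_left ?_ (norm_nonneg _))
      exact (norm_cauchyFactor_le x hz.le).trans (one_le_exp_growth hK.le hz))
  exact ⟨M', h⟩

end CauchyReal

/-! ### The reproducing kernel at real points and the reproducing property. -/

section Kernel

variable {E f : ℂ → ℂ}

theorem differentiable_kernelNum (hE : HermiteBiehler E) (w : ℂ) :
    Differentiable ℂ (kernelNum E w) := by
  unfold kernelNum
  exact (hE.entire.const_mul _).sub ((differentiable_star hE.entire).const_mul _)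

theorem kernelNum_self (x : ℝ) : kernelNum E x x = 0 := by
  simp [kernelNum, star_ofReal, mul_comm]

/-- The case distinction in `kernel` is a divided difference, which makes the kernel visibly entire.
-/
theorem kernel_real_eq (x : ℝ) :
    kernel E x = fun z => -dslope (kernelNum E x) x z / (2 * Real.pi * I) := by
  ext z
  rw [kernel, conj_ofReal]
  split_ifs with h
  · rw [h, dslope_same]
  · rw [dslope_of_ne _ h, slope_def_field, kernelNum_self, sub_zero]
    have h1 : (x : ℂ) - z ≠ 0 := sub_ne_zero.2 (Ne.symm h)
    have h2 : z - (x : ℂ) ≠ 0 := sub_ne_zero.2 h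
    have hpi : (Real.pi : ℂ) ≠ 0 := by exact_mod_cast Real.pi_ne_zero
    field_simp
    ring

theorem differentiable_kernel_real (hE : HermiteBiehler E) (x : ℝ) :
    Differentiable ℂ (kernel E x) := by
  rw [kernel_real_eq]
  intro z
  exact ((differentiableAt_dslope ((differentiable_kernelNum hE x).analyticAt _)
    ((differentiable_kernelNum hE x).analyticAt _)).neg).div_const _

theorem sub_mul_kernel_real (x : ℝ) (z : ℂ) :
    (z - x) * kernel E x z = -kernelNum E x z / (2 * Real.pi * I) := by
  have h := sub_smul_dslope (kernelNum E x) x z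
  rw [kernelNum_self, sub_zero, smul_eq_mul] at h
  rw [kernel_real_eq, ← h]
  ring

theorem kernelNum_real_real (x t : ℝ) :
    kernelNum E x t = conj (E x) * E t - E x * conj (E t) := by
  simp [kernelNum, star_ofReal]

theorem star_kernel_real (hE : HermiteBiehler E) (x : ℝ) : star (kernel E x) = kernel E x := by
  have hc := (differentiable_star (differentiable_kernel_real hE x)).continuous
  have hd : Dense ({(x : ℂ)}ᶜ : Set ℂ) := dense_compl_singleton _
  refine hc.ext_on hd (differentiable_kernel_real hE x).continuous fun z hz => ?_
  have hz' : z - x ≠ 0 := sub_ne_zero.2 hz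
  have h1 := sub_mul_kernel_real (E := E) x z
  have h2 := congrArg conj (sub_mul_kernel_real (E := E) x (conj z))
  refine mul_left_cancel₀ hz' ?_
  rw [h1, DeBranges.star]
  simp only [map_mul, map_sub, conj_conj, conj_ofReal, map_div₀, map_neg, conj_I, map_ofNat,
    kernelNum] at h2 ⊢
  rw [h2]
  simp only [DeBranges.star, conj_conj]
  have hpi : (Real.pi : ℂ) ≠ 0 := by exact_mod_cast Real.pi_ne_zero
  field_simp
  ring

/-- The reproducing property at real points. -/
theorem MemHardy.reproducing (hE : HermiteBiehler E) (hr : NoRealZeros E) (hf : MemHardy E f)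
    (x : ℝ) : ∫ t : ℝ, conj (kernel E x t / E t) * (f t / E t) = f x := by
  set u : ℂ → ℂ := fun z => f z / E z with hu
  set v : ℂ → ℂ := fun z => DeBranges.star f z / E z with hv
  have hs := hf.star hE hr
  have hua : ∀ z : ℂ, 0 ≤ z.im → AnalyticAt ℂ u z := fun _ hz => hE.analyticAt_div hr hf.entire hz
  have hva : ∀ z : ℂ, 0 ≤ z.im → AnalyticAt ℂ v z := fun _ hz => hE.analyticAt_div hr hs.entire hz
  have iu := integrable_cauchyQuotient hua x hf.memLp
  have iv := integrable_cauchyQuotient hva x hs.memLp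
  have zu := integral_cauchyQuotient hua x hf.growth hf.memLp
  have zv := integral_cauchyQuotient hva x hs.growth hs.memLp
  have iv' : Integrable fun t : ℝ => conj (cauchyQuotient v x t) :=
    (LinearIsometryEquiv.integrable_comp_iff (Complex.conjLIE)).2 iv
  have zv' : ∫ t : ℝ, conj (cauchyQuotient v x t) = 0 := by
    rw [integral_conj, zv, map_zero]
  have hw : 0 < ((x : ℂ) + I).im := by simp
  have ip := integrable_poissonUpper_ofReal hw
  have hpi : (Real.pi : ℂ) ≠ 0 := by exact_mod_cast Real.pi_ne_zero
  -- The two terms of the kernel give the Cauchy quotients of `f/E` and `f^*/E`, whose integrals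
  -- vanish. Their correction terms combine as `(1/(t-x+i) + 1/(t-x-i))/(2π(t-x))`, which is the
  -- Poisson kernel at `x + i`, of integral one.
  have key : ∀ t : ℝ, t ≠ x → conj (kernel E x t / E t) * (f t / E t) =
      E x / (2 * Real.pi * I) * cauchyQuotient u x t
        - conj (E x) / (2 * Real.pi * I) * conj (cauchyQuotient v x t)
        + f x * poissonUpper (x + I) t := by
    intro t ht
    have htx : (t : ℂ) - x ≠ 0 := by
      rw [← ofReal_sub]; exact_mod_cast sub_ne_zero.2 ht
    have hE1 : E t ≠ 0 := hr t
    have hE2 : conj (E t) ≠ 0 := by simpa using hE1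
    have hE3 : E x ≠ 0 := hr x
    have hE4 : conj (E x) ≠ 0 := by simpa using hE3
    have k1 := congrArg conj (sub_mul_kernel_real (E := E) x t)
    have c1 := sub_mul_cauchyQuotient (u := u) x t
    have c2 := congrArg conj (sub_mul_cauchyQuotient (u := v) x t)
    rw [kernelNum_real_real] at k1
    simp only [map_mul, map_sub, conj_conj, conj_ofReal, map_div₀, map_neg, conj_I, map_ofNat] at k1 c2
    have p1 : (t : ℂ) - x + I ≠ 0 := sub_add_I_ne_zero x (by simp)
    have p2 : (t : ℂ) - x - I ≠ 0 := fun h => p1 (by simpa using congrArg conj h)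
    have p3 : (poissonUpper (x + I) t : ℂ) = 1 / Real.pi * (1 / ((t - x + I) * (t - x - I))) := by
      rw [poissonUpper_add_I]
      push_cast
      congr 2
      ring_nf
      rw [I_sq]; ring
    have a2 : conj (cauchyFactor x t) = -I / (t - x - I) := by
      rw [cauchyFactor]; simp [sub_eq_add_neg]
    have v1 : conj (v t) = f t / conj (E t) := by
      simp only [hv, map_div₀, star_ofReal, conj_conj]
    have v2 : conj (v x) = f x / conj (E x) := by
      simp only [hv, map_div₀, star_ofReal, conj_conj]
    rw [v1, v2, a2] at c2
    refine mul_left_cancel₀ htx ?_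
    rw [map_div₀]
    have lhs : ((t : ℂ) - x) * (conj (kernel E x t) / conj (E t) * (f t / E t)) =
        (((t : ℂ) - x) * conj (kernel E x t)) / conj (E t) * (f t / E t) := by ring
    have rhs : ((t : ℂ) - x) * (E x / (2 * Real.pi * I) * cauchyQuotient u x t
        - conj (E x) / (2 * Real.pi * I) * conj (cauchyQuotient v x t)
        + f x * poissonUpper (x + I) t) =
        E x / (2 * Real.pi * I) * (((t : ℂ) - x) * cauchyQuotient u x t)
        - conj (E x) / (2 * Real.pi * I) * (((t : ℂ) - x) * conj (cauchyQuotient v x t))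
        + f x * (((t : ℂ) - x) * poissonUpper (x + I) t) := by ring
    have hs2 : ((t : ℂ) - x) * (1 / ((t - x + I) * (t - x - I))) =
        (1 / (t - x + I) + 1 / (t - x - I)) / 2 := by
      field_simp
      ring
    rw [lhs, rhs, k1, c1, c2, p3, cauchyFactor]
    have : ((t : ℂ) - x) * (1 / Real.pi * (1 / ((t - x + I) * (t - x - I)))) =
      1 / Real.pi * ((1 / (t - x + I) + 1 / (t - x - I)) / 2) := by rw [← hs2]; ring
    rw [this]
    simp only [hu]
    generalize (t : ℂ) - x + I = p at *
    generalize (t : ℂ) - x - I = q at *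
    field_simp
    ring
  have hae : ∀ᵐ t : ℝ, conj (kernel E x t / E t) * (f t / E t) =
      E x / (2 * Real.pi * I) * cauchyQuotient u x t
        - conj (E x) / (2 * Real.pi * I) * conj (cauchyQuotient v x t)
        + f x * poissonUpper (x + I) t := by
    filter_upwards [compl_mem_ae_iff.2 (measure_singleton x)] with t ht using key t ht
  have isub : Integrable fun t : ℝ => E x / (2 * Real.pi * I) * cauchyQuotient u x t
        - conj (E x) / (2 * Real.pi * I) * conj (cauchyQuotient v x t) :=
    (iu.const_mul _).sub (iv'.const_mul _)
  rw [integral_congr_ae hae, integral_add isub (ip.const_mul _),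
    integral_sub (iu.const_mul _) (iv'.const_mul _), integral_const_mul, integral_const_mul,
    integral_const_mul, zu, zv', integral_complex_ofReal, integral_poissonUpper hw]
  simp

end Kernel

/-! ### Kernels as elements of the space, kernels of products, and phase derivatives. -/

theorem eq_of_eq_ofReal {f g : ℂ → ℂ} (hf : Differentiable ℂ f) (hg : Differentiable ℂ g)
    (h : ∀ t : ℝ, f t = g t) : f = g := by
  refine AnalyticOnNhd.eq_of_frequently_eq (z₀ := 0) (fun z _ => hf.analyticAt z)
    (fun z _ => hg.analyticAt z) ?_
  have ht : Tendsto (fun t : ℝ => (t : ℂ)) (𝓝[≠] 0) (𝓝[≠] 0) := by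
    refine tendsto_nhdsWithin_iff.2 ⟨?_, ?_⟩
    · have := (continuous_ofReal.tendsto 0)
      rw [ofReal_zero] at this
      exact this.mono_left nhdsWithin_le_nhds
    · filter_upwards [self_mem_nhdsWithin] with t ht
      simpa using ht
  exact ht.frequently (Eventually.of_forall fun t => h t).frequently

section Kernel

variable {E F : ℂ → ℂ}

theorem kernelNum_div (hE : HermiteBiehler E) (hr : NoRealZeros E) (x : ℝ) {z : ℂ}
    (hz : 0 ≤ z.im) :
    kernelNum E x z / E z = conj (E x) - E x * (star E z / E z) := by
  have := hE.ne_zero hr hz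
  rw [kernelNum, conj_ofReal]
  field_simp

theorem HermiteBiehler.norm_star_div_le (hE : HermiteBiehler E) {z : ℂ}
    (hz : 0 ≤ z.im) : ‖star E z / E z‖ ≤ 1 := by
  rcases hz.eq_or_lt with h | h
  · have : z = (z.re : ℂ) := by apply Complex.ext <;> simp [← h]
    rw [this, norm_div, norm_star, conj_ofReal]
    exact div_self_le_one _
  · exact (hE.norm_star_div_lt h).le

theorem norm_kernelNum_div_le (hE : HermiteBiehler E) (hr : NoRealZeros E) (x : ℝ) {z : ℂ}
    (hz : 0 ≤ z.im) : ‖kernelNum E x z / E z‖ ≤ 2 * ‖E x‖ := by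
  rw [kernelNum_div hE hr x hz]
  refine (norm_sub_le _ _).trans ?_
  rw [RCLike.norm_conj, norm_mul]
  have := mul_le_of_le_one_right (norm_nonneg (E x)) (hE.norm_star_div_le hz)
  linarith

theorem norm_sub_mul_kernel_div_le (hE : HermiteBiehler E) (hr : NoRealZeros E) (x : ℝ) {z : ℂ}
    (hz : 0 ≤ z.im) : ‖z - x‖ * ‖kernel E x z / E z‖ ≤ ‖E x‖ := by
  have h : (z - x) * (kernel E x z / E z) = -(kernelNum E x z / E z) / (2 * Real.pi * I) := by
    rw [← mul_div_assoc, sub_mul_kernel_real]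
    ring
  rw [← norm_mul, h, norm_div, norm_neg]
  have h1 : ‖(2 * Real.pi * I : ℂ)‖ = 2 * Real.pi := by
    simp [abs_of_pos Real.pi_pos]
  rw [h1, div_le_iff₀ (by positivity)]
  have := norm_kernelNum_div_le hE hr x hz
  have h3 := Real.pi_gt_three
  nlinarith [norm_nonneg (E x)]

/-- The denominator `(z - x)/(z - x + i)` is bounded and vanishes only at the boundary point `x`; it
absorbs the factor `z - x` by which the kernel has been divided. -/
theorem boundedType_kernel_div (hE : HermiteBiehler E) (hr : NoRealZeros E) (x : ℝ) :
    BoundedType fun z => kernel E x z / E z := by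
  have hd : DifferentiableOn ℂ (fun z => kernel E x z / E z) upper := fun z hz =>
    (hE.analyticAt_div hr (differentiable_kernel_real hE x)
      (le_of_lt hz)).differentiableAt.differentiableWithinAt
  have hh : DifferentiableOn ℂ (fun z : ℂ => (z - x) / (z - x + I)) upper := fun z hz => by
    have := sub_add_I_ne_zero x (le_of_lt hz)
    exact DifferentiableAt.differentiableWithinAt (by fun_prop (disch := assumption))
  refine ⟨hd, fun z => kernel E x z / E z * ((z - x) / (z - x + I)), fun z => (z - x) / (z - x + I),
    hd.mul hh, hh, ⟨‖E x‖, fun z hz => ?_⟩, ⟨1, fun z hz => ?_⟩, ⟨x + I, ?_, ?_⟩,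
    fun z _ => rfl⟩
  · have h1 := norm_sub_mul_kernel_div_le hE hr x (le_of_lt hz)
    have h2 := one_le_norm_sub_add_I x (le_of_lt hz)
    rw [norm_mul, norm_div (z - x), mul_div_assoc', mul_comm]
    exact (div_le_self (by positivity) h2).trans h1
  · rw [norm_div]
    refine div_le_one_of_le₀ ?_ (norm_nonneg _)
    have hz' : 0 < z.im := hz
    rw [← sq_le_sq₀ (norm_nonneg _) (norm_nonneg _), ← normSq_eq_norm_sq, ← normSq_eq_norm_sq,
      normSq_apply, normSq_apply]
    simp only [sub_re, ofReal_re, sub_im, ofReal_im, add_re, add_im, I_re, I_im]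
    nlinarith
  · simp [upper]
  · simp

theorem meanType_kernel_div_le (hE : HermiteBiehler E) (hr : NoRealZeros E) (x : ℝ) :
    meanType (fun z => kernel E x z / E z) ≤ 0 := by
  refine limsup_le_of_le (by isBoundedDefault) ?_
  filter_upwards [eventually_gt_atTop 0, eventually_ge_atTop ‖E x‖] with y hy hyE
  refine EReal.div_nonpos_of_nonpos_of_nonneg ?_ (by exact_mod_cast hy.le)
  rw [ENNReal.log_le_zero_iff, ← ofReal_norm, ENNReal.ofReal_le_one]
  have h1 := norm_sub_mul_kernel_div_le hE hr x (z := y * I) (by simpa using hy.le)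
  have h2 : y ≤ ‖(y : ℂ) * I - x‖ := by
    refine le_trans ?_ (abs_im_le_norm _)
    simp [le_abs_self]
  have h3 : y * ‖kernel E x (y * I) / E (y * I)‖ ≤ y * 1 := by
    rw [mul_one]
    exact (mul_le_mul_of_nonneg_right h2 (norm_nonneg _)).trans (h1.trans hyE)
  exact le_of_mul_le_mul_left h3 hy

theorem integrable_kernel_div (hE : HermiteBiehler E) (hr : NoRealZeros E) (x : ℝ) :
    Integrable fun t : ℝ => ‖kernel E x t / E t‖ ^ 2 := by
  have hc := continuous_div_real hr hE (differentiable_kernel_real hE x)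
  obtain ⟨B, hB⟩ := (isCompact_Icc (a := x - 1) (b := x + 1)).exists_bound_of_continuousOn
    hc.continuousOn
  refine ((integrable_inv_sq_add_one x).const_mul (2 * B ^ 2 + 2 * ‖E x‖ ^ 2)).mono'
    (hc.norm.pow 2).aestronglyMeasurable (Eventually.of_forall fun t => ?_)
  rw [Real.norm_of_nonneg (by positivity), mul_one_div, le_div_iff₀ (by positivity)]
  set k := ‖kernel E x t / E t‖ with hk
  have hk0 : 0 ≤ k := norm_nonneg _
  have h1 : |t - x| * k ≤ ‖E x‖ := by
    have := norm_sub_mul_kernel_div_le hE hr x (z := t) (by simp)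
    rwa [← ofReal_sub, norm_real, Real.norm_eq_abs] at this
  have h2 : (t - x) ^ 2 * k ^ 2 ≤ ‖E x‖ ^ 2 := by
    rw [← sq_abs (t - x), ← mul_pow]
    exact pow_le_pow_left₀ (by positivity) h1 2
  by_cases ht : t ∈ Icc (x - 1) (x + 1)
  · have h3 : k ^ 2 ≤ B ^ 2 := pow_le_pow_left₀ hk0 (hB t ht) 2
    nlinarith [sq_nonneg ‖E x‖]
  · have h3 : 1 ≤ (t - x) ^ 2 := by
      by_contra h
      rw [not_le, sq_lt_one_iff_abs_lt_one, abs_lt] at h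
      exact ht ⟨by linarith [h.1], by linarith [h.2]⟩
    nlinarith [sq_nonneg B, sq_nonneg k]

theorem memSpace_kernel (hE : HermiteBiehler E) (hr : NoRealZeros E) (x : ℝ) :
    MemSpace E (kernel E x) where
  entire := differentiable_kernel_real hE x
  integrable := integrable_kernel_div hE hr x
  boundedType := boundedType_kernel_div hE hr x
  boundedType_star := by rw [star_kernel_real hE]; exact boundedType_kernel_div hE hr x
  meanType_le := meanType_kernel_div_le hE hr x
  meanType_star_le := by rw [star_kernel_real hE]; exact meanType_kernel_div_le hE hr x

/-- The reproducing property applied to the kernel itself. -/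
theorem kernel_self_eq (hE : HermiteBiehler E) (hr : NoRealZeros E) (x : ℝ) :
    kernel E x x = (normSq E (kernel E x) : ℂ) := by
  rw [← ((memSpace_kernel hE hr x).memHardy hE hr).reproducing hE hr x, normSq,
    ← integral_complex_ofReal]
  congr 1 with t
  rw [← normSq_eq_conj_mul_self, normSq_eq_norm_sq]

theorem kernel_self_re (hE : HermiteBiehler E) (hr : NoRealZeros E) (x : ℝ) :
    (kernel E x x).re = normSq E (kernel E x) := by
  rw [kernel_self_eq hE hr, ofReal_re]

theorem eq_zero_of_normSq_eq_zero {f : ℂ → ℂ} (hE : HermiteBiehler E) (hr : NoRealZeros E)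
    (hf : Differentiable ℂ f) (hi : Integrable fun t : ℝ => ‖f t / E t‖ ^ 2)
    (h : normSq E f = 0) : f = 0 := by
  refine eq_of_eq_ofReal hf (differentiable_const 0) fun t => ?_
  rw [normSq, integral_eq_zero_iff_of_nonneg (fun t => by positivity) hi] at h
  have hc := continuous_div_real hr hE hf
  have := (hc.norm.pow 2).ae_eq_iff_eq volume (continuous_const (y := (0 : ℝ)))
  have h2 := congrFun (this.1 h) t
  have h3 : f t / E t = 0 := by simpa using h2
  exact (div_eq_zero_iff.1 h3).resolve_right (hr t)

/-- A kernel of norm zero would vanish identically, and its numerator at `i` would give `|E(i)| =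
|E(-i)|`, against the Hermite–Biehler inequality. -/
theorem kernel_self_re_pos (hE : HermiteBiehler E) (hr : NoRealZeros E) (x : ℝ) :
    0 < (kernel E x x).re := by
  rw [kernel_self_re hE hr]
  refine lt_of_le_of_ne (integral_nonneg fun t => by positivity) fun h => ?_
  have h0 := eq_zero_of_normSq_eq_zero hE hr (differentiable_kernel_real hE x)
    (integrable_kernel_div hE hr x) h.symm
  have h1 := sub_mul_kernel_real (E := E) x I
  have hpi : (Real.pi : ℂ) ≠ 0 := by exact_mod_cast Real.pi_ne_zero
  rw [h0, Pi.zero_apply, mul_zero, eq_comm, div_eq_zero_iff, neg_eq_zero] at h1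
  have h2 : kernelNum E x I = 0 := h1.resolve_right (by simp [Real.pi_ne_zero])
  rw [kernelNum, sub_eq_zero, conj_ofReal] at h2
  have h3 := congrArg (fun z : ℂ => ‖z‖) h2
  simp only [norm_mul, RCLike.norm_conj, norm_star] at h3
  have h4 := hE.lt I (by simp [upper])
  have h5 : 0 < ‖E x‖ := norm_pos_iff.2 (hr x)
  rw [mul_right_inj' h5.ne'] at h3
  linarith

theorem HermiteBiehler.mul (hE : HermiteBiehler E) (hF : HermiteBiehler F) :
    HermiteBiehler fun z => E z * F z where
  entire := hE.entire.mul hF.entire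
  lt z hz := by
    rw [norm_mul, norm_mul]
    exact mul_lt_mul'' (hE.lt z hz) (hF.lt z hz) (norm_nonneg _) (norm_nonneg _)

theorem NoRealZeros.mul (hE : NoRealZeros E) (hF : NoRealZeros F) :
    NoRealZeros fun z => E z * F z := fun x => mul_ne_zero (hE x) (hF x)

theorem star_mul (z : ℂ) : star (fun z => E z * F z) z = star E z * star F z := by
  simp [star]

/-- In the numerator, adding and subtracting `E(x)E^*(z)conj(F(x))F(z)` separates the numerators of
`E` and `F`. On the diagonal this becomes `K_{EF} = |F|²K_E + |E|²K_F`. -/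
theorem kernel_mul (hE : HermiteBiehler E) (hF : HermiteBiehler F) (x : ℝ) :
    kernel (fun z => E z * F z) x =
      fun z => conj (F x) * F z * kernel E x z + E x * star E z * kernel F x z := by
  have hd : Dense ({(x : ℂ)}ᶜ : Set ℂ) := dense_compl_singleton _
  refine (differentiable_kernel_real (hE.mul hF) x).continuous.ext_on hd ?_ fun z hz => ?_
  · have h1 := (differentiable_kernel_real hE x).continuous
    have h2 := (differentiable_kernel_real hF x).continuous
    have h3 := (differentiable_star hE.entire).continuous
    have h4 := hF.entire.continuous
    fun_prop
  · refine mul_left_cancel₀ (sub_ne_zero.2 hz) ?_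
    rw [sub_mul_kernel_real]
    have e : (z - x) * (conj (F x) * F z * kernel E x z + E x * star E z * kernel F x z) =
      conj (F x) * F z * ((z - x) * kernel E x z) + E x * star E z * ((z - x) * kernel F x z) := by
      ring
    rw [e, sub_mul_kernel_real, sub_mul_kernel_real]
    simp only [kernelNum, star_mul, conj_ofReal, map_mul]
    ring

theorem kernel_mul_self_re (hE : HermiteBiehler E) (hF : HermiteBiehler F) (x : ℝ) :
    (kernel (fun z => E z * F z) x x).re =
      ‖F x‖ ^ 2 * (kernel E x x).re + ‖E x‖ ^ 2 * (kernel F x x).re := by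
  rw [kernel_mul hE hF]
  simp only
  rw [star_ofReal, ← normSq_eq_conj_mul_self, mul_conj, normSq_eq_norm_sq,
    normSq_eq_norm_sq]
  rw [add_re, re_ofReal_mul, re_ofReal_mul]

/-- The kernel numerator at two real points is a multiple of a sine, so `sin(φ t - φ x) = (t - x) π
K(x,t)/(|E x||E t|)`. This differentiates the sine at `x`, and `arcsin` recovers `φ` near `x`
because continuity keeps the difference in `(-π/2, π/2)`. -/
theorem IsPhase.hasDerivAt {φ : ℝ → ℝ} (hE : HermiteBiehler E) (hr : NoRealZeros E)
    (hφ : IsPhase E φ) (x : ℝ) :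
    HasDerivAt φ (Real.pi * (kernel E x x).re / ‖E x‖ ^ 2) x := by
  have hx : 0 < ‖E x‖ := norm_pos_iff.2 (hr x)
  set c : ℝ → ℝ := fun t => Real.pi * (kernel E x t).re / (‖E x‖ * ‖E t‖) with hc
  have hkey : ∀ t : ℝ, Real.sin (φ t - φ x) = (t - x) * c t := by
    intro t
    have ht : 0 < ‖E t‖ := norm_pos_iff.2 (hr t)
    have h1 := sub_mul_kernel_real (E := E) x t
    have h2 : kernelNum E x t = -(2 * I) * (‖E x‖ * ‖E t‖) * Real.sin (φ t - φ x) := by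
      have e1 : conj (E x) = ‖E x‖ * exp (I * φ x) := by
        conv_lhs => rw [hφ.eq x]
        rw [map_mul, conj_ofReal, ← exp_conj]
        simp
      have e2 : conj (E t) = ‖E t‖ * exp (I * φ t) := by
        conv_lhs => rw [hφ.eq t]
        rw [map_mul, conj_ofReal, ← exp_conj]
        simp
      rw [kernelNum_real_real, e1, e2]
      have e3 := hφ.eq x
      have e4 := hφ.eq t
      generalize ((‖E x‖ : ℝ) : ℂ) = a at e3 ⊢
      generalize ((‖E t‖ : ℝ) : ℂ) = b at e4 ⊢
      rw [e3, e4, ofReal_sin, sin]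
      push_cast
      have a1 : -((φ t : ℂ) - φ x) * I = I * φ x + -(I * φ t) := by ring
      have a2 : ((φ t : ℂ) - φ x) * I = -(I * φ x) + I * φ t := by ring
      rw [a1, a2, exp_add, exp_add]
      ring_nf
      rw [I_sq]
      ring
    have hpi : (Real.pi : ℂ) ≠ 0 := by exact_mod_cast Real.pi_ne_zero
    rw [h2] at h1
    have h3 : ((t : ℂ) - x) * kernel E x t =
        ((‖E x‖ * ‖E t‖ * Real.sin (φ t - φ x) / Real.pi : ℝ) : ℂ) := by
      rw [h1]; push_cast; field_simp
    have h4 := congrArg Complex.re h3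
    rw [← ofReal_sub, re_ofReal_mul, ofReal_re] at h4
    rw [hc]
    have := Real.pi_pos
    field_simp
    field_simp at h4
    linarith
  have hcc : ContinuousAt c x := by
    have h1 := ((differentiable_kernel_real hE x).continuous).comp continuous_ofReal
    have h2 := hE.entire.continuous.comp continuous_ofReal
    refine ContinuousAt.div (continuous_const.mul (continuous_re.comp h1)).continuousAt ?_
      (by positivity)
    exact (continuous_const.mul h2.norm).continuousAt
  have hs : HasDerivAt (fun t => Real.sin (φ t - φ x)) (c x) x := by
    rw [hasDerivAt_iff_tendsto_slope]
    refine (hcc.tendsto.mono_left nhdsWithin_le_nhds).congr' ?_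
    filter_upwards [self_mem_nhdsWithin] with t ht
    have : t - x ≠ 0 := sub_ne_zero.2 ht
    rw [slope_def_field, hkey t, sub_self, Real.sin_zero, sub_zero]
    field_simp
  have ha : HasDerivAt Real.arcsin 1 (Real.sin (φ x - φ x)) := by
    have := Real.hasDerivAt_arcsin (x := 0) (by norm_num) (by norm_num)
    simpa using this
  have h := ((ha.comp x hs).add_const (φ x)).congr_of_eventuallyEq (f₁ := φ) (by
    have h1 : ∀ᶠ t in 𝓝 x, φ t - φ x ∈ Ioo (-(Real.pi / 2)) (Real.pi / 2) := by
      have : ContinuousAt (fun t => φ t - φ x) x := (hφ.continuous.sub continuous_const).continuousAt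
      refine this.eventually_mem (Ioo_mem_nhds ?_ ?_) <;> simp [Real.pi_pos]
    filter_upwards [h1] with t ht
    simp only [Function.comp_apply]
    rw [Real.arcsin_sin ht.1.le ht.2.le, sub_add_cancel])
  rw [one_mul] at h
  rw [pow_two]
  exact h

end Kernel

/-! ### Removing singular bounds at the real line, and a Liouville theorem. -/

theorem norm_sq_sub_sq_eq {z : ℂ} {ρ : ℝ} (hz : ‖z‖ = ρ) : ‖z ^ 2 - (ρ : ℂ) ^ 2‖ = 2 * ρ * |z.im| := by
  have hρ : 0 ≤ ρ := hz ▸ norm_nonneg z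
  have h2 : (ρ : ℂ) ^ 2 = z * conj z := by
    rw [mul_conj, normSq_eq_norm_sq, hz]; push_cast; ring
  have : z ^ 2 - (ρ : ℂ) ^ 2 = z * (2 * z.im * I) := by
    rw [h2, pow_two, ← mul_sub, sub_conj]; push_cast; ring
  rw [this, norm_mul, hz]
  simp
  ring

/-- A bound for an entire function on a circle, in terms of powers of the distance to the real
line, gives a bound in the disc of half the radius. -/
theorem norm_le_of_mul_im_pow_le {f : ℂ → ℂ} (hf : Differentiable ℂ f) {ρ D : ℝ} (hρ : 0 < ρ)
    (hD : 0 ≤ D) {m : ℕ} (hm : m ≠ 0)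
    (hb : ∀ z : ℂ, ‖z‖ = ρ → z.im ≠ 0 → ‖f z‖ * |z.im| ^ m ≤ D) {z : ℂ} (hz : ‖z‖ ≤ ρ / 2) :
    ‖f z‖ ≤ D * (8 / (3 * ρ)) ^ m := by
  -- On the circle `|z² - ρ²| = 2ρ|im z|`, so this factor trades the bound degenerating at the real
  -- line for a uniform one. In the half-radius disc it is at least `3ρ²/4`.
  set g : ℂ → ℂ := fun z => f z * (z ^ 2 - (ρ : ℂ) ^ 2) ^ m with hg
  have hgd : Differentiable ℂ g := hf.mul (by fun_prop)
  have hmax : ‖g z‖ ≤ D * (2 * ρ) ^ m := by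
    refine Complex.norm_le_of_forall_mem_frontier_norm_le (U := Metric.ball 0 ρ)
      Metric.isBounded_ball hgd.diffContOnCl (fun w hw => ?_)
      (subset_closure (by simpa using hz.trans_lt (half_lt_self hρ)))
    rw [frontier_ball _ hρ.ne'] at hw
    have hw' : ‖w‖ = ρ := by simpa using hw
    rw [hg, norm_mul, norm_pow, norm_sq_sub_sq_eq hw', mul_pow]
    by_cases h0 : w.im = 0
    · rw [h0, abs_zero, zero_pow hm, mul_zero, mul_zero]; positivity
    · calc _ = ‖f w‖ * |w.im| ^ m * (2 * ρ) ^ m := by ring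
        _ ≤ _ := mul_le_mul_of_nonneg_right (hb w hw' h0) (by positivity)
  have hlow : 3 * ρ ^ 2 / 4 ≤ ‖z ^ 2 - (ρ : ℂ) ^ 2‖ := by
    have h1 : ‖(ρ : ℂ) ^ 2‖ - ‖z ^ 2‖ ≤ ‖z ^ 2 - (ρ : ℂ) ^ 2‖ := by
      rw [norm_sub_rev]; exact norm_sub_norm_le _ _
    rw [norm_pow, norm_pow, norm_real, Real.norm_of_nonneg hρ.le] at h1
    nlinarith [norm_nonneg z]
  rw [hg, norm_mul, norm_pow] at hmax
  have h3 : 0 < (3 * ρ ^ 2 / 4) ^ m := by positivity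
  have h4 : ‖f z‖ * (3 * ρ ^ 2 / 4) ^ m ≤ D * (2 * ρ) ^ m :=
    (mul_le_mul_of_nonneg_left (pow_le_pow_left₀ (by positivity) hlow m) (norm_nonneg _)).trans hmax
  rw [← le_div_iff₀ h3] at h4
  refine h4.trans (le_of_eq ?_)
  rw [mul_div_assoc, ← div_pow]
  congr 2
  field_simp
  norm_num

/-- A Liouville theorem for functions of growth `√‖z‖`. -/
theorem eq_const_of_norm_le_sqrt {f : ℂ → ℂ} (hf : Differentiable ℂ f) {A : ℝ}
    (hb : ∀ z : ℂ, ‖f z‖ ≤ A * (1 + √‖z‖)) (z : ℂ) : f z = f 0 := by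
  have hA : 0 ≤ A := by
    have := (norm_nonneg _).trans (hb 0)
    simpa using this
  have hder : ∀ w : ℂ, deriv f w = 0 := by
    intro w
    have hle : ∀ R : ℝ, 0 < R → ‖deriv f w‖ ≤ A * (1 + √(‖w‖ + R)) / R := by
      intro R hR
      refine Complex.norm_deriv_le_of_forall_mem_sphere_norm_le hR hf.diffContOnCl fun ζ hζ => ?_
      refine (hb ζ).trans (mul_le_mul_of_nonneg_left ?_ hA)
      have : ‖ζ‖ ≤ ‖w‖ + R := by
        have h1 : ‖ζ - w‖ = R := by simpa [dist_eq] using hζ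
        have := norm_add_le w (ζ - w)
        rwa [add_sub_cancel, h1] at this
      linarith [Real.sqrt_le_sqrt this]
    have hlim : Tendsto (fun R : ℝ => A * (1 + √(‖w‖ + R)) / R) atTop (𝓝 0) := by
      have h1 : Tendsto (fun R : ℝ => A * (1 / R + √(‖w‖ / R + 1) * (1 / √R))) atTop
          (𝓝 (A * (0 + √(0 + 1) * 0))) := by
        refine Tendsto.const_mul _ (Tendsto.add ?_ (Tendsto.mul ?_ ?_))
        · exact tendsto_const_nhds.div_atTop tendsto_id
        · exact (Real.continuous_sqrt.tendsto _).comp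
            ((tendsto_const_nhds.div_atTop tendsto_id).add_const 1)
        · exact tendsto_const_nhds.div_atTop Real.tendsto_sqrt_atTop
      simp only [mul_zero, add_zero] at h1
      refine h1.congr' ?_
      filter_upwards [eventually_gt_atTop 0] with R hR
      have hs : 0 < √R := Real.sqrt_pos.2 hR
      have e1 : √(‖w‖ + R) = √(‖w‖ / R + 1) * √R := by
        rw [← Real.sqrt_mul (by positivity)]
        congr 1
        field_simp
      have e2 : 1 / √R = √R / R := by
        rw [div_eq_div_iff hs.ne' hR.ne', one_mul, Real.mul_self_sqrt hR.le]
      rw [e1, e2]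
      field_simp
    have : ‖deriv f w‖ ≤ 0 := ge_of_tendsto hlim (by
      filter_upwards [eventually_gt_atTop 0] with R hR using hle R hR)
    exact norm_le_zero_iff.1 this
  exact is_const_of_deriv_eq_zero hf hder z 0

/-! ### The space as a closed subspace of `L²`. -/

section Space

variable {E f g : ℂ → ℂ}

theorem star_add (z : ℂ) : star (fun z => f z + g z) z = star f z + star g z := by simp [star]

theorem star_const_mul (c z : ℂ) : star (fun z => c * f z) z = conj c * star f z := by simp [star]

theorem MemHardy.add (hf : MemHardy E f) (hg : MemHardy E g) :
    MemHardy E fun z => f z + g z where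
  entire := hf.entire.add hg.entire
  memLp := by simp only [add_div]; exact hf.memLp.add hg.memLp
  bound := by
    obtain ⟨C, hC⟩ := hf.bound
    obtain ⟨D, hD⟩ := hg.bound
    refine ⟨C + D, fun z hz => ?_⟩
    rw [add_div, add_div]
    exact (norm_add_le _ _).trans (add_le_add (hC z hz) (hD z hz))
  bound_star := by
    obtain ⟨C, hC⟩ := hf.bound_star
    obtain ⟨D, hD⟩ := hg.bound_star
    refine ⟨C + D, fun z hz => ?_⟩
    rw [star_add, add_div, add_div]
    exact (norm_add_le _ _).trans (add_le_add (hC z hz) (hD z hz))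

theorem MemHardy.const_mul (hf : MemHardy E f) (c : ℂ) : MemHardy E fun z => c * f z where
  entire := hf.entire.const_mul c
  memLp := by simp only [mul_div_assoc]; exact hf.memLp.const_mul c
  bound := by
    obtain ⟨C, hC⟩ := hf.bound
    refine ⟨‖c‖ * C, fun z hz => ?_⟩
    rw [mul_div_assoc, norm_mul, mul_div_assoc]
    exact mul_le_mul_of_nonneg_left (hC z hz) (norm_nonneg _)
  bound_star := by
    obtain ⟨C, hC⟩ := hf.bound_star
    refine ⟨‖c‖ * C, fun z hz => ?_⟩
    rw [star_const_mul, mul_div_assoc, norm_mul, mul_div_assoc, RCLike.norm_conj]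
    exact mul_le_mul_of_nonneg_left (hC z hz) (norm_nonneg _)

theorem MemHardy.sub (hf : MemHardy E f) (hg : MemHardy E g) :
    MemHardy E fun z => f z - g z := by
  have := hf.add (hg.const_mul (-1))
  simpa only [neg_one_mul, ← sub_eq_add_neg] using this

theorem memHardy_zero : MemHardy E fun _ => 0 where
  entire := differentiable_const 0
  memLp := by simp
  bound := ⟨0, by simp⟩
  bound_star := ⟨0, by simp [star]⟩

/-- The class of `f / E` in `L²(ℝ)`. -/
noncomputable def MemHardy.toL2 (hf : MemHardy E f) : Lp ℂ 2 (volume : Measure ℝ) :=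
  hf.memLp.toLp _

theorem MemHardy.coeFn_toL2 (hf : MemHardy E f) :
    hf.toL2 =ᵐ[volume] fun t : ℝ => f t / E t := hf.memLp.coeFn_toLp

theorem MemHardy.inner_toL2 (hf : MemHardy E f) (hg : MemHardy E g) :
    inner ℂ hf.toL2 hg.toL2 = ∫ t : ℝ, conj (f t / E t) * (g t / E t) := by
  rw [L2.inner_def]
  refine integral_congr_ae ?_
  filter_upwards [hf.coeFn_toL2, hg.coeFn_toL2] with t h1 h2
  rw [h1, h2, RCLike.inner_apply, mul_comm]

theorem normSq_nonneg' : 0 ≤ normSq E f := integral_nonneg fun t => by positivity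

theorem sq_norm : norm E f ^ 2 = normSq E f := Real.sq_sqrt normSq_nonneg'

theorem MemHardy.sq_norm_toL2 (hf : MemHardy E f) : ‖hf.toL2‖ ^ 2 = normSq E f := by
  have h := hf.inner_toL2 hf
  rw [inner_self_eq_norm_sq_to_K] at h
  have e : ∫ t : ℝ, conj (f t / E t) * (f t / E t) = ((normSq E f : ℝ) : ℂ) := by
    rw [normSq, ← integral_complex_ofReal]
    congr 1 with t
    rw [← normSq_eq_conj_mul_self, normSq_eq_norm_sq]
  rw [e] at h
  refine Complex.ofReal_injective ?_
  rw [← h]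
  push_cast
  rfl

theorem MemHardy.norm_toL2 (hf : MemHardy E f) : ‖hf.toL2‖ = norm E f := by
  rw [norm, ← hf.sq_norm_toL2, Real.sqrt_sq (norm_nonneg _)]

theorem norm_nonneg' : 0 ≤ norm E f := Real.sqrt_nonneg _

/-- Elements of the space are bounded on compact sets by their norm. -/
theorem exists_norm_le_mul_norm (hE : HermiteBiehler E) (hr : NoRealZeros E) {R : ℝ} (hR : 0 < R) :
    ∃ C : ℝ, 0 ≤ C ∧ ∀ f, MemHardy E f → ∀ z : ℂ, ‖z‖ ≤ R → ‖f z‖ ≤ C * norm E f := by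
  obtain ⟨B, hB⟩ := (isCompact_closedBall (0 : ℂ) (2 * R)).exists_bound_of_continuousOn
    hE.entire.continuous.continuousOn
  have hB0 : 0 ≤ B := (norm_nonneg _).trans (hB 0 (by simp [hR.le]))
  refine ⟨B * √(2 * R) * (8 / (3 * (2 * R))) ^ 1, by positivity, fun f hf z hz => ?_⟩
  have hN : 0 ≤ norm E f := norm_nonneg'
  -- The Hardy bound blows up only like `1/√(im z)`, so one factor `im z` tames it. The lower
  -- half-plane is reached by taking `g = f^*`.
  have hpos : ∀ {g : ℂ → ℂ}, (∀ z : ℂ, 0 < z.im → ‖g z / E z‖ ≤ norm E f / √(Real.pi * z.im)) →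
      ∀ z : ℂ, ‖z‖ = 2 * R → 0 < z.im → ‖g z‖ * z.im ≤ B * norm E f * √(2 * R) := by
    intro g hg z hz hy
    have h1 := hg z hy
    have hE0 : 0 < ‖E z‖ := norm_pos_iff.2 (hE.ne_zero hr hy.le)
    rw [norm_div, div_le_iff₀ hE0] at h1
    have hEB := hB z (by simpa using hz.le)
    have hs : 0 < √z.im := Real.sqrt_pos.2 hy
    have h2 : norm E f / √(Real.pi * z.im) ≤ norm E f / √z.im := by
      refine div_le_div_of_nonneg_left hN hs (Real.sqrt_le_sqrt ?_)
      nlinarith [Real.pi_gt_three]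
    have h3 : √z.im ≤ √(2 * R) :=
      Real.sqrt_le_sqrt ((le_abs_self _).trans ((abs_im_le_norm z).trans hz.le))
    calc ‖g z‖ * z.im ≤ norm E f / √z.im * B * z.im := by
          refine mul_le_mul_of_nonneg_right (h1.trans ?_) hy.le
          exact mul_le_mul h2 hEB (norm_nonneg _) (by positivity)
      _ = B * norm E f * √z.im := by
          nth_rewrite 2 [← Real.mul_self_sqrt hy.le]
          field_simp
      _ ≤ _ := mul_le_mul_of_nonneg_left h3 (by positivity)
  have key := norm_le_of_mul_im_pow_le hf.entire (ρ := 2 * R) (D := B * norm E f * √(2 * R))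
    (m := 1) (by positivity) (by positivity) one_ne_zero (fun w hw h0 => by
      rw [pow_one]
      rcases lt_or_gt_of_ne h0 with h | h
      · have h1 := hpos (g := star f) (fun z hz => hf.norm_star_le hE hr hz) (conj w)
          (by rw [RCLike.norm_conj, hw]) (by simpa using h)
        rw [norm_star, conj_conj, conj_im] at h1
        rwa [abs_of_neg h]
      · rw [abs_of_pos h]
        exact hpos (fun z hz => hf.norm_le hE hr hz) w hw h) (z := z) (by simpa using hz)
  refine key.trans (le_of_eq (by ring))

theorem MemHardy.toL2_eq_iff {E' g : ℂ → ℂ} (hf : MemHardy E f) (hg : MemHardy E' g) :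
    hf.toL2 = hg.toL2 ↔ ∀ᵐ t : ℝ, f t / E t = g t / E' t :=
  MemLp.toLp_eq_toLp_iff _ _

theorem MemHardy.toL2_add (hf : MemHardy E f) (hg : MemHardy E g) :
    (hf.add hg).toL2 = hf.toL2 + hg.toL2 := by
  refine Lp.ext ?_
  filter_upwards [hf.coeFn_toL2, hg.coeFn_toL2, (hf.add hg).coeFn_toL2,
    Lp.coeFn_add hf.toL2 hg.toL2] with t h1 h2 h3 h4
  rw [h3, h4, Pi.add_apply, h1, h2, add_div]

theorem MemHardy.toL2_const_mul (hf : MemHardy E f) (c : ℂ) :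
    (hf.const_mul c).toL2 = c • hf.toL2 := by
  refine Lp.ext ?_
  filter_upwards [hf.coeFn_toL2, (hf.const_mul c).coeFn_toL2,
    Lp.coeFn_smul c hf.toL2] with t h1 h2 h3
  rw [h2, h3, Pi.smul_apply, h1, smul_eq_mul, mul_div_assoc]

theorem MemHardy.toL2_sub (hf : MemHardy E f) (hg : MemHardy E g) :
    (hf.sub hg).toL2 = hf.toL2 - hg.toL2 := by
  refine Lp.ext ?_
  filter_upwards [hf.coeFn_toL2, hg.coeFn_toL2, (hf.sub hg).coeFn_toL2,
    Lp.coeFn_sub hf.toL2 hg.toL2] with t h1 h2 h3 h4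
  rw [h3, h4, Pi.sub_apply, h1, h2, sub_div]

theorem toL2_zero : (memHardy_zero (E := E)).toL2 = 0 := by
  refine Lp.ext ?_
  filter_upwards [(memHardy_zero (E := E)).coeFn_toL2,
    Lp.coeFn_zero ℂ 2 (volume : Measure ℝ)] with t h1 h2
  rw [h1, h2, zero_div, Pi.zero_apply]

/-- The subspace of `L²(ℝ)` of all boundary functions `f / E`. -/
def hardySubmodule (E : ℂ → ℂ) : Submodule ℂ (Lp ℂ 2 (volume : Measure ℝ)) where
  carrier := {g | ∃ f, ∃ hf : MemHardy E f, g = hf.toL2}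
  add_mem' := by
    rintro _ _ ⟨f, hf, rfl⟩ ⟨g, hg, rfl⟩
    exact ⟨_, hf.add hg, (hf.toL2_add hg).symm⟩
  zero_mem' := ⟨_, memHardy_zero, toL2_zero.symm⟩
  smul_mem' := by
    rintro c _ ⟨f, hf, rfl⟩
    exact ⟨_, hf.const_mul c, (hf.toL2_const_mul c).symm⟩

theorem MemHardy.toL2_mem (hf : MemHardy E f) : hf.toL2 ∈ hardySubmodule E := ⟨f, hf, rfl⟩

/-- Completeness of the space. -/
theorem isClosed_hardySubmodule (hE : HermiteBiehler E) (hr : NoRealZeros E) :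
    IsClosed (hardySubmodule E : Set (Lp ℂ 2 (volume : Measure ℝ))) := by
  refine isClosed_of_closure_subset fun g hg => ?_
  obtain ⟨G, hGmem, hGlim⟩ := mem_closure_iff_seq_limit.1 hg
  choose F hF hGF using hGmem
  have hcauchy : CauchySeq G := hGlim.cauchySeq
  have hsub : ∀ n m, norm E (fun z => F n z - F m z) = dist (G n) (G m) := fun n m => by
    rw [← ((hF n).sub (hF m)).norm_toL2, MemHardy.toL2_sub (hF n) (hF m), ← hGF, ← hGF, dist_eq_norm]
  -- Point evaluations are bounded uniformly on compact sets, so norm convergence forces locally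
  -- uniform convergence to an entire limit.
  have hunif : ∀ R : ℝ, 0 < R → UniformCauchySeqOn F atTop (Metric.ball 0 R) := by
    intro R hR
    obtain ⟨C, hC0, hC⟩ := exists_norm_le_mul_norm hE hr hR
    rw [Metric.uniformCauchySeqOn_iff]
    intro ε hε
    obtain ⟨N, hN⟩ := Metric.cauchySeq_iff.1 hcauchy (ε / (C + 1)) (by positivity)
    refine ⟨N, fun m hm n hn z hz => ?_⟩
    rw [dist_eq_norm]
    have h1 := hC _ ((hF m).sub (hF n)) z (by simpa using (mem_ball_zero_iff.1 hz).le)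
    rw [hsub] at h1
    have h2 := hN m hm n hn
    calc _ ≤ C * dist (G m) (G n) := h1
      _ ≤ (C + 1) * dist (G m) (G n) := by nlinarith [dist_nonneg (x := G m) (y := G n)]
      _ < (C + 1) * (ε / (C + 1)) := mul_lt_mul_of_pos_left h2 (by positivity)
      _ = ε := by field_simp
  have hpt : ∀ z : ℂ, ∃ a, Tendsto (fun n => F n z) atTop (𝓝 a) := fun z =>
    cauchySeq_tendsto_of_complete
      ((hunif (‖z‖ + 1) (by positivity)).cauchySeq (x := z) (by simp))
  choose f hf using hpt
  have hfd : Differentiable ℂ f := by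
    intro z
    have h1 := (hunif (‖z‖ + 1) (by positivity)).tendstoUniformlyOn_of_tendsto
      (f := f) (fun w _ => hf w)
    have h2 := h1.tendstoLocallyUniformlyOn.differentiableOn
      (Eventually.of_forall fun n => (hF n).entire.differentiableOn) Metric.isOpen_ball
    exact h2.differentiableAt (Metric.isOpen_ball.mem_nhds (by simp))
  have hnorm : Tendsto (fun n => norm E (F n)) atTop (𝓝 ‖g‖) := by
    have : (fun n => norm E (F n)) = fun n => ‖G n‖ := by
      ext n; rw [hGF, MemHardy.norm_toL2]
    rw [this]
    exact hGlim.norm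
  have hb : ∀ z : ℂ, 0 < z.im → ‖f z / E z‖ ≤ ‖g‖ / √(Real.pi * z.im) := fun z hz =>
    le_of_tendsto_of_tendsto ((hf z).div_const _).norm (hnorm.div_const _)
      (Eventually.of_forall fun n => (hF n).norm_le hE hr hz)
  have hbs : ∀ z : ℂ, 0 < z.im → ‖star f z / E z‖ ≤ ‖g‖ / √(Real.pi * z.im) := fun z hz => by
    have h1 : Tendsto (fun n => star (F n) z) atTop (𝓝 (star f z)) :=
      (continuous_conj.tendsto _).comp (hf (conj z))
    exact le_of_tendsto_of_tendsto (h1.div_const _).norm (hnorm.div_const _)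
      (Eventually.of_forall fun n => (hF n).norm_star_le hE hr hz)
  -- A subsequence of the `L²` sequence converges almost everywhere, which identifies the `L²` limit
  -- with the boundary function of the entire limit.
  have hae : g =ᵐ[volume] fun t : ℝ => f t / E t := by
    obtain ⟨ns, hns, hlim⟩ := (tendstoInMeasure_of_tendsto_Lp hGlim).exists_seq_tendsto_ae
    have hall : ∀ᵐ t : ℝ, ∀ n, G n t = F n t / E t := by
      rw [ae_all_iff]
      intro n
      rw [hGF]
      exact (hF n).coeFn_toL2
    filter_upwards [hlim, hall] with t h1 h2
    refine tendsto_nhds_unique h1 ?_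
    simp only [h2]
    exact ((hf t).div_const _).comp hns.tendsto_atTop
  have hmem : MemHardy E f := by
    refine ⟨hfd, (memLp_congr_ae hae).1 (Lp.memLp g), ⟨‖g‖ / √Real.pi, fun z hz => ?_⟩,
      ⟨‖g‖ / √Real.pi, fun z hz => ?_⟩⟩
    · rw [div_div, ← Real.sqrt_mul Real.pi_pos.le]; exact hb z hz
    · rw [div_div, ← Real.sqrt_mul Real.pi_pos.le]; exact hbs z hz
  refine ⟨f, hmem, Lp.ext ?_⟩
  exact hae.trans hmem.coeFn_toL2.symm

end Space

/-! ### Companion functions. -/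

/-- An entire function which vanishes at the zeros of another one, all of them simple, is
divisible by it. -/
theorem exists_entire_mul_eq {G S : ℂ → ℂ} (hG : Differentiable ℂ G) (hS : Differentiable ℂ S)
    (hsimple : ∀ z, S z = 0 → deriv S z ≠ 0) (hGS : ∀ z, S z = 0 → G z = 0) :
    ∃ h : ℂ → ℂ, Differentiable ℂ h ∧ ∀ z, G z = h z * S z := by
  classical
  refine ⟨fun z => if S z = 0 then deriv G z / deriv S z else G z / S z, fun x => ?_, fun z => ?_⟩
  · by_cases hx : S x = 0
    · have hGd := differentiableAt_dslope (hG.analyticAt x) (hG.analyticAt x)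
      have hSd := differentiableAt_dslope (hS.analyticAt x) (hS.analyticAt x)
      have h0 : dslope S x x ≠ 0 := by rw [dslope_same]; exact hsimple x hx
      refine (hGd.div hSd h0).congr_of_eventuallyEq ?_
      filter_upwards [hSd.continuousAt.eventually_ne h0] with z hz
      rcases eq_or_ne z x with rfl | hzx
      · simp [hx]
      · have e1 := sub_smul_dslope S x z
        have e2 := sub_smul_dslope G x z
        rw [hx, sub_zero, smul_eq_mul] at e1
        rw [hGS x hx, sub_zero, smul_eq_mul] at e2
        have hz' := sub_ne_zero.2 hzx
        have hSz : S z ≠ 0 := by rw [← e1]; exact mul_ne_zero hz' hz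
        rw [if_neg hSz, ← e1, ← e2, mul_div_mul_left _ _ hz']
        rfl
    · refine ((hG x).div (hS x) hx).congr_of_eventuallyEq ?_
      filter_upwards [(hS x).continuousAt.eventually_ne hx] with z hz
      rw [if_neg hz]
      rfl
  · by_cases hz : S z = 0
    · simp [hz, hGS z hz]
    · simp [hz]

/-- The combination of `E` and its conjugate whose zeros are the points of phase `α`
modulo `π`. -/
noncomputable def companion (E : ℂ → ℂ) (α : ℝ) (z : ℂ) : ℂ :=
  exp (α * I) * E z - exp (-(α * I)) * star E z

section Companion

variable {E F : ℂ → ℂ}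

theorem conj_exp_mul_I (α : ℝ) : conj (exp (α * I)) = exp (-(α * I)) := by
  rw [← exp_conj]; simp

theorem norm_exp_neg_mul_I (α : ℝ) : ‖exp (-(α * I))‖ = 1 := by
  rw [← conj_exp_mul_I, RCLike.norm_conj, norm_exp_ofReal_mul_I]

theorem differentiable_companion (hE : HermiteBiehler E) (α : ℝ) :
    Differentiable ℂ (companion E α) :=
  (hE.entire.const_mul _).sub ((differentiable_star hE.entire).const_mul _)

theorem star_companion (α : ℝ) (z : ℂ) : star (companion E α) z = -companion E α z := by
  simp only [star, companion, map_sub, map_mul, conj_conj, conj_exp_mul_I]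
  rw [← conj_exp_mul_I, conj_conj]
  ring

theorem companion_ofReal {φ : ℝ → ℝ} (hφ : IsPhase E φ) (α x : ℝ) :
    companion E α x = 2 * I * ‖E x‖ * Real.sin (α - φ x) := by
  rw [companion, star_ofReal, hφ.eq x]
  simp only [map_mul, conj_ofReal, norm_mul, norm_real, norm_norm]
  have e1 : ‖exp (-(I * φ x))‖ = 1 := by rw [mul_comm]; exact norm_exp_neg_mul_I _
  have e2 : conj (exp (-(I * φ x))) = exp (I * φ x) := by
    rw [← exp_conj]; simp
  rw [e1, e2, ofReal_sin, Complex.sin]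
  have h1 : exp (α * I) * exp (-(I * φ x)) = exp (((α - φ x : ℝ) : ℂ) * I) := by
    rw [← exp_add]; congr 1; push_cast; ring
  have h2 : exp (-(α * I)) * exp (I * φ x) = exp (-((α - φ x : ℝ) : ℂ) * I) := by
    rw [← exp_add]; congr 1; push_cast; ring
  push_cast at *
  linear_combination (‖E x‖ : ℂ) * h1 - ‖E x‖ * h2 -
    (‖E x‖ : ℂ) * (exp (-((α : ℂ) - φ x) * I) - exp ((α - φ x) * I)) * I_sq

theorem companion_ofReal_eq_zero_iff {φ : ℝ → ℝ} (hr : NoRealZeros E) (hφ : IsPhase E φ)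
    (α x : ℝ) : companion E α x = 0 ↔ ∃ n : ℤ, φ x = n * Real.pi + α := by
  have h1 : (‖E x‖ : ℂ) ≠ 0 := by exact_mod_cast (norm_pos_iff.2 (hr x)).ne'
  rw [companion_ofReal hφ]
  simp only [mul_eq_zero, OfNat.ofNat_ne_zero, I_ne_zero, h1, or_self, false_or, ofReal_eq_zero]
  rw [Real.sin_eq_zero_iff]
  constructor
  · rintro ⟨n, hn⟩
    exact ⟨-n, by push_cast; linarith⟩
  · rintro ⟨n, hn⟩
    exact ⟨-n, by push_cast; linarith⟩

theorem companion_ne_zero (hE : HermiteBiehler E) (α : ℝ) {z : ℂ} (hz : z.im ≠ 0) :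
    companion E α z ≠ 0 := by
  intro h
  have h1 := congrArg (‖·‖) (sub_eq_zero.1 h)
  simp only [norm_mul, norm_exp_ofReal_mul_I, norm_exp_neg_mul_I, one_mul, norm_star] at h1
  rcases lt_or_gt_of_ne hz with h2 | h2
  · have := hE.lt (conj z) (by simpa [upper] using h2)
    rw [conj_conj] at this
    exact this.ne h1
  · exact (hE.lt z h2).ne' h1

/-- At a zero `x` one has `conj (E x) = e^{2iα} E x`, which makes the companion proportional to the
kernel numerator at `x`. Orthogonality of the kernels and simplicity of the zeros both come from
this. -/
theorem companion_eq_of_eq_zero (hr : NoRealZeros E) {α x : ℝ}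
    (h : companion E α x = 0) :
    ∃ c : ℂ, c ≠ 0 ∧ ∀ z, companion E α z = c * ((z - x) * kernel E x z) := by
  have hx := hr x
  have he := exp_ne_zero (α * I)
  have hp : (2 * Real.pi * I : ℂ) ≠ 0 := by simp [Real.pi_ne_zero, I_ne_zero]
  refine ⟨-(2 * Real.pi * I) / (exp (α * I) * E x), by simp [hx, he, Real.pi_ne_zero], fun z => ?_⟩
  rw [sub_mul_kernel_real, kernelNum, conj_ofReal]
  rw [companion, star_ofReal, sub_eq_zero, exp_neg] at h
  rw [companion, exp_neg]
  have h' : conj (E x) = exp (α * I) * exp (α * I) * E x := by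
    rw [mul_assoc, h, mul_inv_cancel_left₀ he]
  rw [h']
  field_simp

theorem eq_ofReal_of_companion_eq_zero (hE : HermiteBiehler E) {α : ℝ} {z : ℂ}
    (h : companion E α z = 0) : z = (z.re : ℂ) := by
  have : z.im = 0 := by
    by_contra h0
    exact companion_ne_zero hE α h0 h
  apply Complex.ext <;> simp [this]

theorem deriv_companion_ne_zero (hE : HermiteBiehler E) (hr : NoRealZeros E) {α : ℝ} {z : ℂ}
    (h : companion E α z = 0) : deriv (companion E α) z ≠ 0 := by
  have hz := eq_ofReal_of_companion_eq_zero hE h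
  set x := z.re
  rw [hz] at h ⊢
  obtain ⟨c, hc, hcz⟩ := companion_eq_of_eq_zero hr h
  have hk := (differentiable_kernel_real hE x (x : ℂ)).hasDerivAt
  have hd : HasDerivAt (companion E α) (c * kernel E x x) (x : ℂ) := by
    have := ((((hasDerivAt_id (x : ℂ)).sub_const (x : ℂ)).mul hk).const_mul c)
    have e : companion E α = fun z => c * ((z - x) * kernel E x z) := funext hcz
    rw [e]
    simpa using this
  rw [hd.deriv]
  refine mul_ne_zero hc fun h0 => ?_
  have := kernel_self_re_pos hE hr x
  rw [h0] at this
  simp at this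

/-- A lower bound for the companion function in the upper half-plane. -/
theorem exists_norm_le_mul_norm_companion (hE : HermiteBiehler E) (α : ℝ) :
    ∃ C : ℝ, 0 ≤ C ∧ ∀ z : ℂ, 0 < z.im →
      ‖E z‖ ≤ C * ((1 + ‖z‖ ^ 2) / z.im) * ‖companion E α z‖ := by
  -- With `a = e^{iα}E`, `b = e^{-iα}E^*` and `|b| ≤ |a|`, the quotient `W = (a + b)/(a - b)` has
  -- nonnegative real part, hence limited growth. Also `2a = (1 + W)(a - b)`, which bounds `E` by
  -- the companion.
  set W : ℂ → ℂ := fun z =>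
    (exp (α * I) * E z + exp (-(α * I)) * star E z) / companion E α z with hW
  have hd : DifferentiableOn ℂ W upper := fun z hz =>
    ((((hE.entire.const_mul _).add ((differentiable_star hE.entire).const_mul _)) z).div
      (differentiable_companion hE α z)
      (companion_ne_zero hE α (ne_of_gt hz))).differentiableWithinAt
  have hre : ∀ z ∈ upper, 0 ≤ (W z).re := by
    intro z hz
    have h1 : ‖exp (-(α * I)) * star E z‖ ≤ ‖exp (α * I) * E z‖ := by
      simp only [norm_mul, norm_exp_ofReal_mul_I, norm_exp_neg_mul_I, one_mul, norm_star]
      exact (hE.lt z hz).le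
    simp only [hW, companion]
    generalize exp (-(α * I)) * star E z = b at *
    generalize exp (α * I) * E z = a at *
    have h2 : Complex.normSq b ≤ Complex.normSq a := by
      rw [normSq_eq_norm_sq, normSq_eq_norm_sq]
      exact pow_le_pow_left₀ (norm_nonneg _) h1 2
    rw [div_re, ← add_div]
    refine div_nonneg ?_ (normSq_nonneg _)
    rw [normSq_apply, normSq_apply] at h2
    simp only [add_re, sub_re, add_im, sub_im]
    nlinarith
  obtain ⟨C, hC0, hC⟩ := exists_norm_le_of_re_nonneg hd hre
  refine ⟨1 + C, by positivity, fun z hz => ?_⟩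
  have hS := companion_ne_zero hE α hz.ne'
  have h1 : 2 * (exp (α * I) * E z) = (1 + W z) * companion E α z := by
    simp only [hW]
    rw [add_mul, div_mul_cancel₀ _ hS, companion]
    ring
  have h2 := congrArg (‖·‖) h1
  simp only [norm_mul, norm_exp_ofReal_mul_I, one_mul, norm_ofNat] at h2
  have h3 : ‖1 + W z‖ ≤ 1 + C * ((1 + ‖z‖ ^ 2) / z.im) := by
    refine (norm_add_le _ _).trans ?_
    rw [norm_one]
    linarith [hC z hz]
  have h4 : 1 ≤ (1 + ‖z‖ ^ 2) / z.im := by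
    rw [le_div_iff₀ hz]
    have := (le_abs_self _).trans (abs_im_le_norm z)
    nlinarith [sq_nonneg (‖z‖ - 1)]
  have h5 := mul_le_mul_of_nonneg_right (h3.trans (add_le_add_left h4 _)) (norm_nonneg (companion E α z))
  nlinarith [norm_nonneg (E z)]

/-- The factor `f/E` costs `(im z)^{-1/2}` and `E/companion` costs `(1 + |z|²)/im z`. After
`norm_le_of_mul_im_pow_le` with exponent two, order `|z|^{5/2}` drops to `√|z|`, which the Liouville
theorem tolerates. -/
theorem exists_norm_mul_sq_le (hE : HermiteBiehler E) (hr : NoRealZeros E) (α : ℝ) {f h : ℂ → ℂ}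
    (hf : MemHardy E f) (hfh : ∀ z, f z = h z * companion E α z) :
    ∃ D : ℝ, 0 ≤ D ∧ ∀ z : ℂ, 1 ≤ ‖z‖ → 0 < z.im → ‖h z‖ * z.im ^ 2 ≤ D * (‖z‖ ^ 2 * √‖z‖) := by
  obtain ⟨C, hC0, hC⟩ := exists_norm_le_mul_norm_companion hE α
  have hN : 0 ≤ norm E f := norm_nonneg'
  refine ⟨2 * C * norm E f, by positivity, fun z hz1 hz => ?_⟩
  have h1 := hf.norm_le hE hr hz
  have hE0 : 0 < ‖E z‖ := norm_pos_iff.2 (hE.ne_zero hr hz.le)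
  have hS : 0 < ‖companion E α z‖ := norm_pos_iff.2 (companion_ne_zero hE α hz.ne')
  have hs : 0 < √z.im := Real.sqrt_pos.2 hz
  rw [norm_div, div_le_iff₀ hE0, hfh, norm_mul] at h1
  have h2 : norm E f / √(Real.pi * z.im) ≤ norm E f / √z.im := by
    refine div_le_div_of_nonneg_left hN hs (Real.sqrt_le_sqrt ?_)
    nlinarith [Real.pi_gt_three]
  have h3 : ‖h z‖ ≤ norm E f / √z.im * (C * ((1 + ‖z‖ ^ 2) / z.im)) := by
    refine le_of_mul_le_mul_right ?_ hS
    calc _ ≤ norm E f / √z.im * ‖E z‖ := h1.trans (mul_le_mul_of_nonneg_right h2 hE0.le)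
      _ ≤ norm E f / √z.im * (C * ((1 + ‖z‖ ^ 2) / z.im) * ‖companion E α z‖) :=
        mul_le_mul_of_nonneg_left (hC z hz) (by positivity)
      _ = _ := by ring
  have h4 : √z.im ≤ √‖z‖ := Real.sqrt_le_sqrt ((le_abs_self _).trans (abs_im_le_norm z))
  calc ‖h z‖ * z.im ^ 2 ≤ norm E f / √z.im * (C * ((1 + ‖z‖ ^ 2) / z.im)) * z.im ^ 2 :=
        mul_le_mul_of_nonneg_right h3 (by positivity)
    _ = C * norm E f * ((1 + ‖z‖ ^ 2) * √z.im) := by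
        have e : z.im = √z.im * √z.im := (Real.mul_self_sqrt hz.le).symm
        generalize √z.im = s at *
        rw [e]
        field_simp
    _ ≤ C * norm E f * ((2 * ‖z‖ ^ 2) * √‖z‖) := by
        refine mul_le_mul_of_nonneg_left ?_ (by positivity)
        refine mul_le_mul ?_ h4 hs.le (by positivity)
        nlinarith
    _ = _ := by ring

/-- Elements of the space vanishing at all points of phase `α` modulo `π` are multiples of the
companion function. -/
theorem MemHardy.exists_eq_const_mul_companion (hE : HermiteBiehler E) (hr : NoRealZeros E)
    {α : ℝ} {f : ℂ → ℂ} (hf : MemHardy E f)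
    (h0 : ∀ x : ℝ, companion E α x = 0 → f x = 0) :
    ∃ c : ℂ, ∀ z, f z = c * companion E α z := by
  obtain ⟨h, hd, hfh⟩ := exists_entire_mul_eq hf.entire (differentiable_companion hE α)
    (fun z hz => deriv_companion_ne_zero hE hr hz) (fun z hz => by
      have e := eq_ofReal_of_companion_eq_zero hE hz
      rw [e] at hz ⊢
      exact h0 _ hz)
  obtain ⟨D, hD0, hD⟩ := exists_norm_mul_sq_le hE hr α hf hfh
  -- The companion is antisymmetric under `star`, so `f^*` has quotient `-h^*`; this carries the
  -- estimate to the lower half-plane.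
  obtain ⟨D', hD'0, hD'⟩ := exists_norm_mul_sq_le hE hr α (h := fun z => -DeBranges.star h z)
    (hf.star hE hr) fun z => by
      have := star_companion (E := E) α z
      rw [neg_mul, ← mul_neg, ← this]
      simp only [DeBranges.star, hfh, map_mul]
  have hbound : ∀ ρ : ℝ, 1 ≤ ρ → ∀ z : ℂ, ‖z‖ ≤ ρ / 2 →
      ‖h z‖ ≤ (D + D') * (ρ ^ 2 * √ρ) * (8 / (3 * ρ)) ^ 2 := by
    intro ρ hρ z hz
    refine norm_le_of_mul_im_pow_le hd (by linarith) (by positivity) two_ne_zero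
      (fun w hw hw0 => ?_) hz
    have hρ0 : 0 ≤ ρ ^ 2 * √ρ := by positivity
    rw [sq_abs]
    rcases lt_or_gt_of_ne hw0 with h1 | h1
    · have := hD' (conj w) (by rw [RCLike.norm_conj, hw]; exact hρ) (by simpa using h1)
      rw [norm_neg, norm_star, conj_conj, conj_im, neg_sq, RCLike.norm_conj, hw] at this
      nlinarith
    · have := hD w (by rw [hw]; exact hρ) h1
      rw [hw] at this
      nlinarith
  refine ⟨h 0, fun z => ?_⟩
  rw [hfh z, eq_const_of_norm_le_sqrt hd (A := (D + D') * (64 / 9) * √2) (fun w => ?_) z]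
  have h1 := hbound (2 * (1 + ‖w‖)) (by linarith [norm_nonneg w]) w (by linarith)
  refine h1.trans (le_of_eq_of_le
    (b := (D + D') * (64 / 9) * √(2 * (1 + ‖w‖))) ?_ ?_)
  · have : 1 + ‖w‖ ≠ 0 := by positivity
    field_simp
    ring
  · rw [Real.sqrt_mul zero_le_two, ← mul_assoc]
    refine mul_le_mul_of_nonneg_left ?_ (by positivity)
    rw [Real.sqrt_le_left (by positivity), add_sq, Real.sq_sqrt (norm_nonneg w)]
    nlinarith [Real.sqrt_nonneg ‖w‖]

/-- The companion function lies in the space for at most one phase modulo `π`. -/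
theorem sin_sub_eq_zero_of_memHardy_companion (hr : NoRealZeros E)
    {α β : ℝ} (hα : MemHardy E (companion E α)) (hβ : MemHardy E (companion E β)) :
    Real.sin (α - β) = 0 := by
  by_contra h0
  -- This combination eliminates `E^*` and leaves `2i sin(α - β) E`, whose quotient by `E` is a
  -- constant and so not in `L²` unless it is zero.
  have h := ((hα.const_mul (exp (-(β * I)))).sub (hβ.const_mul (exp (-(α * I))))).memLp
  have e : (fun t : ℝ => (exp (-(β * I)) * companion E α t - exp (-(α * I)) * companion E β t)
      / E t) = fun _ : ℝ => 2 * I * Real.sin (α - β) := by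
    ext t
    rw [div_eq_iff (hr t), ofReal_sin, Complex.sin, companion, companion]
    have h1 : exp (-(β * I)) * exp (α * I) = exp (((α - β : ℝ) : ℂ) * I) := by
      rw [← exp_add]; congr 1; push_cast; ring
    have h2 : exp (-(α * I)) * exp (β * I) = exp (-((α - β : ℝ) : ℂ) * I) := by
      rw [← exp_add]; congr 1; push_cast; ring
    push_cast at *
    linear_combination E t * h1 - E t * h2 -
      E t * (exp (-((α : ℂ) - β) * I) - exp ((α - β) * I)) * I_sq
  rw [e, memLp_const_iff (by simp) (by simp)] at h
  have h2 : (Real.sin (α - β) : ℂ) ≠ 0 := by exact_mod_cast h0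
  simp [h2, -ofReal_sin] at h

/-- Division by `EF` cancels `F`; for the conjugate function there remains the factor `F^*/F`, of
modulus at most one. -/
theorem MemHardy.mul_right (hF : HermiteBiehler F) (hFr : NoRealZeros F) {f : ℂ → ℂ}
    (hf : MemHardy E f) : MemHardy (fun z => E z * F z) (fun z => f z * F z) where
  entire := hf.entire.mul hF.entire
  memLp := by
    have : (fun t : ℝ => f t * F t / (E t * F t)) = fun t : ℝ => f t / E t := by
      ext t; exact mul_div_mul_right _ _ (hFr t)
    rw [this]
    exact hf.memLp
  bound := by
    obtain ⟨C, hC⟩ := hf.bound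
    refine ⟨C, fun z hz => ?_⟩
    rw [mul_div_mul_right _ _ (hF.ne_zero hFr hz.le)]
    exact hC z hz
  bound_star := by
    obtain ⟨C, hC⟩ := hf.bound_star
    refine ⟨C, fun z hz => ?_⟩
    rw [star_mul, mul_div_mul_comm, norm_mul]
    exact (mul_le_of_le_one_right (norm_nonneg _) (hF.norm_star_div_le hz.le)).trans (hC z hz)

theorem MemHardy.toL2_mul_right (hF : HermiteBiehler F) (hFr : NoRealZeros F) {f : ℂ → ℂ}
    (hf : MemHardy E f) : (hf.mul_right hF hFr).toL2 = hf.toL2 := by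
  rw [MemHardy.toL2_eq_iff]
  exact Eventually.of_forall fun t => mul_div_mul_right _ _ (hFr t)

theorem norm_div_star_le (hF : HermiteBiehler F) {z : ℂ} (hz : z.im ≤ 0) :
    ‖F z / star F z‖ ≤ 1 := by
  have h := hF.norm_star_div_le (z := conj z) (by simpa using hz)
  rwa [norm_div, norm_star, conj_conj, ← norm_star, ← norm_div] at h

/-- The companion function of a product `E F` is not a multiple of `F` by an element of the
space of `E`. -/
theorem companion_toL2_notMem (hE : HermiteBiehler E) (hF : HermiteBiehler F)
    (hEr : NoRealZeros E) (hFr : NoRealZeros F) {α : ℝ}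
    (hS : MemHardy (fun z => E z * F z) (companion (fun z => E z * F z) α)) :
    hS.toL2 ∉ hardySubmodule E := by
  rintro ⟨g, hg, hSg⟩
  rw [MemHardy.toL2_eq_iff] at hSg
  have hcont := (Continuous.ae_eq_iff_eq volume
    (continuous_div_real (hEr.mul hFr) (hE.mul hF) hS.entire)
    (continuous_div_real hEr hE hg.entire)).1 hSg
  have hSeq : companion (fun z => E z * F z) α = fun z => g z * F z := by
    refine eq_of_eq_ofReal hS.entire (hg.entire.mul hF.entire) fun t => ?_
    have := congrFun hcont t
    have h1 := hEr t
    have h2 := hFr t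
    field_simp at this
    rw [this, mul_comm]
  -- Zeros of `F` would be zeros of the companion, hence real, and `F` has no real zeros. So `F/F^*`
  -- is entire.
  have hF0 : ∀ z, F z ≠ 0 := by
    intro z hz
    have h1 : companion (fun z => E z * F z) α z = 0 := by rw [hSeq]; simp [hz]
    have h2 := eq_ofReal_of_companion_eq_zero (hE.mul hF) h1
    rw [h2] at hz
    exact hFr _ hz
  have hF0' : ∀ z, star F z ≠ 0 := fun z => by simpa [star] using hF0 (conj z)
  set W : ℂ → ℂ := fun z => F z / star F z with hW
  have hWd : Differentiable ℂ W := fun z =>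
    (hF.entire z).div (differentiable_star hF.entire z) (hF0' z)
  obtain ⟨C, hC⟩ := hg.bound_star
  have hC0 : 0 ≤ C := by
    have := (norm_nonneg _).trans (hC I (by simp))
    simpa using this
  -- Applying `star` to `S = gF` and dividing by `EF^*` gives `e^{iα}F/F^* = e^{-iα}E^*/E - g^*/E`.
  -- In the lower half-plane `|W| ≤ 1` directly.
  have hup : ∀ z : ℂ, 0 < z.im → ‖W z‖ ≤ C / √z.im + 1 := by
    intro z hz
    have hEz := hE.ne_zero hEr hz.le
    have h1 : star g z * star F z = -companion (fun z => E z * F z) α z := by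
      rw [← star_companion, hSeq, star_mul]
    rw [companion, star_mul] at h1
    have h2 : exp (α * I) * W z = exp (-(α * I)) * (star E z / E z) - star g z / E z := by
      have := hF0' z
      simp only [hW]
      field_simp
      linear_combination h1
    have h3 : ‖W z‖ = ‖exp (-(α * I)) * (star E z / E z) - star g z / E z‖ := by
      rw [← h2, norm_mul, norm_exp_ofReal_mul_I, one_mul]
    rw [h3]
    refine (norm_sub_le _ _).trans ?_
    rw [norm_mul, norm_exp_neg_mul_I, one_mul]
    linarith [hC z hz, hE.norm_star_div_le hz.le]
  have hbound : ∀ z : ℂ, ‖W z‖ ≤ (C + 1) * (8 / 3) := by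
    intro z
    set ρ := 2 * (1 + ‖z‖) with hρ
    have hρ1 : 1 ≤ ρ := by rw [hρ]; linarith [norm_nonneg z]
    have := norm_le_of_mul_im_pow_le hWd (ρ := ρ) (D := (C + 1) * ρ) (m := 1) (by linarith)
      (by positivity) one_ne_zero (fun w hw hw0 => ?_) (z := z) (by rw [hρ]; linarith)
    · refine this.trans (le_of_eq ?_)
      have : ρ ≠ 0 := by linarith
      field_simp
    rw [pow_one]
    have him : |w.im| ≤ ρ := hw ▸ abs_im_le_norm w
    rcases lt_or_gt_of_ne hw0 with h1 | h1
    · have h2 := norm_div_star_le hF h1.le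
      calc ‖W w‖ * |w.im| ≤ 1 * ρ := mul_le_mul h2 him (abs_nonneg _) zero_le_one
        _ ≤ _ := by nlinarith
    · rw [abs_of_pos h1] at him ⊢
      have hs : 0 < √w.im := Real.sqrt_pos.2 h1
      calc ‖W w‖ * w.im ≤ (C / √w.im + 1) * w.im := mul_le_mul_of_nonneg_right (hup w h1) h1.le
        _ = C * √w.im + w.im := by
          have e : w.im = √w.im * √w.im := (Real.mul_self_sqrt h1.le).symm
          generalize √w.im = s at *
          rw [e]
          field_simp
        _ ≤ C * ρ + ρ := by
          refine add_le_add (mul_le_mul_of_nonneg_left ?_ hC0) him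
          rw [Real.sqrt_le_left (by linarith)]
          nlinarith
        _ = _ := by ring
  -- A bounded entire `W` is constant, but `|W(0)| ≤ 1` while `|W(i)| > 1` by the strict
  -- Hermite–Biehler inequality.
  have hconst := eq_const_of_norm_le_sqrt hWd (A := (C + 1) * (8 / 3)) (fun z =>
    (hbound z).trans (le_mul_of_one_le_right (by positivity)
      (by linarith [Real.sqrt_nonneg ‖z‖]))) I
  have h1 : ‖W 0‖ ≤ 1 := norm_div_star_le hF (by simp)
  have h2 := hF.norm_star_div_lt (z := I) (by simp)
  rw [norm_div, div_lt_one (norm_pos_iff.2 (hF0 I))] at h2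
  rw [← hconst] at h1
  simp only [hW] at h1
  rw [norm_div, div_le_one (norm_pos_iff.2 (hF0' I))] at h1
  linarith

end Companion

/-! ### Two facts on orthonormal expansions and angles in Hilbert space. -/

section Hilbert

variable {H ι : Type*} [NormedAddCommGroup H] [InnerProductSpace ℂ H] [CompleteSpace H]

/-- Decomposition of a vector into its orthonormal expansion and a remainder. -/
theorem exists_orthonormal_remainder {e : ι → H} (he : Orthonormal ℂ e) {V : Submodule ℂ H}
    (hV : IsClosed (V : Set H)) (heV : ∀ i, e i ∈ V) {v : H} (hv : v ∈ V) :
    ∃ r ∈ V, (∀ i, inner ℂ (e i) r = 0) ∧ inner ℂ r v = ((‖r‖ ^ 2 : ℝ) : ℂ) ∧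
      ∑' i, ‖inner ℂ (e i) v‖ ^ 2 = ‖v‖ ^ 2 - ‖r‖ ^ 2 := by
  classical
  have hsum : Summable fun i => inner ℂ (e i) v • e i :=
    (he.orthogonalFamily.summable_iff_norm_sq_summable fun i => inner ℂ (e i) v).2
      (he.inner_products_summable v)
  obtain ⟨p, hp⟩ := hsum
  have hpV : p ∈ V := hV.mem_of_tendsto hp
    (Eventually.of_forall fun s => V.sum_mem fun i _ => V.smul_mem _ (heV i))
  have hinner : ∀ i, inner ℂ (e i) p = inner ℂ (e i) v := by
    intro i
    have h1 := hp.mapL (innerSL ℂ (e i))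
    refine h1.unique ?_
    have h2 : (fun j => innerSL ℂ (e i) (inner ℂ (e j) v • e j)) =
        fun j => if j = i then inner ℂ (e i) v else 0 := by
      ext j
      rw [innerSL_apply_apply, inner_smul_right, orthonormal_iff_ite.1 he i j]
      by_cases h : j = i
      · simp [h]
      · simp [h, Ne.symm h]
    rw [h2]
    exact hasSum_ite_eq i (inner ℂ (e i) v)
  have hr : ∀ i, inner ℂ (e i) (v - p) = 0 := fun i => by
    rw [inner_sub_right, hinner, sub_self]
  have hrp : inner ℂ (v - p) p = 0 := by
    refine (hp.mapL (innerSL ℂ (v - p))).unique ?_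
    convert hasSum_zero with j
    rw [innerSL_apply_apply, inner_smul_right, ← inner_conj_symm (v - p), hr, map_zero, mul_zero]
  have hpr : inner ℂ p (v - p) = 0 := by rw [← inner_conj_symm, hrp, map_zero]
  have hself : inner ℂ (v - p) (v - p) = ((‖v - p‖ ^ 2 : ℝ) : ℂ) := by
    rw [inner_self_eq_norm_sq_to_K]; push_cast; rfl
  refine ⟨v - p, V.sub_mem hv hpV, hr, ?_, ?_⟩
  · rw [← hself, inner_sub_right _ v p, hrp, sub_zero]
  · have h1 : HasSum (fun i => ((‖inner ℂ (e i) v‖ ^ 2 : ℝ) : ℂ)) (inner ℂ v p) := by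
      have e1 : (fun i => ((‖inner ℂ (e i) v‖ ^ 2 : ℝ) : ℂ)) =
          fun i => innerSL ℂ v (inner ℂ (e i) v • e i) := by
        ext i
        rw [innerSL_apply_apply, inner_smul_right, ← inner_conj_symm v (e i), mul_conj,
          normSq_eq_norm_sq]
      rw [e1]
      exact hp.mapL (innerSL ℂ v)
    have h2 : inner ℂ v p = ((‖p‖ ^ 2 : ℝ) : ℂ) := by
      have e1 : inner ℂ p p = ((‖p‖ ^ 2 : ℝ) : ℂ) := by
        rw [inner_self_eq_norm_sq_to_K]; push_cast; rfl
      rw [← e1]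
      rw [inner_sub_left, sub_eq_zero] at hrp
      exact hrp
    rw [h2, hasSum_ofReal] at h1
    rw [h1.tsum_eq]
    have h3 := norm_add_sq_eq_norm_sq_add_norm_sq_of_inner_eq_zero p (v - p) hpr
    rw [add_sub_cancel] at h3
    nlinarith

/-- The angle between a closed subspace and a vector outside of it is positive. -/
theorem exists_norm_sq_le_of_notMem {W : Submodule ℂ H} (hW : IsClosed (W : Set H)) {s : H}
    (hs : s ∉ W) :
    ∃ δ : ℝ, 0 < δ ∧ ∀ v ∈ W, ∀ c : ℂ, inner ℂ (c • s) v = ((‖c • s‖ ^ 2 : ℝ) : ℂ) →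
      ‖c • s‖ ^ 2 ≤ (1 - δ) * ‖v‖ ^ 2 := by
  have : CompleteSpace W := hW.completeSpace_coe
  have hs0 : 0 < ‖s‖ := norm_pos_iff.2 fun h => hs (h ▸ W.zero_mem)
  have hlt : ‖W.starProjection s‖ < ‖s‖ :=
    lt_of_le_of_ne (W.norm_starProjection_apply_le s)
      fun h => hs ((W.mem_iff_norm_starProjection s).2 h)
  -- The cosine of the angle between `s` and `W`. Projecting `s` onto `W` gives `‖c s‖² = |⟨c s, v⟩|
  -- ≤ θ‖c s‖‖v‖`.
  set θ := ‖W.starProjection s‖ / ‖s‖ with hθ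
  have hθ0 : 0 ≤ θ := by positivity
  have hθ1 : θ < 1 := (div_lt_one hs0).2 hlt
  refine ⟨1 - θ ^ 2, by nlinarith, fun v hv c hc => ?_⟩
  have h1 : ‖c • s‖ ^ 2 ≤ ‖c • s‖ * (θ * ‖v‖) := by
    have h2 : inner ℂ s v = inner ℂ (W.starProjection s) v := by
      rw [W.inner_starProjection_left_eq_right, W.starProjection_eq_self_iff.2 hv]
    have h3 := congrArg (‖·‖) hc
    simp only [inner_smul_left, norm_mul, RCLike.norm_conj, norm_real, norm_pow, norm_norm] at h3
    rw [← h3, h2, norm_smul]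
    calc ‖c‖ * ‖inner ℂ (W.starProjection s) v‖ ≤ ‖c‖ * (‖W.starProjection s‖ * ‖v‖) :=
          mul_le_mul_of_nonneg_left (norm_inner_le_norm _ _) (norm_nonneg _)
      _ = _ := by rw [hθ]; field_simp
  have h4 : ‖c • s‖ ≤ θ * ‖v‖ := by
    rcases (norm_nonneg (c • s)).eq_or_lt with h | h
    · rw [← h]; positivity
    · rw [pow_two] at h1
      exact le_of_mul_le_mul_left h1 h
  calc ‖c • s‖ ^ 2 ≤ (θ * ‖v‖) ^ 2 := pow_le_pow_left₀ (norm_nonneg _) h4 2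
    _ = _ := by ring

end Hilbert

/-! ### Orthonormal kernels, sampling in the product space, comparison of kernels. -/

section Sampling

variable {E F f : ℂ → ℂ}

theorem memHardy_kernel (hE : HermiteBiehler E) (hr : NoRealZeros E) (x : ℝ) :
    MemHardy E (kernel E x) := (memSpace_kernel hE hr x).memHardy hE hr

theorem inner_kernel_toL2 (hE : HermiteBiehler E) (hr : NoRealZeros E) (hf : MemHardy E f)
    (x : ℝ) : inner ℂ (memHardy_kernel hE hr x).toL2 hf.toL2 = f x := by
  rw [MemHardy.inner_toL2, hf.reproducing hE hr]

/-- The normalized reproducing kernel at a real point, as an element of `L²(ℝ)`. -/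
noncomputable def unitKernel (hE : HermiteBiehler E) (hr : NoRealZeros E) (x : ℝ) :
    Lp ℂ 2 (volume : Measure ℝ) :=
  ((norm E (kernel E x) : ℂ)⁻¹) • (memHardy_kernel hE hr x).toL2

theorem unitKernel_mem (hE : HermiteBiehler E) (hr : NoRealZeros E) (x : ℝ) :
    unitKernel hE hr x ∈ hardySubmodule E :=
  Submodule.smul_mem _ _ (memHardy_kernel hE hr x).toL2_mem

theorem inner_unitKernel (hE : HermiteBiehler E) (hr : NoRealZeros E) (hf : MemHardy E f)
    (x : ℝ) : inner ℂ (unitKernel hE hr x) hf.toL2 = (norm E (kernel E x) : ℂ)⁻¹ * f x := by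
  rw [unitKernel, inner_smul_left, inner_kernel_toL2 hE hr, map_inv₀, conj_ofReal]

theorem norm_inner_unitKernel_sq (hE : HermiteBiehler E) (hr : NoRealZeros E) (hf : MemHardy E f)
    (x : ℝ) : ‖inner ℂ (unitKernel hE hr x) hf.toL2‖ ^ 2 = ‖f x‖ ^ 2 / (kernel E x x).re := by
  rw [inner_unitKernel, norm_mul, norm_inv, norm_real, mul_pow, inv_pow, Real.norm_eq_abs, sq_abs,
    sq_norm, kernel_self_re hE hr, div_eq_inv_mul]

theorem norm_kernel_pos (hE : HermiteBiehler E) (hr : NoRealZeros E) (x : ℝ) :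
    0 < norm E (kernel E x) := by
  rw [norm, ← kernel_self_re hE hr]
  exact Real.sqrt_pos.2 (kernel_self_re_pos hE hr x)

theorem norm_unitKernel (hE : HermiteBiehler E) (hr : NoRealZeros E) (x : ℝ) :
    ‖unitKernel hE hr x‖ = 1 := by
  have h := norm_kernel_pos hE hr x
  rw [unitKernel, norm_smul, MemHardy.norm_toL2, norm_inv, norm_real, Real.norm_of_nonneg h.le,
    inv_mul_cancel₀ h.ne']

theorem kernel_eq_zero_of_companion_eq_zero (hr : NoRealZeros E) {α x y : ℝ} (hxy : y ≠ x)
    (hx : companion E α x = 0) (hy : companion E α y = 0) : kernel E x y = 0 := by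
  obtain ⟨c, hc, h⟩ := companion_eq_of_eq_zero hr hx
  rw [h y] at hy
  have h1 : (y : ℂ) - x ≠ 0 := by rw [← ofReal_sub]; exact_mod_cast sub_ne_zero.2 hxy
  simpa [hc, h1] using hy

theorem orthonormal_unitKernel (hE : HermiteBiehler E) (hr : NoRealZeros E) {α : ℝ} {ι : Type*}
    {lam : ι → ℝ} (hinj : Function.Injective lam) (hz : ∀ i, companion E α (lam i) = 0) :
    Orthonormal ℂ fun i => unitKernel hE hr (lam i) := by
  refine ⟨fun i => norm_unitKernel hE hr _, fun i j hij => ?_⟩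
  simp only [unitKernel]
  rw [inner_smul_left, inner_smul_right, inner_kernel_toL2 hE hr,
    kernel_eq_zero_of_companion_eq_zero hr (fun h => hij (hinj h)) (hz j) (hz i)]
  simp

/-- Sampling in the space of `E`, viewed inside the space of `E F` through multiplication
by `F`, at the points of phase `α` modulo `π` of `E F`. -/
theorem exists_sampling_mul (hE : HermiteBiehler E) (hF : HermiteBiehler F)
    (hEr : NoRealZeros E) (hFr : NoRealZeros F) {φ : ℝ → ℝ}
    (hφ : IsPhase (fun z => E z * F z) φ) :
    ∃ δ : ℝ, 0 < δ ∧ ∀ α ∈ Ico (0 : ℝ) Real.pi,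
      ∀ lam : {n : ℤ // ∃ x : ℝ, φ x = n * Real.pi + α} → ℝ,
        (∀ n, φ (lam n) = (n : ℤ) * Real.pi + α) → ∀ f, MemHardy E f →
          Summable (fun n => ‖f (lam n) * F (lam n)‖ ^ 2 /
            (kernel (fun z => E z * F z) (lam n) (lam n)).re) ∧
          δ * norm E f ^ 2 ≤ ∑' n, ‖f (lam n) * F (lam n)‖ ^ 2 /
            (kernel (fun z => E z * F z) (lam n) (lam n)).re ∧
          ∑' n, ‖f (lam n) * F (lam n)‖ ^ 2 /
            (kernel (fun z => E z * F z) (lam n) (lam n)).re ≤ norm E f ^ 2 := by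
  set P : ℂ → ℂ := fun z => E z * F z with hP
  have hPE : HermiteBiehler P := hE.mul hF
  have hPr : NoRealZeros P := hEr.mul hFr
  -- One `δ` serves all phases: at most one `α` in `[0, π)` has its companion in the space. That
  -- phase determines `δ`; for the others only `c = 0` occurs.
  have hδ : ∃ δ : ℝ, 0 < δ ∧ ∀ α ∈ Ico (0 : ℝ) Real.pi, ∀ c : ℂ, ∀ v ∈ hardySubmodule E,
      ∀ hcS : MemHardy P (fun z => c * companion P α z),
        inner ℂ hcS.toL2 v = ((‖hcS.toL2‖ ^ 2 : ℝ) : ℂ) →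
          ‖hcS.toL2‖ ^ 2 ≤ (1 - δ) * ‖v‖ ^ 2 := by
    have hdiv : ∀ {α : ℝ} {c : ℂ}, c ≠ 0 → MemHardy P (fun z => c * companion P α z) →
        MemHardy P (companion P α) := fun {α c} hc h => by
      have := h.const_mul c⁻¹
      simpa only [inv_mul_cancel_left₀ hc] using this
    have hzero : ∀ {α : ℝ} {c : ℂ} (h : MemHardy P (fun z => c * companion P α z)), c = 0 →
        ‖h.toL2‖ = 0 := fun {α c} h hc => by
      subst hc
      rw [h.norm_toL2]
      simp [norm, normSq]
    by_cases hex : ∃ α ∈ Ico (0 : ℝ) Real.pi, MemHardy P (companion P α)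
    · obtain ⟨α, hα, hS⟩ := hex
      obtain ⟨δ, hδ0, hδ⟩ := exists_norm_sq_le_of_notMem (isClosed_hardySubmodule hE hEr)
        (companion_toL2_notMem hE hF hEr hFr hS)
      refine ⟨min δ 1, by positivity, fun β hβ c v hv hcS hin => ?_⟩
      by_cases hc : c = 0
      · rw [hzero hcS hc, zero_pow two_ne_zero]
        exact mul_nonneg (sub_nonneg.2 (min_le_right _ _)) (by positivity)
      have hsin := sin_sub_eq_zero_of_memHardy_companion hPr hS (hdiv hc hcS)
      have hαβ : α = β := by
        rw [Real.sin_eq_zero_iff_of_lt_of_lt (by linarith [hα.1, hβ.2])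
          (by linarith [hα.2, hβ.1])] at hsin
        linarith
      subst hαβ
      have he : hcS.toL2 = c • hS.toL2 := hS.toL2_const_mul c
      rw [he] at hin ⊢
      refine (hδ v hv c hin).trans (mul_le_mul_of_nonneg_right ?_ (by positivity))
      linarith [min_le_left δ 1]
    · refine ⟨1, one_pos, fun α hα c v hv hcS hin => ?_⟩
      by_cases hc : c = 0
      · rw [hzero hcS hc]; simp
      · exact (hex ⟨α, hα, hdiv hc hcS⟩).elim
  obtain ⟨δ, hδ0, hδ⟩ := hδ
  refine ⟨δ, hδ0, fun α hα lam hlam f hf => ?_⟩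
  have hfF := hf.mul_right hF hFr
  have hnorm : ‖hfF.toL2‖ = norm E f := by
    rw [hf.toL2_mul_right hF hFr, hf.norm_toL2]
  have hinj : Function.Injective lam := fun n m h => by
    have h1 := hlam n
    rw [h, hlam m, add_left_inj] at h1
    exact Subtype.ext (by exact_mod_cast (mul_right_cancel₀ Real.pi_ne_zero h1).symm)
  have hz : ∀ n, companion P α (lam n) = 0 := fun n =>
    (companion_ofReal_eq_zero_iff hPr hφ α _).2 ⟨n, hlam n⟩
  have ho := orthonormal_unitKernel hPE hPr hinj hz
  have hterm : ∀ n, ‖f (lam n) * F (lam n)‖ ^ 2 / (kernel P (lam n) (lam n)).re =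
      ‖inner ℂ (unitKernel hPE hPr (lam n)) hfF.toL2‖ ^ 2 := fun n =>
    (norm_inner_unitKernel_sq hPE hPr hfF (lam n)).symm
  simp only [hterm]
  refine ⟨ho.inner_products_summable _, ?_, ?_⟩
  -- The remainder vanishes at every sampling point, so it is a multiple of the companion, and `hδ`
  -- bounds its share of the norm.
  · obtain ⟨r, ⟨g, hg, hrg⟩, hr0, hrv, hsum⟩ := exists_orthonormal_remainder ho
      (isClosed_hardySubmodule hPE hPr) (fun n => unitKernel_mem hPE hPr (lam n)) hfF.toL2_mem
    rw [hsum, hnorm]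
    obtain ⟨c, hc⟩ := hg.exists_eq_const_mul_companion hPE hPr (α := α) fun x hx => by
      obtain ⟨n, hn⟩ := (companion_ofReal_eq_zero_iff hPr hφ α x).1 hx
      have hxn : x = lam ⟨n, x, hn⟩ := hφ.strictMono.injective (by rw [hn, hlam])
      have h1 := hr0 ⟨n, x, hn⟩
      rw [hrg, inner_unitKernel, ← hxn] at h1
      have h2 : (norm P (kernel P x) : ℂ) ≠ 0 := by
        exact_mod_cast (norm_kernel_pos hPE hPr x).ne'
      simpa [h2] using h1
    obtain rfl : g = fun z => c * companion P α z := funext hc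
    rw [hrg] at hrv ⊢
    rw [hf.toL2_mul_right hF hFr] at hrv
    have := hδ α hα c _ hf.toL2_mem hg hrv
    rw [hf.norm_toL2] at this
    linarith
  · rw [← hnorm]
    exact ho.tsum_inner_products_le _

/-- Comparison of the reproducing kernels of two spaces, one included in the other. -/
theorem kernel_self_re_le {E₁ E₂ : ℂ → ℂ} (h₁ : HermiteBiehler E₁) (h₁r : NoRealZeros E₁)
    (h₂ : HermiteBiehler E₂) (h₂r : NoRealZeros E₂) (hsub : space E₁ ⊆ space E₂) {C : ℝ}
    (hle : ∀ f ∈ space E₁, norm E₂ f ≤ C * norm E₁ f) (x : ℝ) :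
    (kernel E₁ x x).re ≤ C ^ 2 * (kernel E₂ x x).re := by
  have hk : kernel E₁ x ∈ space E₁ := memSpace_kernel h₁ h₁r x
  have hk2 : MemHardy E₂ (kernel E₁ x) := (hsub hk).memHardy h₂ h₂r
  -- With `k₁`, `k₂` the kernels at `x`, reproducing `k₁` in the second space gives `‖k₁‖₁² = |⟨k₂,
  -- k₁⟩₂| ≤ C‖k₂‖₂‖k₁‖₁`; then cancel `‖k₁‖₁`.
  have h1 := norm_inner_le_norm (𝕜 := ℂ) (memHardy_kernel h₂ h₂r x).toL2 hk2.toL2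
  rw [inner_kernel_toL2 h₂ h₂r, MemHardy.norm_toL2, MemHardy.norm_toL2] at h1
  have h2 := h1.trans (mul_le_mul_of_nonneg_left (hle _ hk) norm_nonneg')
  have h3 : ‖kernel E₁ x x‖ = norm E₁ (kernel E₁ x) * norm E₁ (kernel E₁ x) := by
    rw [kernel_self_eq h₁ h₁r, norm_real, Real.norm_of_nonneg normSq_nonneg', ← sq_norm, pow_two]
  have hpos := norm_kernel_pos h₁ h₁r x
  rw [h3, ← mul_assoc] at h2
  have h4 := le_of_mul_le_mul_right h2 hpos
  rw [kernel_self_re h₁ h₁r, kernel_self_re h₂ h₂r, ← sq_norm, ← sq_norm, ← mul_pow, mul_comm C]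
  exact pow_le_pow_left₀ hpos.le h4 2

end Sampling

theorem le_kernel_mul_self_re {E F : ℂ → ℂ} (hE : HermiteBiehler E) (hF : HermiteBiehler F)
    (hFr : NoRealZeros F) (x : ℝ) :
    ‖F x‖ ^ 2 * (kernel E x x).re ≤ (kernel (fun z => E z * F z) x x).re := by
  rw [kernel_mul_self_re hE hF]
  have := kernel_self_re_pos hF hFr x
  exact le_add_of_nonneg_right (by positivity)

/-- A bound for the ratio of the phase derivatives bounds the reproducing kernel of the
product. -/
theorem kernel_mul_self_re_le {E F : ℂ → ℂ} (hE : HermiteBiehler E) (hF : HermiteBiehler F)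
    (hEr : NoRealZeros E) (hFr : NoRealZeros F) {φE φF : ℝ → ℝ} (hφE : IsPhase E φE)
    (hφF : IsPhase F φF) {M x : ℝ} (hM : deriv φF x ≤ M * deriv φE x) :
    (kernel (fun z => E z * F z) x x).re ≤ (1 + M) * (‖F x‖ ^ 2 * (kernel E x x).re) := by
  rw [(hφE.hasDerivAt hE hEr x).deriv, (hφF.hasDerivAt hF hFr x).deriv] at hM
  have hEx : 0 < ‖E x‖ := norm_pos_iff.2 (hEr x)
  have hFx : 0 < ‖F x‖ := norm_pos_iff.2 (hFr x)
  rw [kernel_mul_self_re hE hF]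
  rw [← mul_div_assoc, div_le_div_iff₀ (by positivity) (by positivity)] at hM
  have h1 : Real.pi * (‖E x‖ ^ 2 * (kernel F x x).re) ≤
      Real.pi * (M * (‖F x‖ ^ 2 * (kernel E x x).re)) := by linarith
  have := le_of_mul_le_mul_left h1 Real.pi_pos
  linarith

/-- Both phase derivatives are strictly positive, so positivity of the constant need not be assumed.
-/
theorem phase_ratio_pos {E F : ℂ → ℂ} (hE : HermiteBiehler E) (hF : HermiteBiehler F)
    (hEr : NoRealZeros E) (hFr : NoRealZeros F) {φE φF : ℝ → ℝ} (hφE : IsPhase E φE)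
    (hφF : IsPhase F φF) {M x : ℝ} (hM : deriv φF x ≤ M * deriv φE x) : 0 < M := by
  rw [(hφE.hasDerivAt hE hEr x).deriv, (hφF.hasDerivAt hF hFr x).deriv] at hM
  have hEx : 0 < ‖E x‖ := norm_pos_iff.2 (hEr x)
  have hFx : 0 < ‖F x‖ := norm_pos_iff.2 (hFr x)
  have h1 := kernel_self_re_pos hE hEr x
  have h2 := kernel_self_re_pos hF hFr x
  have h3 : 0 < Real.pi * (kernel F x x).re / ‖F x‖ ^ 2 := by positivity
  exact pos_of_mul_pos_left (h3.trans_le hM) (by positivity)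

end DeBranges

/-! ### The sampling theorem. -/

theorem mainTheorem2
    (E₀ E F : ℂ → ℂ)
    (hE₀ : DeBranges.HermiteBiehler E₀) (hE : DeBranges.HermiteBiehler E)
    (hF : DeBranges.HermiteBiehler F)
    (hE₀r : DeBranges.NoRealZeros E₀) (hEr : DeBranges.NoRealZeros E)
    (hFr : DeBranges.NoRealZeros F)
    (hsame : DeBranges.SameSpace E₀ E)
    (φE φF φEF : ℝ → ℝ)
    (hφE : DeBranges.IsPhase E φE) (hφF : DeBranges.IsPhase F φF)
    (hφEF : DeBranges.IsPhase (fun z => E z * F z) φEF)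
    (hφ : ∃ C : ℝ, ∀ x : ℝ, deriv φF x ≤ C * deriv φE x) :
    ∃ A B : ℝ, ∀ α ∈ Set.Ico (0 : ℝ) Real.pi,
      ∀ lam : {n : ℤ // ∃ x : ℝ, φEF x = n * Real.pi + α} → ℝ,
        (∀ n, φEF (lam n) = (n : ℤ) * Real.pi + α) →
          DeBranges.NormalizedSamplingWith E₀ lam A B := by
  open DeBranges in
  obtain ⟨hspace, c, C, hc, hC, hcC⟩ := hsame
  obtain ⟨M, hM⟩ := hφ
  have hM0 : 0 < M := phase_ratio_pos hE hF hEr hFr hφE hφF (hM 0)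
  obtain ⟨δ, hδ0, hδ⟩ := exists_sampling_mul hE hF hEr hFr hφEF
  -- Exchanging the weights costs `C⁻²` below and `(1 + M)c⁻²` above; passing between the two norms
  -- contributes `c²` and `C²`.
  refine ⟨(C ^ 2)⁻¹ * (δ * c ^ 2), (c ^ 2)⁻¹ * (1 + M) * C ^ 2, fun α hα lam hlam =>
    ⟨by positivity, by positivity, fun f hf => ?_⟩⟩
  have hfE : MemSpace E f := by rw [hspace] at hf; exact hf
  obtain ⟨hs, hlow, hupp⟩ := hδ α hα lam hlam f (hfE.memHardy hE hEr)
  have hN0 : 0 ≤ DeBranges.norm E₀ f := norm_nonneg'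
  have hN : 0 ≤ DeBranges.norm E f := norm_nonneg'
  obtain ⟨hcf, hCf⟩ := hcC f hf
  have hcf2 : c ^ 2 * DeBranges.norm E₀ f ^ 2 ≤ DeBranges.norm E f ^ 2 := by
    rw [← mul_pow]; exact pow_le_pow_left₀ (by positivity) hcf 2
  have hCf2 : DeBranges.norm E f ^ 2 ≤ C ^ 2 * DeBranges.norm E₀ f ^ 2 := by
    rw [← mul_pow]; exact pow_le_pow_left₀ hN hCf 2
  have hK : ∀ x : ℝ, (kernel E₀ x x).re ≤ C ^ 2 * (kernel E x x).re :=
    kernel_self_re_le hE₀ hE₀r hE hEr hspace.le fun f hf => (hcC f hf).2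
  have hK' : ∀ x : ℝ, (kernel E x x).re ≤ (c⁻¹) ^ 2 * (kernel E₀ x x).re :=
    kernel_self_re_le hE hEr hE₀ hE₀r hspace.ge fun f hf => by
      rw [le_inv_mul_iff₀ hc]
      exact (hcC f (hspace ▸ hf)).1
  have hpos : ∀ n, 0 < (kernel E₀ (lam n) (lam n)).re := fun n => kernel_self_re_pos hE₀ hE₀r _
  have hpos' : ∀ n, 0 < (kernel E (lam n) (lam n)).re := fun n => kernel_self_re_pos hE hEr _
  have hposEF : ∀ n, 0 < (kernel (fun z => E z * F z) (lam n) (lam n)).re := fun n =>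
    kernel_self_re_pos (hE.mul hF) (hEr.mul hFr) _
  have hF0 : ∀ n, 0 < ‖F (lam n)‖ := fun n => norm_pos_iff.2 (hFr _)
  have hle : ∀ n, ‖f (lam n)‖ ^ 2 / (kernel E₀ (lam n) (lam n)).re ≤
      (c ^ 2)⁻¹ * (1 + M) * (‖f (lam n) * F (lam n)‖ ^ 2 /
        (kernel (fun z => E z * F z) (lam n) (lam n)).re) := fun n => by
    have h1 := kernel_mul_self_re_le hE hF hEr hFr hφE hφF (hM (lam n))
    have h2 := hK' (lam n)
    rw [inv_pow] at h2
    have h3 : (kernel (fun z => E z * F z) (lam n) (lam n)).re ≤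
        (c ^ 2)⁻¹ * (1 + M) * ‖F (lam n)‖ ^ 2 * (kernel E₀ (lam n) (lam n)).re := by
      refine h1.trans ?_
      rw [← mul_assoc]
      refine (mul_le_mul_of_nonneg_left h2 (by positivity)).trans (le_of_eq (by ring))
    rw [norm_mul, mul_pow, ← mul_div_assoc, div_le_div_iff₀ (hpos n) (hposEF n)]
    calc _ ≤ ‖f (lam n)‖ ^ 2 *
        ((c ^ 2)⁻¹ * (1 + M) * ‖F (lam n)‖ ^ 2 * (kernel E₀ (lam n) (lam n)).re) :=
          mul_le_mul_of_nonneg_left h3 (by positivity)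
      _ = _ := by ring
  have hge : ∀ n, (C ^ 2)⁻¹ * (‖f (lam n) * F (lam n)‖ ^ 2 /
        (kernel (fun z => E z * F z) (lam n) (lam n)).re) ≤
      ‖f (lam n)‖ ^ 2 / (kernel E₀ (lam n) (lam n)).re := fun n => by
    have h1 := le_kernel_mul_self_re hE hF hFr (lam n)
    have h2 := hK (lam n)
    have h3 : ‖F (lam n)‖ ^ 2 * (kernel E₀ (lam n) (lam n)).re ≤
        C ^ 2 * (kernel (fun z => E z * F z) (lam n) (lam n)).re :=
      calc _ ≤ ‖F (lam n)‖ ^ 2 * (C ^ 2 * (kernel E (lam n) (lam n)).re) :=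
            mul_le_mul_of_nonneg_left h2 (by positivity)
        _ = C ^ 2 * (‖F (lam n)‖ ^ 2 * (kernel E (lam n) (lam n)).re) := by ring
        _ ≤ _ := mul_le_mul_of_nonneg_left h1 (by positivity)
    rw [inv_mul_le_iff₀ (by positivity), norm_mul, mul_pow, ← mul_div_assoc,
      div_le_div_iff₀ (hposEF n) (hpos n)]
    calc _ = ‖f (lam n)‖ ^ 2 * (‖F (lam n)‖ ^ 2 * (kernel E₀ (lam n) (lam n)).re) := by ring
      _ ≤ ‖f (lam n)‖ ^ 2 * (C ^ 2 * (kernel (fun z => E z * F z) (lam n) (lam n)).re) :=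
        mul_le_mul_of_nonneg_left h3 (by positivity)
      _ = _ := by ring
  have hs0 : Summable fun n => ‖f (lam n)‖ ^ 2 / (kernel E₀ (lam n) (lam n)).re :=
    Summable.of_nonneg_of_le (fun n => div_nonneg (by positivity) (hpos n).le) hle
      (hs.mul_left _)
  refine ⟨hs0, ?_, ?_⟩
  · calc _ = (C ^ 2)⁻¹ * (δ * (c ^ 2 * DeBranges.norm E₀ f ^ 2)) := by ring
      _ ≤ (C ^ 2)⁻¹ * (δ * DeBranges.norm E f ^ 2) := by gcongr
      _ ≤ _ := mul_le_mul_of_nonneg_left hlow (by positivity)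
      _ = _ := tsum_mul_left.symm
      _ ≤ _ := (hs.mul_left _).tsum_le_tsum hge hs0
  · calc _ ≤ _ := hs0.tsum_le_tsum hle (hs.mul_left _)
      _ = _ := tsum_mul_left
      _ ≤ (c ^ 2)⁻¹ * (1 + M) * DeBranges.norm E f ^ 2 :=
        mul_le_mul_of_nonneg_left hupp (by positivity)
      _ ≤ (c ^ 2)⁻¹ * (1 + M) * (C ^ 2 * DeBranges.norm E₀ f ^ 2) := by gcongr
      _ = _ := by ring
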